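/- **Theorem (Well-posedness of the two-field $hp$-HDG formulation, partial coercivity).** Let $d\ge 2$ and let $\Omega\subset\mathbb R^d$ be a nonempty, connected open set with $\Omega=\operatorname{int}\overline\Omega$ (for instance a Lipschitz domain), partitioned into finitely many open simplices $K\in\mathcal T_h$ that are pairwise disjoint and satisfy $\bigcup_K\overline K=\overline\Omega$ (hanging nodes allowed). Let $\partial\Omega=\Gamma_D\cup\Gamma_N\cup\Gamma_R$ be a disjoint decomposition into measurable (possibly empty) parts, and let $p_K\ge 0$ be integers. Mortars are the sets of positive $(d-1)$-dimensional measure of the form $e=F\cap F'$ ($F,F'$ faces of two different elements), with degree $p_e=\max(p_K,p_{K'})$, and $e=F\cap\Gamma_X$, $X\in\{D,N,R\}$, with $p_e=p_K$ ($K$ the element of $F$); $\mathcal E_h$ is the set of all mortars. Let $V_h$ be the space of functions on $\mathcal T_h$ that are polynomials of total degree $\le p_K$ on each $K$, and $\Lambda_h$ the space of functions on $\mathcal E_h$ that are restrictions of polynomials of degree $\le p_e$ on each $e$. Write $\langle\cdot,\cdot\rangle_{\partial\mathcal T_h}=\sum_K\sum_{F\subset\partial K}\sum_{e\subset F}\langle\cdot,\cdot\rangle_e$.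 Let $m=n^\sigma+n^u$, $z=(\sigma,u)\in\mathbb R^{n^\sigma}\times\mathbb R^{n^u}$, and let $G,A_1,\dots,A_d$ be $m\times m$ matrix fields on $\overline\Omega$ with blocks $$G=\begin{bmatrix}G^{\sigma\sigma}&G^{\sigma u}\\G^{u\sigma}&G^{uu}\end{bmatrix},\qquad A_k=\begin{bmatrix}A_k^{\sigma\sigma}&B_k\\B_k^T&C_k\end{bmatrix}.$$ On $\partial K$, with outward unit normal $n$, put $A=\sum_kn_kA_k$, $B=\sum_kn_kB_k$, $C=\sum_kn_kC_k$; the field $y\mapsto\sum_kn_kA_k(y)$, with $n$ the normal of $e$, is assumed to be continuous on $\overline\Omega$ at almost every point of each mortar $e$. Matrix inequalities are understood as inequalities of quadratic forms. Let $T$ be an essentially bounded measurable $n^u\times n^u$ matrix function on the element boundaries (it may differ on the two sides of a mortar) and $\varrho\in L^\infty(\Gamma_N\cup\Gamma_R)$ a real function. Assume 1. (A1)–(A3): $G,A_k\in L^\infty(\Omega)$; $\sum_k\partial_kA_k\in L^\infty(\Omega)$ (distributional derivative); $A_k=A_k^T$ a.e. 2. (A4a): there is $\mu_0>0$ with $G+G^T+\sum_k\partial_kA_k\ge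 2\mu_0\begin{bmatrix}I&0\\0&0\end{bmatrix}$ a.e. in $\Omega$. (A4b): $G^{\sigma u}=(G^{u\sigma})^T=0$, and each $B_k$ is constant over $\Omega$. 3. (A5)–(A6): $A_k^{\sigma\sigma}=0$, and $G^{\sigma\sigma}\ge k_0I$ a.e. for some $k_0>0$. 4. The boundary operator $\begin{bmatrix}0&-\alpha B\\ \alpha B^T&2\varrho I+C\end{bmatrix}$ is $\ge0$ a.e. on $\partial\Omega$, where $\alpha=1$, $\varrho=\tfrac12$ on $\Gamma_D$ and $\alpha=-1$ with the given $\varrho$ on $\Gamma_N\cup\Gamma_R$. 5. $\tfrac12C+T>0$ a.e. on all element boundaries. 6. The ranges of $B_1,\dots,B_d$ are linearly independent subspaces (for $d=2$: $\operatorname{Range}B_1\cap\operatorname{Range}B_2=\{0\}$), and $\mathcal N(B_k)=\{0\}$ for every $k$. 7. Either $\Gamma_D$ has positive $(d-1)$-dimensional measure, or the only constant vector $c\in\mathbb R^{n^u}$ with $c^T\big(G^{uu}+(G^{uu})^T+\sum_k\partial_kC_k\big)c=0$ a.e. in $\Omega$ and $c^T(2\varrho I+C)c=0$ a.e. on $\Gamma_N\cup\Gamma_R$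 is $c=0$. Then for all $f^\sigma\in[L^2(\Omega)]^{n^\sigma}$, $f^u\in[L^2(\Omega)]^{n^u}$ there is exactly one $(\sigma_h,u_h,\hat u_h)\in V_h^{n^\sigma}\times V_h^{n^u}\times\Lambda_h^{n^u}$ such that, for all $(s,v,\hat v)$ in the same space, $$-\sum_k(B_ku_h,\partial_ks)_{\mathcal T_h}+(G^{\sigma\sigma}\sigma_h+G^{\sigma u}u_h,s)_{\mathcal T_h}+\langle B\hat u_h,s\rangle_{\partial\mathcal T_h}=(f^\sigma,s)_{\mathcal T_h},$$ $$-\sum_k(B_k^T\sigma_h+C_ku_h,\partial_kv)_{\mathcal T_h}+(G^{u\sigma}\sigma_h+G^{uu}u_h,v)_{\mathcal T_h}+\langle B^T\sigma_h+Cu_h+T(u_h-\hat u_h),v\rangle_{\partial\mathcal T_h}=(f^u,v)_{\mathcal T_h},$$ $$\big\langle[\![B^T\sigma_h+Cu_h+T(u_h-\hat u_h)]\!],\hat v\big\rangle_{\mathcal E_h\setminus\Gamma_D}=\langle(\varrho I+C)\hat u_h,\hat v\rangle_{\mathcal E_h\cap(\Gamma_N\cup\Gamma_R)},\qquad\langle\hat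 u_h,\hat v\rangle_{\mathcal E_h\cap\Gamma_D}=0,$$ where $[\![\cdot]\!]$ is the sum of the values from the two adjacent elements on an interior mortar and the single value on a boundary mortar. In particular $\hat u_h$ is unique. -/

import Mathlib

open MeasureTheory Filter Topology
open scoped ContDiff Matrix

noncomputable section

namespace HDG

/-- The ambient Euclidean space `ℝ^d`. -/
abbrev Sp (d : ℕ) : Type := EuclideanSpace ℝ (Fin d)

/-! ### Matrix inequalities -/

/-- `X ≥ Y`: the quadratic form of `X - Y` is nonnegative (no symmetry of `X`, `Y` is required). -/
def MatGE {m : Type*} [Fintype m] (X Y : Matrix m m ℝ) : Prop :=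
  ∀ z : m → ℝ, z ⬝ᵥ (Y *ᵥ z) ≤ z ⬝ᵥ (X *ᵥ z)

/-- `X > 0`: the quadratic form of `X` is positive off the origin. -/
def MatPos {m : Type*} [Fintype m] (X : Matrix m m ℝ) : Prop :=
  ∀ z : m → ℝ, z ≠ 0 → 0 < z ⬝ᵥ (X *ᵥ z)

/-- The ranges of the matrices `B_k` are independent: `∑_k B_k w_k = 0` only if every
`B_k w_k` vanishes. For two matrices this says that the two ranges meet only in `0`, see
`rangesIndependent_two`. -/
def RangesIndependent {d a b : ℕ} (B : Fin d → Matrix (Fin a) (Fin b) ℝ) : Prop :=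
  iSupIndep fun k => LinearMap.range (B k).mulVecLin

theorem rangesIndependent_two {a b : ℕ} (B : Fin 2 → Matrix (Fin a) (Fin b) ℝ) :
    RangesIndependent B ↔ ⨅ k, LinearMap.range (B k).mulVecLin = ⊥ := by
  unfold RangesIndependent
  rw [iSupIndep_pair (i := 0) (j := 1) (by decide) (by decide), disjoint_iff]
  have h : (⨅ k, LinearMap.range (B k).mulVecLin)
      = LinearMap.range (B 0).mulVecLin ⊓ LinearMap.range (B 1).mulVecLin := by
    apply le_antisymm
    · exact le_inf (iInf_le _ 0) (iInf_le _ 1)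
    · refine le_iInf fun k => ?_
      fin_cases k
      · exact inf_le_left
      · exact inf_le_right
  rw [h]

/-! ### Mesh and boundary decomposition -/

/-- A partition of `Ω` into finitely many simplices with disjoint interiors whose closures cover
`closure Ω`. Faces of neighbouring elements need not match (hanging nodes are allowed). -/
structure Mesh (d : ℕ) (Ω : Set (Sp d)) where
  N : ℕ
  elem : Fin N → Affine.Simplex ℝ (Sp d) d
  disjoint : Pairwise fun i j => Disjoint (elem i).interior (elem j).interior
  cover : ⋃ i, (elem i).closedInterior = closure Ω

/-- Types of boundary conditions. -/
inductive BdType : Type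
  | dirichlet : BdType
  | neumann : BdType
  | robin : BdType

instance : Finite BdType :=
  Finite.of_surjective (fun k : Fin 3 => if k = 0 then BdType.dirichlet else
    if k = 1 then BdType.neumann else BdType.robin) (by
      rintro (_ | _ | _)
      · exact ⟨0, by simp⟩
      · exact ⟨1, by simp⟩
      · exact ⟨2, by simp⟩)

/-- A decomposition of `∂Ω` into the disjoint parts `Γ_D`, `Γ_N`, `Γ_R` (any may be empty). -/
structure BdDecomp {d : ℕ} (Ω : Set (Sp d)) where
  part : BdType → Set (Sp d)
  measurable : ∀ t, MeasurableSet (part t)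
  disjoint : Pairwise fun t t' => Disjoint (part t) (part t')
  union : ⋃ t, part t = frontier Ω

variable {d : ℕ} [NeZero d] {Ω : Set (Sp d)}

/-- The `(d-1)`-dimensional surface measure. -/
def surf (d : ℕ) : Measure (Sp d) := Measure.euclideanHausdorffMeasure (d - 1)

/-- A pair (element, face of that element); the face is named by its opposite vertex. -/
abbrev Mesh.Side (M : Mesh d Ω) : Type := Fin M.N × Fin (d + 1)

/-- The open element `K_i`. -/
def Mesh.K (M : Mesh d Ω) (i : Fin M.N) : Set (Sp d) := (M.elem i).interior

/-- The (closed) face belonging to a side. -/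
def Mesh.face (M : Mesh d Ω) (s : M.Side) : Set (Sp d) :=
  ((M.elem s.1).faceOpposite s.2).closedInterior

/-- The unit normal to the face `s`, outward from the element `s.1`: the normalised vector from
the opposite vertex to its orthogonal projection on the face. -/
def Mesh.normal (M : Mesh d Ω) (s : M.Side) : Sp d :=
  let v : Sp d := (M.elem s.1).altitudeFoot s.2 -ᵥ (M.elem s.1).points s.2
  ‖v‖⁻¹ • v

/-! ### Mortars -/

/-- Interior (split-sided) mortars: the intersections of positive surface measure of a face of one
element with a face of another one. Each unordered pair is listed once. -/
abbrev Mesh.IntMortar (M : Mesh d Ω) : Type :=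
  {q : M.Side × M.Side // q.1.1 < q.2.1 ∧ 0 < surf d (M.face q.1 ∩ M.face q.2)}

/-- Boundary mortars: the intersections of positive surface measure of a face with one of the parts
of the boundary (the whole of `F ∩ ∂Ω` when the mesh resolves the decomposition). -/
abbrev Mesh.BdMortar (M : Mesh d Ω) (Γ : BdDecomp Ω) : Type :=
  {q : M.Side × BdType // 0 < surf d (M.face q.1 ∩ Γ.part q.2)}

/-- The mesh skeleton, i.e. the collection of all mortars. -/
abbrev Mesh.Mortar (M : Mesh d Ω) (Γ : BdDecomp Ω) : Type := M.IntMortar ⊕ M.BdMortar Γ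

instance (M : Mesh d Ω) (Γ : BdDecomp Ω) : Fintype (M.Mortar Γ) := Fintype.ofFinite _

variable {M : Mesh d Ω} {Γ : BdDecomp Ω}

/-- The point set of a mortar. -/
def Mesh.carrier (M : Mesh d Ω) (Γ : BdDecomp Ω) : M.Mortar Γ → Set (Sp d)
  | .inl q => M.face q.1.1 ∩ M.face q.1.2
  | .inr q => M.face q.1.1 ∩ Γ.part q.1.2

/-- The sides (one or two) whose face contains the mortar. -/
def Mesh.sides (M : Mesh d Ω) (Γ : BdDecomp Ω) : M.Mortar Γ → Finset M.Side
  | .inl q => {q.1.1, q.1.2}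
  | .inr q => {q.1.1}

/-- `none` for interior mortars, the type of the boundary condition for boundary mortars. -/
def Mesh.kind (M : Mesh d Ω) (Γ : BdDecomp Ω) : M.Mortar Γ → Option BdType
  | .inl _ => none
  | .inr q => some q.1.2

/-- Mortars on the Dirichlet boundary. -/
def Mesh.IsDir (M : Mesh d Ω) (Γ : BdDecomp Ω) (e : M.Mortar Γ) : Prop :=
  M.kind Γ e = some .dirichlet

/-- Mortars on the Neumann or Robin boundary. -/
def Mesh.IsNeuRob (M : Mesh d Ω) (Γ : BdDecomp Ω) (e : M.Mortar Γ) : Prop :=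
  M.kind Γ e = some .neumann ∨ M.kind Γ e = some .robin

/-- Polynomial degree on the mortars: the maximum of the degrees of the adjacent elements. -/
def Mesh.degree (M : Mesh d Ω) (Γ : BdDecomp Ω) (p : Fin M.N → ℕ) : M.Mortar Γ → ℕ
  | .inl q => max (p q.1.1.1) (p q.1.2.1)
  | .inr q => p q.1.1.1

/-! ### Approximation spaces -/

/-- The value of a polynomial at a point. -/
def pval (q : MvPolynomial (Fin d) ℝ) (x : Sp d) : ℝ := MvPolynomial.eval (fun k => x k) q

/-- Restriction of polynomials to `e`, as functions on `ℝ^d` vanishing off `e`. -/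
def restrictPoly (e : Set (Sp d)) : MvPolynomial (Fin d) ℝ →ₗ[ℝ] (Sp d → ℝ) where
  toFun q := e.indicator (pval q)
  map_add' q r := by
    ext x
    by_cases hx : x ∈ e <;> simp [hx, pval]
  map_smul' c q := by
    ext x
    by_cases hx : x ∈ e <;> simp [hx, pval]

/-- `P_k(e)`: restrictions to `e` of polynomials of total degree at most `k`. -/
def polyOn (e : Set (Sp d)) (k : ℕ) : Submodule ℝ (Sp d → ℝ) :=
  (MvPolynomial.restrictTotalDegree (Fin d) ℝ k).map (restrictPoly e)

/-- Vector-valued broken polynomials on the mesh. An element has nonempty interior, so a polynomial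
function on it is the same thing as a polynomial. -/
abbrev VolSpace (M : Mesh d Ω) (p : Fin M.N → ℕ) (n : ℕ) : Type :=
  (i : Fin M.N) → Fin n → MvPolynomial.restrictTotalDegree (Fin d) ℝ (p i)

/-- Vector-valued piecewise polynomials on the skeleton. -/
abbrev TraceSpace (M : Mesh d Ω) (Γ : BdDecomp Ω) (p : Fin M.N → ℕ) (n : ℕ) : Type :=
  (e : M.Mortar Γ) → Fin n → polyOn (M.carrier Γ e) (M.degree Γ p e)

/-- The value of `w` at `x`, computed in the element `i`. -/
def vval {p : Fin M.N → ℕ} {n : ℕ} (w : VolSpace M p n) (i : Fin M.N) (x : Sp d) : Fin n → ℝ :=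
  fun j => pval (w i j : MvPolynomial (Fin d) ℝ) x

/-- The value of `∂_k w` at `x`, computed in the element `i`. -/
def dval {p : Fin M.N → ℕ} {n : ℕ} (k : Fin d) (w : VolSpace M p n) (i : Fin M.N) (x : Sp d) :
    Fin n → ℝ :=
  fun j => pval (MvPolynomial.pderiv k (w i j : MvPolynomial (Fin d) ℝ)) x

/-- The value at `x` of a trace function on the mortar `e`. -/
def tval {p : Fin M.N → ℕ} {n : ℕ} (w : TraceSpace M Γ p n) (e : M.Mortar Γ) (x : Sp d) :
    Fin n → ℝ :=
  fun j => (w e j : Sp d → ℝ) x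

/-! ### Friedrichs' systems -/

variable {a b : ℕ}

/-- Matrices acting on `z = (σ, u)`, `σ` with `a` and `u` with `b` components. -/
abbrev BlockMat (a b : ℕ) : Type := Matrix (Fin a ⊕ Fin b) (Fin a ⊕ Fin b) ℝ

/-- All entries lie in `L^∞(S, μ)`. -/
def EssBounded {m : Type*} (F : Sp d → Matrix m m ℝ) (μ : Measure (Sp d)) : Prop :=
  ∀ i j, MemLp (fun x => F x i j) ⊤ μ

/-- `D = ∑_k ∂_k A_k` in the sense of distributions on `Ω`. -/
def HasWeakDivergence (Ω : Set (Sp d)) (A : Fin d → Sp d → BlockMat a b)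
    (D : Sp d → BlockMat a b) : Prop :=
  ∀ φ : Sp d → ℝ, ContDiff ℝ ∞ φ → HasCompactSupport φ → tsupport φ ⊆ Ω → ∀ i j,
    ∑ k, ∫ x in Ω, A k x i j * fderiv ℝ φ x (EuclideanSpace.single k 1)
      = - ∫ x in Ω, D x i j * φ x

/-- `A = ∑_k n_k A_k` on the side `s`, with `n` outward from the element. -/
def normalMat (M : Mesh d Ω) (A : Fin d → Sp d → BlockMat a b) (s : M.Side) (x : Sp d) :
    BlockMat a b :=
  ∑ k, M.normal s k • A k x

/-- `B = ∑_k n_k B_k`. -/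
def matB (M : Mesh d Ω) (A : Fin d → Sp d → BlockMat a b) (s : M.Side) (x : Sp d) :
    Matrix (Fin a) (Fin b) ℝ :=
  (normalMat M A s x).toBlocks₁₂

/-- `C = ∑_k n_k C_k`. -/
def matC (M : Mesh d Ω) (A : Fin d → Sp d → BlockMat a b) (s : M.Side) (x : Sp d) :
    Matrix (Fin b) (Fin b) ℝ :=
  (normalMat M A s x).toBlocks₂₂

/-- `A = ∑_k n_k A_k` is continuous across the mesh skeleton (and up to the boundary). -/
def ContinuousAcrossSkeleton (M : Mesh d Ω) (Γ : BdDecomp Ω) (A : Fin d → Sp d → BlockMat a b) :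
    Prop :=
  ∀ e : M.Mortar Γ, ∀ s ∈ M.sides Γ e, ∀ᵐ x ∂(surf d).restrict (M.carrier Γ e),
    ContinuousWithinAt (normalMat M A s) (closure Ω) x

/-- The boundary operator `[[0, -αB], [αBᵀ, 2ϱI + C]]` of the two-field theory. -/
def bdOperator (M : Mesh d Ω) (A : Fin d → Sp d → BlockMat a b) (α ϱ : ℝ) (s : M.Side)
    (x : Sp d) : BlockMat a b :=
  Matrix.fromBlocks 0 (-α • matB M A s x) (α • (matB M A s x)ᵀ)
    ((2 * ϱ) • (1 : Matrix (Fin b) (Fin b) ℝ) + matC M A s x)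

/-- The boundary operator is nonnegative on `∂Ω`, with `α = 1`, `ϱ = 1/2` on the Dirichlet part and
`α = -1`, `ϱ` given on the Neumann and Robin parts. -/
def BdOperatorNonneg (M : Mesh d Ω) (Γ : BdDecomp Ω) (A : Fin d → Sp d → BlockMat a b)
    (ϱ : Sp d → ℝ) : Prop :=
  ∀ e : M.Mortar Γ, ∀ s ∈ M.sides Γ e, ∀ᵐ x ∂(surf d).restrict (M.carrier Γ e),
    (M.IsDir Γ e → MatGE (bdOperator M A 1 (1 / 2) s x) 0) ∧
    (M.IsNeuRob Γ e → MatGE (bdOperator M A (-1) (ϱ x) s x) 0)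

/-- Nonzero constants are controlled: `Γ_D` has positive surface measure, or no nonzero constant
vector `c` is annihilated both by the quadratic form of `G^{uu} + (G^{uu})ᵀ + ∑_k ∂_k C_k` in `Ω`
and by that of `2ϱI + C` on the Neumann and Robin boundary. -/
def ConstantsControlled (M : Mesh d Ω) (Γ : BdDecomp Ω) (A : Fin d → Sp d → BlockMat a b)
    (D G : Sp d → BlockMat a b) (ϱ : Sp d → ℝ) : Prop :=
  0 < surf d (Γ.part .dirichlet) ∨
  ∀ c : Fin b → ℝ,
    (∀ᵐ x ∂volume.restrict Ω, c ⬝ᵥ ((G x + (G x)ᵀ + D x).toBlocks₂₂ *ᵥ c) = 0) →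
    (∀ e : M.Mortar Γ, M.IsNeuRob Γ e → ∀ s ∈ M.sides Γ e,
      ∀ᵐ x ∂(surf d).restrict (M.carrier Γ e),
        c ⬝ᵥ (((2 * ϱ x) • (1 : Matrix (Fin b) (Fin b) ℝ) + matC M A s x) *ᵥ c) = 0) →
    c = 0

/-! ### The hp-HDG scheme -/

/-- `∑_{K} ∑_{F ⊆ ∂K} ∑_{e ⊆ F} ∫_e g`, the integral over all element boundaries. -/
def bdSum (M : Mesh d Ω) (Γ : BdDecomp Ω) (g : M.Mortar Γ → M.Side → Sp d → ℝ) : ℝ :=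
  open Classical in
  ∑ s : M.Side, ∑ e : M.Mortar Γ with s ∈ M.sides Γ e,
    ∫ x in M.carrier Γ e, g e s x ∂(surf d)

/-- The `u`-component `Bᵀσ + Cu + T(u - û)` of the numerical flux on the mortar `e`, seen from the
side `s`. -/
def fluxU (A : Fin d → Sp d → BlockMat a b) (T : M.Side → Sp d → Matrix (Fin b) (Fin b) ℝ)
    {p : Fin M.N → ℕ} (σ : VolSpace M p a) (u : VolSpace M p b) (û : TraceSpace M Γ p b)
    (e : M.Mortar Γ) (s : M.Side) (x : Sp d) : Fin b → ℝ :=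
  (matB M A s x)ᵀ *ᵥ vval σ s.1 x + matC M A s x *ᵥ vval u s.1 x
    + T s x *ᵥ (vval u s.1 x - tval û e x)

/-- `(σ, u, û)` solves the two-field hp-HDG scheme: the two local equations, the conservation
condition on the mortars off `Γ_D` (the jump is the sum of the fluxes seen from all adjacent sides)
with the Neumann/Robin condition, and the Dirichlet condition. -/
structure IsSolution (M : Mesh d Ω) (Γ : BdDecomp Ω) (p : Fin M.N → ℕ)
    (A : Fin d → Sp d → BlockMat a b) (G : Sp d → BlockMat a b)
    (T : M.Side → Sp d → Matrix (Fin b) (Fin b) ℝ) (ϱ : Sp d → ℝ)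
    (fσ : Sp d → Fin a → ℝ) (fu : Sp d → Fin b → ℝ)
    (σ : VolSpace M p a) (u : VolSpace M p b) (û : TraceSpace M Γ p b) : Prop where
  local_σ : ∀ s : VolSpace M p a,
    - (∑ k, ∑ i, ∫ x in M.K i, ((A k x).toBlocks₁₂ *ᵥ vval u i x) ⬝ᵥ dval k s i x)
    + (∑ i, ∫ x in M.K i,
        ((G x).toBlocks₁₁ *ᵥ vval σ i x + (G x).toBlocks₁₂ *ᵥ vval u i x) ⬝ᵥ vval s i x)
    + bdSum M Γ (fun e t x => (matB M A t x *ᵥ tval û e x) ⬝ᵥ vval s t.1 x)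
    = ∑ i, ∫ x in M.K i, fσ x ⬝ᵥ vval s i x
  local_u : ∀ v : VolSpace M p b,
    - (∑ k, ∑ i, ∫ x in M.K i,
        ((A k x).toBlocks₁₂ᵀ *ᵥ vval σ i x + (A k x).toBlocks₂₂ *ᵥ vval u i x) ⬝ᵥ dval k v i x)
    + (∑ i, ∫ x in M.K i,
        ((G x).toBlocks₂₁ *ᵥ vval σ i x + (G x).toBlocks₂₂ *ᵥ vval u i x) ⬝ᵥ vval v i x)
    + bdSum M Γ (fun e t x => fluxU A T σ u û e t x ⬝ᵥ vval v t.1 x)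
    = ∑ i, ∫ x in M.K i, fu x ⬝ᵥ vval v i x
  global : ∀ w : TraceSpace M Γ p b,
    (open Classical in ∑ e : M.Mortar Γ with ¬ M.IsDir Γ e, ∫ x in M.carrier Γ e,
        (∑ t ∈ M.sides Γ e, fluxU A T σ u û e t x) ⬝ᵥ tval w e x ∂(surf d))
    = open Classical in ∑ e : M.Mortar Γ with M.IsNeuRob Γ e, ∫ x in M.carrier Γ e,
        (∑ t ∈ M.sides Γ e,
          ((ϱ x • (1 : Matrix (Fin b) (Fin b) ℝ) + matC M A t x) *ᵥ tval û e x))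
            ⬝ᵥ tval w e x ∂(surf d)
  dirichlet : ∀ w : TraceSpace M Γ p b,
    (open Classical in ∑ e : M.Mortar Γ with M.IsDir Γ e, ∫ x in M.carrier Γ e,
        tval û e x ⬝ᵥ tval w e x ∂(surf d)) = 0

end HDG

end

/-! Existence is a consequence of uniqueness. Unknowns and test functions range over the same
finite-dimensional space of triples, and the sum of the four residuals is a bilinear form on it. An
injective linear map into the dual is surjective by dimension count (`BoundedData.existsUnique`).
Summing loses no equation: the conservation and Dirichlet conditions share the test function on the
skeleton, but act on complementary sets of mortars.

For zero data, the scheme is tested with its own solution: the local equations with `σ` and `u`, the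
conservation condition with `û`. The Gauss-Green formula on each element converts the derivative
terms into boundary terms plus half of the divergence term. The coupling through `B` is skew and
cancels; the leftover `½ Cû·û` cancels across interior mortars, where the normals are opposite, and
vanishes on Dirichlet mortars, where `û = 0`. What remains is an energy identity
(`BoundedData.energy_identity`) with densities that are nonnegative almost everywhere. Hence `σ =
0`, `u = û` on the element boundaries, and the quadratic forms of `G^{uu} + (G^{uu})ᵀ + ∑ ∂_k C_k`
at `u` and of `2ϱI + C` at `û` vanish.

With `σ = 0` and `û = u`, the first local equation integrated by parts says that `∑_k B_k ∂_k u` is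
orthogonal to every test function. It is itself an admissible test function, so it is zero;
independence of the ranges and injectivity of each `B_k` then give `∂_k u = 0`
(`BoundedData.dval_eq_zero`). So `u` is constant on each element, the constants agree across mortars
because `û` is single-valued, and connectedness of the domain makes them one constant, which the
last assumption forces to be zero.

Two facts underlie this argument. First, the coefficients are merely bounded with bounded
distributional divergence, and only their normal component is continuous at the faces. The
Gauss-Green formula is therefore obtained by inserting a smooth cutoff into the weak divergence
identity; as its transition layer shrinks, its gradient concentrates on the faces
(`tendsto_face_integral`, `gauss_green`). Second, with hanging nodes the mortars partition each face
only up to null sets (`Mesh.integral_face`), and they must link all elements together. The latter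
holds because a set crossed by all lines near a given one in a fixed direction has positive surface
measure (`surf_pos_of_crossing`), so two groups of elements cannot be separated by a null set inside
a connected open set. -/

noncomputable section

namespace HDG

/-! ### Barycentric coordinates and outward normals of a simplex -/

section Simplex

variable {d : ℕ}

/-- The affine basis formed by the vertices of a full-dimensional simplex. -/
def vertexBasis (S : Affine.Simplex ℝ (Sp d) d) : AffineBasis (Fin (d + 1)) ℝ (Sp d) :=
  ⟨S.points, S.independent,
    S.independent.affineSpan_eq_top_iff_card_eq_finrank_add_one.mpr (by simp)⟩

/-- The barycentric coordinates of a full-dimensional simplex. -/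
def lam (S : Affine.Simplex ℝ (Sp d) d) (j : Fin (d + 1)) : Sp d →ᵃ[ℝ] ℝ :=
  (vertexBasis S).coord j

variable (S : Affine.Simplex ℝ (Sp d) d)

theorem lam_points (i j : Fin (d + 1)) : lam S i (S.points j) = if i = j then 1 else 0 :=
  (vertexBasis S).coord_apply i j

theorem sum_lam (x : Sp d) : ∑ j, lam S j x = 1 :=
  (vertexBasis S).sum_coord_apply_eq_one x

theorem affineCombination_lam (x : Sp d) :
    Finset.univ.affineCombination ℝ S.points (fun j => lam S j x) = x :=
  (vertexBasis S).affineCombination_coord_eq_self x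

theorem continuous_lam (j : Fin (d + 1)) : Continuous (lam S j) :=
  (lam S j).continuous_of_finiteDimensional

/-- The upper bounds on the coordinates are automatic: nonnegative numbers with sum 1 are at most 1.
-/
theorem mem_closedInterior_iff (x : Sp d) : x ∈ S.closedInterior ↔ ∀ j, 0 ≤ lam S j x := by
  conv_lhs => rw [← affineCombination_lam S x]
  rw [Affine.Simplex.affineCombination_mem_closedInterior_iff (sum_lam S x)]
  refine ⟨fun h j => (h j).1, fun h j => ⟨h j, ?_⟩⟩
  rw [← sum_lam S x]
  exact Finset.single_le_sum (fun i _ => h i) (Finset.mem_univ j)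

theorem mem_interior_iff [NeZero d] (x : Sp d) : x ∈ S.interior ↔ ∀ j, 0 < lam S j x := by
  conv_lhs => rw [← affineCombination_lam S x]
  rw [Affine.Simplex.affineCombination_mem_interior_iff (sum_lam S x)]
  refine ⟨fun h j => (h j).1, fun h j => ⟨h j, ?_⟩⟩
  rw [← sum_lam S x]
  -- A second vertex exists because `d ≥ 1`; its positive coordinate makes the upper bound strict.
  obtain ⟨i, hi⟩ : ∃ i, i ≠ j := by
    have : Nontrivial (Fin (d + 1)) :=
      Fin.nontrivial_iff_two_le.mpr (by have := NeZero.pos d; omega)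
    exact exists_ne j
  exact Finset.single_lt_sum hi (Finset.mem_univ j) (Finset.mem_univ i) (h i) fun k _ _ => (h k).le

theorem mem_faceOpposite_iff [NeZero d] (j : Fin (d + 1)) (x : Sp d) :
    x ∈ (S.faceOpposite j).closedInterior ↔ lam S j x = 0 ∧ ∀ i, 0 ≤ lam S i x := by
  conv_lhs => rw [← affineCombination_lam S x]
  rw [Affine.Simplex.faceOpposite,
    Affine.Simplex.affineCombination_mem_closedInterior_face_iff_nonneg _ _ (sum_lam S x)]
  constructor
  · rintro ⟨h1, h2⟩
    have h0 : lam S j x = 0 := h2 j (by simp)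
    refine ⟨h0, fun i => ?_⟩
    by_cases hij : i = j
    · rw [hij, h0]
    · exact h1 i (by simpa using hij)
  · rintro ⟨h1, h2⟩
    refine ⟨fun i _ => h2 i, fun i hi => ?_⟩
    have : i = j := by simpa using hi
    rw [this, h1]

/-- The outward unit normal of a simplex on the face opposite to a vertex. -/
def outNormal [NeZero d] (j : Fin (d + 1)) : Sp d :=
  let v : Sp d := S.altitudeFoot j -ᵥ S.points j
  ‖v‖⁻¹ • v

theorem norm_outNormal [NeZero d] (j : Fin (d + 1)) : ‖outNormal S j‖ = 1 := by
  have h : S.altitudeFoot j -ᵥ S.points j ≠ 0 := by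
    rw [Ne, vsub_eq_zero_iff_eq]
    exact (S.ne_altitudeFoot j).symm
  rw [outNormal, norm_smul, norm_inv, norm_norm, inv_mul_cancel₀ (norm_ne_zero_iff.mpr h)]

theorem lam_eq_zero_of_mem_affineSpan [NeZero d] (j : Fin (d + 1)) {x : Sp d}
    (hx : x ∈ affineSpan ℝ (Set.range (S.faceOpposite j).points)) : lam S j x = 0 := by
  rw [Affine.Simplex.range_faceOpposite_points] at hx
  refine affineSpan_induction (p := fun x => lam S j x = 0) hx ?_ ?_
  · rintro _ ⟨i, hi, rfl⟩
    rw [lam_points, if_neg]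
    rintro rfl
    exact hi rfl
  · intro c u v w hu hv hw
    simp only [AffineMap.map_vadd, LinearMap.map_smul, AffineMap.linearMap_vsub, hu, hv, hw]
    simp

theorem mem_affineSpan_of_lam_eq_zero [NeZero d] (j : Fin (d + 1)) {x : Sp d}
    (hx : lam S j x = 0) : x ∈ affineSpan ℝ (Set.range (S.faceOpposite j).points) := by
  rw [Affine.Simplex.range_faceOpposite_points, ← affineCombination_lam S x]
  refine affineCombination_mem_affineSpan_image (sum_lam S x) (fun i _ hi => ?_) S.points
  have : i = j := by simpa using hi
  rw [this, hx]

/-- A barycentric coordinate is an affine function decreasing in the direction of the outward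
normal. -/
theorem lam_sub [NeZero d] (j : Fin (d + 1)) (x y : Sp d) :
    lam S j x - lam S j y = - (S.height j)⁻¹ * inner ℝ (outNormal S j) (x - y) := by
  set v : Sp d := S.altitudeFoot j -ᵥ S.points j with hv
  have hvh : ‖v‖ = S.height j := by
    rw [Affine.Simplex.height, dist_comm, dist_eq_norm_vsub (Sp d)]
  have hpos := S.height_pos j
  have hlin : lam S j x - lam S j y = (lam S j).linear (x - y) := by
    simpa using ((lam S j).linearMap_vsub x y).symm
  have hlv : (lam S j).linear v = -1 := by
    rw [hv, AffineMap.linearMap_vsub, lam_points, if_pos rfl,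
      lam_eq_zero_of_mem_affineSpan S j (S.altitudeFoot_mem_affineSpan_faceOpposite j)]
    simp
  set w := x - y
  -- From the vertex to its foot the coordinate drops from 1 to 0, so adding this multiple of `v`
  -- cancels the variation of the coordinate along `w`. Thus `w'` is parallel to the face, hence
  -- orthogonal to `v`, and only the normal part of `w` matters.
  set w' := w + (lam S j).linear w • v with hw'
  have hw'0 : (lam S j).linear w' = 0 := by
    rw [hw', map_add, map_smul, hlv]; simp
  have horth : inner ℝ v w' = 0 := by
    have h1 : S.altitudeFoot j + w' ∈ affineSpan ℝ (Set.range (S.faceOpposite j).points) := by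
      apply mem_affineSpan_of_lam_eq_zero
      rw [add_comm, ← vadd_eq_add, AffineMap.map_vadd, hw'0,
        lam_eq_zero_of_mem_affineSpan S j (S.altitudeFoot_mem_affineSpan_faceOpposite j)]
      simp
    have h2 : w' ∈ (affineSpan ℝ (Set.range (S.faceOpposite j).points)).direction := by
      have := AffineSubspace.vsub_mem_direction h1 (S.altitudeFoot_mem_affineSpan_faceOpposite j)
      simpa using this
    have h3 : S.points j -ᵥ S.altitudeFoot j ∈
        (affineSpan ℝ (Set.range (S.faceOpposite j).points)).directionᗮ :=
      EuclideanGeometry.vsub_orthogonalProjection_mem_direction_orthogonal _ _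
    have h4 := (Submodule.mem_orthogonal' _ _).mp h3 w' h2
    have : v = -(S.points j -ᵥ S.altitudeFoot j) := by rw [neg_vsub_eq_vsub_rev]
    rw [this, inner_neg_left, h4, neg_zero]
  have hin : inner ℝ v w = - (lam S j).linear w * ‖v‖ ^ 2 := by
    have : w = w' - (lam S j).linear w • v := by rw [hw']; abel
    conv_lhs => rw [this]
    rw [inner_sub_right, horth, inner_smul_right, real_inner_self_eq_norm_sq]
    ring
  have hn : outNormal S j = (S.height j)⁻¹ • v := by rw [← hvh]; rfl
  rw [hlin, hn, real_inner_smul_left, hin, hvh]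
  field_simp

theorem isCompact_closedInterior : IsCompact S.closedInterior := S.isCompact_closedInterior

theorem isOpen_interior [NeZero d] : IsOpen S.interior := by
  have : S.interior = ⋂ j, {x | 0 < lam S j x} := by
    ext x; simp [mem_interior_iff]
  rw [this]
  exact isOpen_iInter_of_finite fun j => isOpen_lt continuous_const (continuous_lam S j)

/-- Moving a point of the closed simplex slightly towards the centroid makes all its barycentric
coordinates positive. -/
theorem closedInterior_subset_closure [NeZero d] : S.closedInterior ⊆ closure S.interior := by
  obtain ⟨c, hc⟩ : ∃ c, c ∈ S.interior := by
    refine ⟨Finset.univ.affineCombination ℝ S.points fun _ => ((d : ℝ) + 1)⁻¹, ?_⟩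
    have hd : (1 : ℝ) ≤ d := by exact_mod_cast NeZero.pos d
    have h1 : (0 : ℝ) < (d : ℝ) + 1 := by positivity
    rw [Affine.Simplex.affineCombination_mem_interior_iff]
    · intro i
      exact ⟨by positivity, inv_lt_one_of_one_lt₀ (by linarith)⟩
    · simp; field_simp
  rw [mem_interior_iff] at hc
  intro x hx
  rw [mem_closedInterior_iff] at hx
  have hlim : Tendsto (fun t : ℝ => AffineMap.lineMap x c t) (𝓝[>] 0) (𝓝 x) := by
    have : Tendsto (fun t : ℝ => AffineMap.lineMap x c t) (𝓝 0)
        (𝓝 (AffineMap.lineMap x c (0 : ℝ))) := by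
      apply Continuous.tendsto
      exact AffineMap.lineMap_continuous
    rw [AffineMap.lineMap_apply_zero] at this
    exact this.mono_left nhdsWithin_le_nhds
  refine mem_closure_of_tendsto hlim ?_
  filter_upwards [Ioo_mem_nhdsGT (zero_lt_one (α := ℝ))] with t ht
  rw [mem_interior_iff]
  intro j
  rw [AffineMap.apply_lineMap, AffineMap.lineMap_apply]
  simp only [vsub_eq_sub, smul_eq_mul, vadd_eq_add]
  nlinarith [hx j, hc j, ht.1, ht.2, mul_nonneg (sub_nonneg.mpr ht.2.le) (hx j),
    mul_pos ht.1 (hc j)]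

theorem nonempty_interior [NeZero d] : S.interior.Nonempty := by
  rw [← closure_nonempty_iff]
  exact S.nonempty_closedInterior.mono (closedInterior_subset_closure S)

end Simplex

/-! ### Hyperplanes and surface measure -/

section Hyperplane

variable {d : ℕ}

/-- The linear hyperplane orthogonal to `n`. -/
abbrev Hp (n : Sp d) : Submodule ℝ (Sp d) := (Submodule.span ℝ {n})ᗮ

theorem finrank_Hp {n : Sp d} (hn : ‖n‖ = 1) : Module.finrank ℝ (Hp n) = d - 1 := by
  have h0 : n ≠ 0 := by rintro rfl; simp at hn
  have h1 := (Submodule.span ℝ {n}).finrank_add_finrank_orthogonal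
  rw [finrank_span_singleton h0, finrank_euclideanSpace_fin] at h1
  exact Nat.eq_sub_of_add_eq' h1

theorem isometry_flat (n x₀ : Sp d) : Isometry fun y : Hp n => x₀ + (y : Sp d) :=
  (IsometryEquiv.addLeft x₀).isometry.comp isometry_subtype_coe

theorem range_flat (n x₀ : Sp d) :
    Set.range (fun y : Hp n => x₀ + (y : Sp d)) = {x | inner ℝ n (x - x₀) = 0} := by
  ext x
  simp only [Set.mem_range, Subtype.exists, Set.mem_ofPred_eq]
  constructor
  · rintro ⟨y, hy, rfl⟩
    simpa using Submodule.mem_orthogonal_singleton_iff_inner_right.mp hy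
  · intro h
    exact ⟨x - x₀, Submodule.mem_orthogonal_singleton_iff_inner_right.mpr h, by simp⟩

/-- Surface measure on a hyperplane is the image of Lebesgue measure. -/
theorem map_flat {n : Sp d} (hn : ‖n‖ = 1) (x₀ : Sp d) :
    Measure.map (fun y : Hp n => x₀ + (y : Sp d)) volume
      = (surf d).restrict {x | inner ℝ n (x - x₀) = 0} := by
  have h := (isometry_flat n x₀).map_euclideanHausdorffMeasure (d := d - 1)
  rw [range_flat] at h
  rw [surf, ← h, ← finrank_Hp hn, InnerProductSpace.euclideanHausdorffMeasure_eq_volume]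

theorem measurableEmbedding_flat (n x₀ : Sp d) :
    MeasurableEmbedding fun y : Hp n => x₀ + (y : Sp d) :=
  (isometry_flat n x₀).isClosedEmbedding.measurableEmbedding

/-- Cartesian coordinates adapted to a hyperplane preserve Lebesgue measure. -/
theorem measurePreserving_tube {n : Sp d} (hn : ‖n‖ = 1) (x₀ : Sp d) :
    MeasurePreserving (fun q : Hp n × ℝ => x₀ + (q.1 : Sp d) + q.2 • n)
      (volume.prod volume) volume := by
  have h1 := ((Submodule.span ℝ {n}).measurePreserving_measurableEquivProd x₀).symm
  rw [InnerProductSpace.euclideanHausdorffMeasure_eq_volume] at h1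
  have h2 : MeasurePreserving
      (fun q : Hp n × ℝ => (LinearIsometryEquiv.toSpanUnitSingleton n hn q.2, q.1))
      (volume.prod volume) (volume.prod volume) := by
    have := (LinearIsometryEquiv.toSpanUnitSingleton (𝕜 := ℝ) n hn).measurePreserving
    exact (this.prod (MeasurePreserving.id (volume : Measure (Hp n)))).comp
      Measure.measurePreserving_swap
  have h3 : (fun q : Hp n × ℝ => x₀ + (q.1 : Sp d) + q.2 • n)
      = ((Submodule.span ℝ {n}).measurableEquivProd x₀).symm ∘
        fun q : Hp n × ℝ => (LinearIsometryEquiv.toSpanUnitSingleton n hn q.2, q.1) := by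
    funext q
    rw [Function.comp_apply, Submodule.measurableEquivProd_symm_apply,
      LinearIsometryEquiv.toSpanUnitSingleton_apply, vadd_eq_add]
    show x₀ + (q.1 : Sp d) + q.2 • n = q.2 • n + (q.1 : Sp d) + x₀
    abel
  rw [h3]
  exact h1.comp h2

theorem surf_null_of_flat_null {n : Sp d} (hn : ‖n‖ = 1) (x₀ : Sp d) {s : Set (Sp d)}
    (hs : s ⊆ {x | inner ℝ n (x - x₀) = 0})
    (h : volume ((fun y : Hp n => x₀ + (y : Sp d)) ⁻¹' s) = 0) : surf d s = 0 := by
  have h1 := (measurableEmbedding_flat n x₀).map_apply volume s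
  rw [map_flat hn, Measure.restrict_eq_self _ hs, h] at h1
  exact h1

theorem surf_lt_top_of_bounded {n : Sp d} (hn : ‖n‖ = 1) (x₀ : Sp d) {s : Set (Sp d)}
    (hs : s ⊆ {x | inner ℝ n (x - x₀) = 0}) (hb : Bornology.IsBounded s) : surf d s < ⊤ := by
  have h1 := (measurableEmbedding_flat n x₀).map_apply volume s
  rw [map_flat hn, Measure.restrict_eq_self _ hs] at h1
  rw [h1]
  exact ((isometry_flat n x₀).antilipschitz.isBounded_preimage hb).measure_lt_top

theorem integral_surf_flat {n : Sp d} (hn : ‖n‖ = 1) (x₀ : Sp d) {s : Set (Sp d)}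
    (hs : s ⊆ {x | inner ℝ n (x - x₀) = 0}) (hm : MeasurableSet s) (f : Sp d → ℝ) :
    ∫ x in s, f x ∂(surf d)
      = ∫ y : Hp n, s.indicator f (x₀ + (y : Sp d)) := by
  have h := (measurableEmbedding_flat n x₀).integral_map (μ := volume) (s.indicator f)
  rw [← h, map_flat hn, integral_indicator hm, Measure.restrict_restrict hm,
    Set.inter_eq_self_of_subset_left hs]

end Hyperplane

/-! ### Functions that are polynomial along lines -/

section NullZeros

/-- `f` restricts to a polynomial on every affine line. -/
def PolyOnLines {V : Type*} [AddCommGroup V] [Module ℝ V] (f : V → ℝ) : Prop :=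
  ∀ x v, ∃ P : Polynomial ℝ, ∀ t : ℝ, f (x + t • v) = P.eval t

/-- Fubini on the lines through `x₀`. Along each of them `f` is a polynomial that is nonzero at
parameter 0, so it has finitely many zeros and the set `W` of pairs (parameter, direction point)
with a zero is null. Hence some slice of `W` with parameter `t ≠ 0` is null. That slice is the zero
set scaled about `x₀` by `t⁻¹`, and a nonzero scaling preserves null sets in both directions. -/
theorem PolyOnLines.measure_zeros {V : Type*} [NormedAddCommGroup V] [NormedSpace ℝ V]
    [FiniteDimensional ℝ V] [MeasurableSpace V] [BorelSpace V] (μ : Measure V)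
    [μ.IsAddHaarMeasure] {f : V → ℝ} (hf : PolyOnLines f) (hc : Continuous f) {x₀ : V}
    (h0 : f x₀ ≠ 0) : μ {x | f x = 0} = 0 := by
  set Z := {x | f x = 0} with hZ
  have hZm : MeasurableSet Z := (isClosed_singleton.preimage hc).measurableSet
  set W : Set (ℝ × V) := {q | f (x₀ + q.1 • (q.2 - x₀)) = 0} with hW
  have hWm : MeasurableSet W := by
    apply IsClosed.measurableSet
    exact isClosed_singleton.preimage (f := fun q : ℝ × V => f (x₀ + q.1 • (q.2 - x₀)))
      (by fun_prop)
  have h1 : (volume.prod μ) W = 0 := by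
    rw [Measure.prod_apply_symm hWm]
    have hsw : ∀ x : V, volume ((fun t : ℝ => (t, x)) ⁻¹' W) = 0 := by
      intro x
      obtain ⟨P, hP⟩ := hf x₀ (x - x₀)
      have hP0 : P ≠ 0 := by
        rintro rfl
        apply h0
        simpa using hP 0
      have : (fun t : ℝ => (t, x)) ⁻¹' W ⊆ {t | P.IsRoot t} := by
        intro t ht
        simpa [hW, hP, Polynomial.IsRoot] using ht
      exact measure_mono_null this ((Polynomial.finite_setOfPred_isRoot hP0).measure_zero _)
    simp [hsw]
  have h2 : ∀ᵐ t : ℝ, μ (Prod.mk t ⁻¹' W) = 0 := Measure.measure_ae_null_of_prod_null h1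
  obtain ⟨t, ht, ht0⟩ : ∃ t : ℝ, μ (Prod.mk t ⁻¹' W) = 0 ∧ t ≠ 0 := by
    have : ∀ᵐ t : ℝ, t ≠ 0 := by simp [ae_iff]
    exact (h2.and this).exists
  have h3 : Prod.mk t ⁻¹' W = AffineMap.homothety x₀ t ⁻¹' Z := by
    ext x
    simp [hW, hZ, AffineMap.homothety_apply, add_comm]
  have h4 : Prod.mk t ⁻¹' W = AffineMap.homothety x₀ t⁻¹ '' Z := by
    rw [h3]
    ext x
    constructor
    · intro hx
      refine ⟨AffineMap.homothety x₀ t x, hx, ?_⟩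
      simp [AffineMap.homothety_apply, smul_smul, inv_mul_cancel₀ ht0]
    · rintro ⟨z, hz, rfl⟩
      simpa [AffineMap.homothety_apply, smul_smul, mul_inv_cancel₀ ht0] using hz
  rw [h4, Measure.addHaar_image_homothety] at ht
  rcases mul_eq_zero.mp ht with h | h
  · exfalso
    rw [ENNReal.ofReal_eq_zero] at h
    exact absurd h (not_le.mpr (abs_pos.mpr (pow_ne_zero _ (inv_ne_zero ht0))))
  · exact h

end NullZeros

/-! ### Smooth cutoff functions on a simplex -/

/-- A smooth step, equal to `0` on `(-∞, 1]` and to `1` on `[2, ∞)`. -/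
def cut (s : ℝ) : ℝ := Real.smoothTransition (s - 1)

theorem contDiff_cut : ContDiff ℝ ∞ cut :=
  Real.smoothTransition.contDiff.comp (contDiff_id.sub contDiff_const)

theorem cut_of_le {s : ℝ} (h : s ≤ 1) : cut s = 0 :=
  Real.smoothTransition.zero_of_nonpos (by linarith)

theorem cut_of_ge {s : ℝ} (h : 2 ≤ s) : cut s = 1 :=
  Real.smoothTransition.one_of_one_le (by linarith)

theorem cut_nonneg (s : ℝ) : 0 ≤ cut s := Real.smoothTransition.nonneg _

theorem cut_le_one (s : ℝ) : cut s ≤ 1 := Real.smoothTransition.le_one _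

theorem hasDerivAt_cut (s : ℝ) : HasDerivAt cut (deriv cut s) s :=
  (contDiff_cut.differentiable (by simp) s).hasDerivAt

theorem continuous_deriv_cut : Continuous (deriv cut) :=
  contDiff_cut.continuous_deriv (by simp)

/-- The endpoint is included by continuity: the derivative vanishes on the open half-line, where
`cut` is locally constant, hence on its closure. -/
theorem deriv_cut_of_le {s : ℝ} (h : s ≤ 1) : deriv cut s = 0 := by
  have hlt : ∀ s < 1, deriv cut s = 0 := fun s hs => by
    have : cut =ᶠ[𝓝 s] fun _ => 0 := by
      filter_upwards [Iio_mem_nhds hs] with t ht using cut_of_le (le_of_lt ht)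
    rw [this.deriv_eq]; simp
  have hcl : closure (Set.Iio (1 : ℝ)) ⊆ {s | deriv cut s = 0} :=
    closure_minimal hlt (isClosed_singleton.preimage continuous_deriv_cut)
  exact hcl (by rwa [closure_Iio])

theorem deriv_cut_of_ge {s : ℝ} (h : 2 ≤ s) : deriv cut s = 0 := by
  have hlt : ∀ s > 2, deriv cut s = 0 := fun s hs => by
    have : cut =ᶠ[𝓝 s] fun _ => 1 := by
      filter_upwards [Ioi_mem_nhds hs] with t ht using cut_of_ge (le_of_lt ht)
    rw [this.deriv_eq]; simp
  have hcl : closure (Set.Ioi (2 : ℝ)) ⊆ {s | deriv cut s = 0} :=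
    closure_minimal hlt (isClosed_singleton.preimage continuous_deriv_cut)
  exact hcl (by rwa [closure_Ioi])

theorem hasCompactSupport_deriv_cut : HasCompactSupport (deriv cut) := by
  refine HasCompactSupport.intro (isCompact_Icc (a := (1 : ℝ)) (b := 2)) fun s hs => ?_
  rw [Set.mem_Icc, not_and_or, not_le, not_le] at hs
  rcases hs with h | h
  · exact deriv_cut_of_le h.le
  · exact deriv_cut_of_ge h.le

/-- The whole rise of `cut` from 0 to 1 takes place on `[1, 2]`. This normalisation is what makes
the layer integrals converge to the face integral without an extra constant. -/
theorem integral_deriv_cut : ∫ s, deriv cut s = 1 := by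
  have h1 : ∫ s in (1 : ℝ)..2, deriv cut s = cut 2 - cut 1 :=
    intervalIntegral.integral_deriv_eq_sub (fun s _ => (hasDerivAt_cut s).differentiableAt)
      (continuous_deriv_cut.intervalIntegrable _ _)
  rw [cut_of_ge le_rfl, cut_of_le le_rfl, intervalIntegral.integral_of_le (by norm_num),
    setIntegral_eq_integral_of_forall_compl_eq_zero] at h1
  · simpa using h1
  · intro s hs
    rw [Set.mem_Ioc, not_and_or, not_lt, not_le] at hs
    rcases hs with h | h
    · exact deriv_cut_of_le h
    · exact deriv_cut_of_ge h.le

theorem exists_bound_deriv_cut : ∃ C, 0 ≤ C ∧ ∀ s, |deriv cut s| ≤ C := by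
  obtain ⟨C, hC⟩ := hasCompactSupport_deriv_cut.exists_bound_of_continuous continuous_deriv_cut
  exact ⟨C, (norm_nonneg _).trans (hC 0), hC⟩

section Cutoff

set_option linter.unusedSectionVars false

variable {d : ℕ} [NeZero d] (S : Affine.Simplex ℝ (Sp d) d)

/-- The cutoff function with transition layer of width `ε`. -/
def chi (ε : ℝ) (x : Sp d) : ℝ := ∏ i, cut (lam S i x / ε)

/-- The cutoff function without the factor belonging to the face `j`. -/
def chiErase (j : Fin (d + 1)) (ε : ℝ) (x : Sp d) : ℝ :=
  ∏ i ∈ Finset.univ.erase j, cut (lam S i x / ε)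

theorem chi_nonneg (ε : ℝ) (x : Sp d) : 0 ≤ chi S ε x :=
  Finset.prod_nonneg fun _ _ => cut_nonneg _

theorem chi_le_one (ε : ℝ) (x : Sp d) : chi S ε x ≤ 1 :=
  Finset.prod_le_one (fun _ _ => cut_nonneg _) fun _ _ => cut_le_one _

theorem chiErase_nonneg (j : Fin (d + 1)) (ε : ℝ) (x : Sp d) : 0 ≤ chiErase S j ε x :=
  Finset.prod_nonneg fun _ _ => cut_nonneg _

theorem chiErase_le_one (j : Fin (d + 1)) (ε : ℝ) (x : Sp d) : chiErase S j ε x ≤ 1 :=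
  Finset.prod_le_one (fun _ _ => cut_nonneg _) fun _ _ => cut_le_one _

theorem hasFDerivAt_lam (j : Fin (d + 1)) (x : Sp d) :
    HasFDerivAt (lam S j) (-((S.height j)⁻¹ • innerSL ℝ (outNormal S j))) x := by
  have h : (lam S j : Sp d → ℝ)
      = fun y => (-((S.height j)⁻¹ • innerSL ℝ (outNormal S j))) y + lam S j 0 := by
    funext y
    have := lam_sub S j y 0
    simp only [sub_zero] at this
    simp only [neg_apply, smul_apply, innerSL_apply_apply,
      smul_eq_mul]
    linarith
  rw [h]
  exact (ContinuousLinearMap.hasFDerivAt _).add_const _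

theorem contDiff_lam (j : Fin (d + 1)) : ContDiff ℝ ∞ (lam S j) := by
  have h : (lam S j : Sp d → ℝ)
      = fun y => (-((S.height j)⁻¹ • innerSL ℝ (outNormal S j))) y + lam S j 0 := by
    funext y
    have := lam_sub S j y 0
    simp only [sub_zero] at this
    simp only [neg_apply, smul_apply, innerSL_apply_apply,
      smul_eq_mul]
    linarith
  rw [h]
  exact (ContinuousLinearMap.contDiff _).add contDiff_const

theorem contDiff_chi (ε : ℝ) : ContDiff ℝ ∞ (chi S ε) := by
  unfold chi
  exact contDiff_prod fun i _ => contDiff_cut.comp ((contDiff_lam S i).div_const ε)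

/-- Product rule, one term per face: the `j`-th factor varies only where `lam S j` lies between `ε`
and `2ε`, and there the coordinate decreases along the outward normal at rate `1 / height`. -/
theorem fderiv_chi (ε : ℝ) (x v : Sp d) :
    fderiv ℝ (chi S ε) x v = - ∑ j, (ε * S.height j)⁻¹ * deriv cut (lam S j x / ε)
      * chiErase S j ε x * inner ℝ (outNormal S j) v := by
  have h := HasFDerivAt.finsetProd (u := Finset.univ) (x := x)
    (g := fun i x => cut (lam S i x / ε))
    (g' := fun i => deriv cut (lam S i x / ε) •
      (ε⁻¹ • (-((S.height i)⁻¹ • innerSL ℝ (outNormal S i))))) (fun i _ => by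
        have h1 : HasFDerivAt (fun x => lam S i x / ε)
            (ε⁻¹ • (-((S.height i)⁻¹ • innerSL ℝ (outNormal S i)))) x := by
          have h0 := (hasFDerivAt_lam S i x).const_smul ε⁻¹
          have h3 : (fun x => lam S i x / ε) = ε⁻¹ • (lam S i : Sp d → ℝ) := by
            funext y
            simp [div_eq_inv_mul]
          rw [h3]
          exact h0
        exact (hasDerivAt_cut _).comp_hasFDerivAt x h1)
  have h2 : HasFDerivAt (chi S ε) _ x := h
  rw [h2.fderiv, ← Finset.sum_neg_distrib]
  simp only [sum_apply, smul_apply,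
    neg_apply, innerSL_apply_apply, smul_eq_mul, chiErase]
  refine Finset.sum_congr rfl fun j _ => ?_
  rw [mul_inv]
  ring

theorem chi_support {ε : ℝ} (hε : 0 < ε) {x : Sp d} (h : chi S ε x ≠ 0) (j : Fin (d + 1)) :
    ε ≤ lam S j x := by
  by_contra hlt
  apply h
  refine Finset.prod_eq_zero (Finset.mem_univ j) (cut_of_le ?_)
  rw [div_le_one hε]
  linarith

theorem tsupport_chi_subset {ε : ℝ} (hε : 0 < ε) :
    tsupport (chi S ε) ⊆ {x | ∀ j, ε ≤ lam S j x} := by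
  apply closure_minimal
  · exact fun x hx j => chi_support S hε hx j
  · have : {x | ∀ j, ε ≤ lam S j x} = ⋂ j, {x | ε ≤ lam S j x} := by ext; simp
    rw [this]
    exact isClosed_iInter fun j => isClosed_le continuous_const (continuous_lam S j)

/-- The step of `cut` begins at 1 rather than at 0, so every coordinate is at least `ε` on the
support, and even the closed support stays inside the open simplex. -/
theorem tsupport_chi_subset_interior {ε : ℝ} (hε : 0 < ε) : tsupport (chi S ε) ⊆ S.interior :=
  fun x hx => (mem_interior_iff S x).mpr fun j => hε.trans_le (tsupport_chi_subset S hε hx j)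

theorem hasCompactSupport_chi {ε : ℝ} (hε : 0 < ε) : HasCompactSupport (chi S ε) :=
  (isCompact_closedInterior S).of_isClosed_subset (isClosed_tsupport _)
    ((tsupport_chi_subset_interior S hε).trans S.interior_subset_closedInterior)

theorem tendsto_chi {x : Sp d} (hx : x ∈ S.interior) :
    ∀ᶠ ε in 𝓝[>] (0 : ℝ), chi S ε x = 1 := by
  rw [mem_interior_iff] at hx
  have : ∀ j, ∀ᶠ ε in 𝓝[>] (0 : ℝ), cut (lam S j x / ε) = 1 := fun j => by
    filter_upwards [Ioo_mem_nhdsGT (half_pos (hx j))] with ε hε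
    apply cut_of_ge
    rw [le_div_iff₀ hε.1]
    linarith [hε.2]
  filter_upwards [eventually_all.mpr this] with ε hε
  exact Finset.prod_eq_one fun j _ => hε j

end Cutoff

/-! ### Limits of functions at boundary points -/

/-- A nonempty open piece of `K` has positive volume, so arbitrarily close to `x` there are points
with values in `C`; closedness passes this to the limit. This is how properties valid almost
everywhere in the volume are carried to the faces. -/
theorem mem_of_tendsto_of_ae {d : ℕ} {E : Type*} [TopologicalSpace E] {K : Set (Sp d)}
    (hK : IsOpen K) {x : Sp d} (hx : x ∈ closure K) {f : Sp d → E} {C : Set E} (hC : IsClosed C)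
    {l : E} (hf : Tendsto f (𝓝[K] x) (𝓝 l)) (hae : ∀ᵐ y ∂volume.restrict K, f y ∈ C) : l ∈ C := by
  refine hC.mem_of_frequently_of_tendsto ?_ hf
  intro hev
  obtain ⟨U, hU, hxU, hUK⟩ := mem_nhdsWithin.mp hev
  have hne : (U ∩ K).Nonempty := mem_closure_iff.mp hx U hU hxU
  have hpos := (hU.inter hK).measure_pos volume hne
  rw [ae_restrict_iff' hK.measurableSet, ae_iff] at hae
  refine hpos.ne' (measure_mono_null ?_ hae)
  intro y hy
  simp only [Set.mem_ofPred_eq, Classical.not_imp]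
  exact ⟨hy.2, hUK hy⟩

/-! ### Concentration of the gradient of the cutoff on a face -/

section FaceLimit

variable {d : ℕ} [NeZero d] (S : Affine.Simplex ℝ (Sp d) d)

theorem face_subset_hyperplane (j : Fin (d + 1)) : (S.faceOpposite j).closedInterior ⊆
    {x | inner ℝ (outNormal S j) (x - S.altitudeFoot j) = 0} := by
  intro x hx
  have h := lam_sub S j x (S.altitudeFoot j)
  rw [((mem_faceOpposite_iff S j x).mp hx).1,
    lam_eq_zero_of_mem_affineSpan S j (S.altitudeFoot_mem_affineSpan_faceOpposite j)] at h
  have h2 := S.height_pos j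
  have h3 : (S.height j)⁻¹ ≠ 0 := inv_ne_zero h2.ne'
  simpa [h3] using h

theorem isClosed_face (j : Fin (d + 1)) : IsClosed (S.faceOpposite j).closedInterior :=
  (S.faceOpposite j).isClosed_closedInterior

theorem lam_tube (j : Fin (d + 1)) (y : Hp (outNormal S j)) (t : ℝ) :
    lam S j (S.altitudeFoot j + (y : Sp d) + t • outNormal S j) = - t / S.height j := by
  have h := lam_sub S j (S.altitudeFoot j + (y : Sp d) + t • outNormal S j) (S.altitudeFoot j)
  rw [lam_eq_zero_of_mem_affineSpan S j (S.altitudeFoot_mem_affineSpan_faceOpposite j),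
    show S.altitudeFoot j + (y : Sp d) + t • outNormal S j - S.altitudeFoot j
      = (y : Sp d) + t • outNormal S j by abel, inner_add_right,
    Submodule.mem_orthogonal_singleton_iff_inner_right.mp y.2, inner_smul_right,
    real_inner_self_eq_norm_sq, norm_outNormal] at h
  rw [sub_zero] at h
  rw [h]
  field_simp
  ring

theorem lam_polyOnLines (i j : Fin (d + 1)) :
    PolyOnLines fun y : Hp (outNormal S j) => lam S i (S.altitudeFoot j + (y : Sp d)) := by
  intro x v
  refine ⟨Polynomial.C (lam S i (S.altitudeFoot j + (x : Sp d)))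
    + Polynomial.C ((lam S i).linear v) * Polynomial.X, fun t => ?_⟩
  have h : S.altitudeFoot j + ((x + t • v : Hp (outNormal S j)) : Sp d)
      = t • (v : Sp d) +ᵥ (S.altitudeFoot j + (x : Sp d)) := by
    simp only [Submodule.coe_add, Submodule.coe_smul, vadd_eq_add]
    abel
  beta_reduce
  rw [h, AffineMap.map_vadd, map_smul]
  simp only [Polynomial.eval_add, Polynomial.eval_mul, Polynomial.eval_C, Polynomial.eval_X,
    vadd_eq_add, smul_eq_mul]
  ring

/-- The intersection of two distinct faces of a simplex is a null set for the surface measure. -/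
theorem volume_lam_zero {i j : Fin (d + 1)} (hij : i ≠ j) :
    volume {y : Hp (outNormal S j) | lam S i (S.altitudeFoot j + (y : Sp d)) = 0} = 0 := by
  have hmem : S.points i ∈ {x | inner ℝ (outNormal S j) (x - S.altitudeFoot j) = 0} := by
    apply face_subset_hyperplane
    rw [mem_faceOpposite_iff, lam_points, if_neg hij.symm]
    refine ⟨rfl, fun k => ?_⟩
    rw [lam_points]
    split_ifs <;> norm_num
  rw [← range_flat] at hmem
  obtain ⟨y, hy⟩ := hmem
  refine (lam_polyOnLines S i j).measure_zeros volume ?_ (x₀ := y) ?_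
  · exact (continuous_lam S i).comp (by fun_prop)
  · simp only at hy
    rw [hy, lam_points, if_pos rfl]
    exact one_ne_zero

/-- Here `t` is the depth below the face in units of `c`. With `c = ε * height`, the density `c⁻¹`
produced by the rescaling is the prefactor of the layer terms in the gradient of the cutoff. -/
theorem measurePreserving_layer (j : Fin (d + 1)) {c : ℝ} (hc : 0 < c) :
    MeasurePreserving (fun q : Hp (outNormal S j) × ℝ =>
      S.altitudeFoot j + (q.1 : Sp d) + (-c * q.2) • outNormal S j)
      (volume.prod volume) (ENNReal.ofReal c⁻¹ • volume) := by
  have h1 := measurePreserving_tube (norm_outNormal S j) (S.altitudeFoot j)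
  have h2 : MeasurePreserving (fun t : ℝ => -c * t) volume (ENNReal.ofReal c⁻¹ • volume) := by
    refine ⟨by fun_prop, ?_⟩
    rw [Real.map_volume_mul_left (neg_ne_zero.mpr hc.ne')]
    rw [inv_neg, abs_neg, abs_of_pos (inv_pos.mpr hc)]
  have h3 := (MeasurePreserving.id (volume : Measure (Hp (outNormal S j)))).prod h2
  rw [Measure.prod_smul_right] at h3
  exact (h1.smul_measure (ENNReal.ofReal c⁻¹)).comp h3

/-- In the coordinates `x = x₀ + y - ε h t n`, with `h` the height, `lam S j x / ε` equals `t` and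
the Jacobian cancels the prefactor, so the shrinking layer becomes the fixed strip `1 ≤ t ≤ 2`. As
`ε → 0` the points tend to `x₀ + y`; over almost every point of the face the remaining cutoff
factors become 1 and `g` tends to its face value. By dominated convergence the limit is the face
integral times the integral of `deriv cut`, which is 1. -/
theorem tendsto_face_integral (j : Fin (d + 1)) {g : Sp d → ℝ}
    (hgm : AEStronglyMeasurable g (volume.restrict S.interior)) {m : ℝ}
    (hm : ∀ x ∈ S.interior, |g x| ≤ m)
    (hc : ∀ᵐ x ∂(surf d).restrict (S.faceOpposite j).closedInterior,
      Tendsto g (𝓝[S.interior] x) (𝓝 (g x))) :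
    Tendsto (fun ε => ∫ x in S.interior, g x * ((ε * S.height j)⁻¹ * deriv cut (lam S j x / ε)
      * chiErase S j ε x)) (𝓝[>] 0)
      (𝓝 (∫ x in (S.faceOpposite j).closedInterior, g x ∂(surf d))) := by
  have hh := S.height_pos j
  set h := S.height j
  set n := outNormal S j
  have hn1 : ‖n‖ = 1 := norm_outNormal S j
  set x₀ := S.altitudeFoot j
  set K := S.interior with hKdef
  have hKo : IsOpen K := isOpen_interior S
  set ψ : ℝ → Hp n × ℝ → Sp d := fun ε q => x₀ + (q.1 : Sp d) + (-(ε * h) * q.2) • n with hψ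
  have hlam : ∀ ε q, lam S j (ψ ε q) = ε * q.2 := fun ε q => by
    rw [hψ]
    simp only
    rw [lam_tube]
    rw [show S.height j = h from rfl]
    field_simp
  have hm0 : 0 ≤ m := by
    obtain ⟨c, hcK⟩ := nonempty_interior S
    exact (abs_nonneg _).trans (hm c hcK)
  have hgi : AEStronglyMeasurable (K.indicator g) volume :=
    (aestronglyMeasurable_indicator_iff hKo.measurableSet).mpr hgm
  have hgb : ∀ x, |K.indicator g x| ≤ m := fun x => by
    by_cases hx : x ∈ K
    · rw [Set.indicator_of_mem hx]; exact hm x hx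
    · rw [Set.indicator_of_notMem hx]; simpa using hm0
  have hcE : ∀ ε, Continuous (chiErase S j ε) := fun ε => by
    unfold chiErase
    exact continuous_finsetProd _ fun i _ =>
      contDiff_cut.continuous.comp ((continuous_lam S i).div_const ε)
  have hψc : ∀ ε, Continuous (ψ ε) := fun ε => by rw [hψ]; fun_prop
  have hmeas : ∀ ε > 0, AEStronglyMeasurable (fun q => K.indicator g (ψ ε q)
      * (deriv cut q.2 * chiErase S j ε (ψ ε q))) (volume.prod volume) := fun ε hε => by
    refine AEStronglyMeasurable.mul ?_ ?_
    · refine AEStronglyMeasurable.comp_quasiMeasurePreserving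
        (hgi.smul_measure (ENNReal.ofReal (ε * h)⁻¹))
        (measurePreserving_layer S j (mul_pos hε hh)).quasiMeasurePreserving
    · exact ((continuous_deriv_cut.comp continuous_snd).mul
        ((hcE ε).comp (hψc ε))).aestronglyMeasurable
  have key : ∀ ε > 0, ∫ x in K, g x * ((ε * h)⁻¹ * deriv cut (lam S j x / ε) * chiErase S j ε x)
      = ∫ q, K.indicator g (ψ ε q) * (deriv cut q.2 * chiErase S j ε (ψ ε q))
          ∂(volume.prod volume) := fun ε hε => by
    have hpos := mul_pos hε hh
    have hmp := measurePreserving_layer S j hpos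
    have hF : AEStronglyMeasurable (fun x => K.indicator g x *
        (deriv cut (lam S j x / ε) * chiErase S j ε x)) volume :=
      hgi.mul ((continuous_deriv_cut.comp ((continuous_lam S j).div_const ε)).mul
        (hcE ε)).aestronglyMeasurable
    have h1 := integral_map (φ := ψ ε) (μ := volume.prod volume) hmp.measurable.aemeasurable
      (f := fun x => K.indicator g x * (deriv cut (lam S j x / ε) * chiErase S j ε x))
      (by
        have : Measure.map (ψ ε) (volume.prod volume) = ENNReal.ofReal (ε * h)⁻¹ • volume :=
          hmp.map_eq
        rw [this]
        exact hF.smul_measure _)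
    have h2 : Measure.map (ψ ε) (volume.prod volume) = ENNReal.ofReal (ε * h)⁻¹ • volume :=
      hmp.map_eq
    rw [h2, integral_smul_measure, ENNReal.toReal_ofReal (inv_pos.mpr hpos).le] at h1
    have h3 : ∀ q, lam S j (ψ ε q) / ε = q.2 := fun q => by
      rw [hlam]; field_simp
    simp only [h3] at h1
    rw [← h1, ← integral_indicator hKo.measurableSet, smul_eq_mul, ← integral_const_mul]
    refine integral_congr_ae (Eventually.of_forall fun x => ?_)
    by_cases hx : x ∈ K
    · simp only [Set.indicator_of_mem hx]; ring
    · simp only [Set.indicator_of_notMem hx]; ring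
  obtain ⟨C, hC0, hC⟩ := exists_bound_deriv_cut
  obtain ⟨R, hR⟩ := (isCompact_closedInterior S).isBounded.subset_closedBall x₀
  -- The radius `R` encloses the simplex around `x₀`; for `ε < 1` and `t ≤ 2` the displacement along
  -- the normal is at most `2 * h`. Outside this cylinder the integrand vanishes.
  set bound : Hp n × ℝ → ℝ :=
    (Metric.closedBall (0 : Hp n) (R + 2 * h) ×ˢ Set.Icc (1 : ℝ) 2).indicator fun _ => m * C
  have hbi : Integrable bound (volume.prod volume) := by
    refine (integrable_indicator_iff ?_).mpr ?_
    · exact Metric.isClosed_closedBall.measurableSet.prod measurableSet_Icc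
    · refine integrableOn_const (μ := volume.prod volume) (C := m * C) ?_
      rw [Measure.prod_prod]
      exact ENNReal.mul_ne_top measure_closedBall_lt_top.ne measure_Icc_lt_top.ne
  have hface : MeasurableSet (S.faceOpposite j).closedInterior :=
    (isClosed_face S j).measurableSet
  have hlim : Tendsto (fun ε => ∫ q, K.indicator g (ψ ε q)
      * (deriv cut q.2 * chiErase S j ε (ψ ε q)) ∂(volume.prod volume)) (𝓝[>] 0)
      (𝓝 (∫ q : Hp n × ℝ, (S.faceOpposite j).closedInterior.indicator g (x₀ + (q.1 : Sp d))
        * deriv cut q.2 ∂(volume.prod volume))) := by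
    refine tendsto_integral_filter_of_dominated_convergence bound ?_ ?_ hbi ?_
    · filter_upwards [self_mem_nhdsWithin] with ε hε using hmeas ε hε
    · filter_upwards [Ioo_mem_nhdsGT (zero_lt_one (α := ℝ))] with ε hε
      refine Eventually.of_forall fun q => ?_
      by_cases hq : q ∈ Metric.closedBall (0 : Hp n) (R + 2 * h) ×ˢ Set.Icc (1 : ℝ) 2
      · simp only [bound, Set.indicator_of_mem hq]
        rw [Real.norm_eq_abs, abs_mul, abs_mul, abs_of_nonneg (chiErase_nonneg S j ε _)]
        refine mul_le_mul (hgb _) ?_ (mul_nonneg (abs_nonneg _) (chiErase_nonneg S j ε _)) hm0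
        exact (mul_le_mul (hC _) (chiErase_le_one S j ε _) (chiErase_nonneg S j ε _) hC0).trans
          (mul_one C).le
      · simp only [bound, Set.indicator_of_notMem hq]
        rw [norm_le_zero_iff]
        by_cases h2 : q.2 ∈ Set.Icc (1 : ℝ) 2
        · have hK : ψ ε q ∉ K := by
            intro hK
            apply hq
            refine ⟨?_, h2⟩
            rw [mem_closedBall_zero_iff]
            have h3 := hR (S.interior_subset_closedInterior hK)
            rw [mem_closedBall_iff_norm] at h3
            have h4 : ((q.1 : Hp n) : Sp d) = (ψ ε q - x₀) + ((ε * h) * q.2) • n := by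
              rw [hψ]; simp only [neg_mul, neg_smul]; abel
            have h5 : ‖(q.1 : Sp d)‖ ≤ ‖ψ ε q - x₀‖ + ‖((ε * h) * q.2) • n‖ := by
              conv_lhs => rw [h4]
              exact norm_add_le _ _
            have h6 : ‖((ε * h) * q.2) • n‖ ≤ 2 * h := by
              rw [norm_smul, hn1, mul_one, Real.norm_eq_abs, abs_of_nonneg
                (mul_nonneg (mul_nonneg hε.1.le hh.le) (by linarith [h2.1]))]
              have : ε * q.2 ≤ 1 * 2 :=
                mul_le_mul hε.2.le h2.2 (by linarith [h2.1]) zero_le_one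
              nlinarith
            rw [Submodule.norm_coe] at h5
            linarith
          rw [Set.indicator_of_notMem hK, zero_mul]
        · have : deriv cut q.2 = 0 := by
            rw [Set.mem_Icc, not_and_or, not_le, not_le] at h2
            rcases h2 with h | h
            · exact deriv_cut_of_le h.le
            · exact deriv_cut_of_ge h.le
          rw [this]; ring
    · have hae : ∀ᵐ y : Hp n, (∀ i, i ≠ j → lam S i (x₀ + (y : Sp d)) ≠ 0) ∧
          (x₀ + (y : Sp d) ∈ (S.faceOpposite j).closedInterior →
            Tendsto g (𝓝[K] (x₀ + (y : Sp d))) (𝓝 (g (x₀ + (y : Sp d))))) := by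
        refine Eventually.and ?_ ?_
        · rw [eventually_all]
          intro i
          by_cases hij : i = j
          · exact Eventually.of_forall fun y h => absurd hij h
          · have := volume_lam_zero S hij
            rw [ae_iff]
            simpa [hij] using this
        · rw [ae_restrict_iff' hface] at hc
          have h1 : ∀ᵐ x ∂(surf d).restrict {x | inner ℝ n (x - x₀) = 0},
              x ∈ (S.faceOpposite j).closedInterior → Tendsto g (𝓝[K] x) (𝓝 (g x)) :=
            ae_restrict_of_ae hc
          rw [← map_flat (norm_outNormal S j)] at h1
          exact ae_of_ae_map (measurableEmbedding_flat n x₀).measurable.aemeasurable h1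
      have hae2 := (Measure.quasiMeasurePreserving_fst
        (μ := (volume : Measure (Hp n))) (ν := (volume : Measure ℝ))).ae hae
      filter_upwards [hae2] with q hq
      obtain ⟨hq0, hqc⟩ := hq
      by_cases h2 : q.2 ∈ Set.Icc (1 : ℝ) 2
      swap
      · have : deriv cut q.2 = 0 := by
          rw [Set.mem_Icc, not_and_or, not_le, not_le] at h2
          rcases h2 with h | h
          · exact deriv_cut_of_le h.le
          · exact deriv_cut_of_ge h.le
        simp only [this, zero_mul, mul_zero]
        exact tendsto_const_nhds
      have hψt : Tendsto (fun ε => ψ ε q) (𝓝[>] 0) (𝓝 (x₀ + (q.1 : Sp d))) := by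
        have : Continuous fun ε : ℝ => ψ ε q := by rw [hψ]; fun_prop
        have h3 := this.tendsto 0
        have h4 : ψ 0 q = x₀ + (q.1 : Sp d) := by rw [hψ]; simp
        rw [h4] at h3
        exact h3.mono_left nhdsWithin_le_nhds
      have hlt : ∀ i, Tendsto (fun ε => lam S i (ψ ε q)) (𝓝[>] 0)
          (𝓝 (lam S i (x₀ + (q.1 : Sp d)))) := fun i =>
        ((continuous_lam S i).tendsto _).comp hψt
      have hj0 : lam S j (x₀ + (q.1 : Sp d)) = 0 := by
        have := lam_tube S j q.1 0
        simpa using this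
      -- If the limit point is off the face, some coordinate is negative there and the approximating
      -- points eventually lie outside the simplex. Otherwise all coordinates except the `j`-th are
      -- strictly positive, so the points eventually lie in the open simplex and beyond the layers
      -- of the other faces.
      by_cases hneg : ∃ i, lam S i (x₀ + (q.1 : Sp d)) < 0
      · obtain ⟨i, hi⟩ := hneg
        rw [Set.indicator_of_notMem (fun hf => absurd (((mem_faceOpposite_iff S j _).mp hf).2 i)
          (not_le.mpr hi)), zero_mul]
        refine tendsto_const_nhds.congr' ?_
        filter_upwards [(hlt i).eventually (gt_mem_nhds hi)] with ε hε
        rw [Set.indicator_of_notMem (fun hf => absurd ((mem_interior_iff S _).mp hf i)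
          (not_lt.mpr (le_of_lt hε))), zero_mul]
      · push Not at hneg
        have hf : x₀ + (q.1 : Sp d) ∈ (S.faceOpposite j).closedInterior :=
          (mem_faceOpposite_iff S j _).mpr ⟨hj0, hneg⟩
        have hpos : ∀ i, i ≠ j → 0 < lam S i (x₀ + (q.1 : Sp d)) := fun i hi =>
          lt_of_le_of_ne (hneg i) (hq0 i hi).symm
        have hevK : ∀ᶠ ε in 𝓝[>] (0 : ℝ), ψ ε q ∈ K := by
          have : ∀ i, ∀ᶠ ε in 𝓝[>] (0 : ℝ), 0 < lam S i (ψ ε q) := fun i => by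
            by_cases hij : i = j
            · filter_upwards [self_mem_nhdsWithin] with ε hε
              rw [hij, hlam]
              exact mul_pos hε (by linarith [h2.1])
            · exact (hlt i).eventually (lt_mem_nhds (hpos i hij))
          filter_upwards [eventually_all.mpr this] with ε hε
          exact (mem_interior_iff S _).mpr hε
        have hev1 : ∀ᶠ ε in 𝓝[>] (0 : ℝ), chiErase S j ε (ψ ε q) = 1 := by
          have : ∀ i, ∀ᶠ ε in 𝓝[>] (0 : ℝ), i ≠ j → cut (lam S i (ψ ε q) / ε) = 1 := fun i => by
            by_cases hij : i = j
            · exact Eventually.of_forall fun ε h => absurd hij h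
            · filter_upwards [(hlt i).eventually (lt_mem_nhds (half_lt_self (hpos i hij))),
                Ioo_mem_nhdsGT (show 0 < lam S i (x₀ + (q.1 : Sp d)) / 4 by
                  linarith [hpos i hij])] with ε h3 h4 _
              apply cut_of_ge
              rw [le_div_iff₀ h4.1]
              linarith [h4.2]
          filter_upwards [eventually_all.mpr this] with ε hε
          exact Finset.prod_eq_one fun i hi => hε i (Finset.ne_of_mem_erase hi)
        rw [Set.indicator_of_mem hf]
        have hg := (hqc hf).comp (tendsto_nhdsWithin_iff.mpr ⟨hψt, hevK⟩)
        refine (hg.mul_const (deriv cut q.2)).congr' ?_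
        filter_upwards [hevK, hev1] with ε h3 h4
        rw [Set.indicator_of_mem h3, h4, mul_one, Function.comp_apply]
  rw [integral_prod_mul (μ := (volume : Measure (Hp n))) (ν := (volume : Measure ℝ))
    (fun y : Hp n => (S.faceOpposite j).closedInterior.indicator g (x₀ + (y : Sp d)))
    (fun t => deriv cut t), integral_deriv_cut, mul_one,
    ← integral_surf_flat (norm_outNormal S j) x₀ (face_subset_hyperplane S j) hface] at hlim
  refine hlim.congr' ?_
  filter_upwards [self_mem_nhdsWithin] with ε hε using (key ε hε).symm

end FaceLimit

/-! ### Essentially bounded functions -/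

section Bounded

variable {α : Type*} [MeasurableSpace α] {μ : Measure α}

theorem memLp_top_mul {f g : α → ℝ} (hf : MemLp f ⊤ μ) (hg : MemLp g ⊤ μ) :
    MemLp (fun x => f x * g x) ⊤ μ :=
  MemLp.mul (p := ⊤) (q := ⊤) hg hf

theorem exists_ae_bound {f : α → ℝ} (hf : MemLp f ⊤ μ) : ∃ c, 0 ≤ c ∧ ∀ᵐ x ∂μ, |f x| ≤ c := by
  refine ⟨(eLpNormEssSup f μ).toReal, ENNReal.toReal_nonneg, ?_⟩
  have h : eLpNormEssSup f μ ≠ ⊤ := by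
    rw [← eLpNorm_exponent_top]; exact hf.eLpNorm_ne_top
  filter_upwards [ae_le_eLpNormEssSup (f := f) (μ := μ)] with x hx
  have := ENNReal.toReal_mono h hx
  simpa using this

theorem memLp_top_of_continuous {X : Type*} [PseudoMetricSpace X] [ProperSpace X]
    [MeasurableSpace X] [BorelSpace X] [SecondCountableTopology X]
    {μ : Measure X} {f : X → ℝ} (hf : Continuous f)
    {s : Set X} (hs : Bornology.IsBounded s) (hm : MeasurableSet s) :
    MemLp f ⊤ (μ.restrict s) := by
  obtain ⟨c, hc⟩ := hs.isCompact_closure.exists_bound_of_continuousOn hf.continuousOn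
  exact memLp_top_of_bound hf.aestronglyMeasurable.restrict c
    (ae_restrict_of_forall_mem hm fun x hx => hc x (subset_closure hx))

end Bounded

/-! ### The Gauss-Green formula on a simplex -/

section GaussGreen

variable {d : ℕ} [NeZero d] (S : Affine.Simplex ℝ (Sp d) d)

set_option linter.unusedSectionVars false in
theorem isBounded_interior : Bornology.IsBounded S.interior :=
  (isCompact_closedInterior S).isBounded.subset S.interior_subset_closedInterior

theorem isFiniteMeasure_interior : IsFiniteMeasure (volume.restrict S.interior) :=
  ⟨by rw [Measure.restrict_apply_univ]; exact (isBounded_interior S).measure_lt_top⟩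

theorem face_subset_closure (j : Fin (d + 1)) :
    (S.faceOpposite j).closedInterior ⊆ closure S.interior := fun x hx =>
  closedInterior_subset_closure S <|
    (mem_closedInterior_iff S x).mpr ((mem_faceOpposite_iff S j x).mp hx).2

/-- The flux of a bounded vector field through the transition layer of the cutoff tends to its flux
through the face. -/
theorem tendsto_face_flux (j : Fin (d + 1)) {f φ : Sp d → ℝ}
    (hf : MemLp f ⊤ (volume.restrict S.interior))
    (hc : ∀ᵐ x ∂(surf d).restrict (S.faceOpposite j).closedInterior,
      Tendsto f (𝓝[S.interior] x) (𝓝 (f x))) (hφ : Continuous φ) :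
    Tendsto (fun ε => ∫ x in S.interior, f x * φ x * ((ε * S.height j)⁻¹ *
      deriv cut (lam S j x / ε) * chiErase S j ε x)) (𝓝[>] 0)
      (𝓝 (∫ x in (S.faceOpposite j).closedInterior, f x * φ x ∂(surf d))) := by
  obtain ⟨c, hc0, hcb⟩ := exists_ae_bound hf
  set tr : ℝ → ℝ := fun t => max (-c) (min c t) with htr
  have htrc : Continuous tr := by fun_prop
  have htr_id : ∀ t, |t| ≤ c → tr t = t := fun t ht => by
    rw [abs_le] at ht
    rw [htr]; simp only
    rw [min_eq_right ht.2, max_eq_right ht.1]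
  have htrb : ∀ t, |tr t| ≤ c := fun t =>
    abs_le.mpr ⟨le_max_left _ _, max_le (by linarith) (min_le_left _ _)⟩
  obtain ⟨b, hb⟩ := (isCompact_closedInterior S).exists_bound_of_continuousOn hφ.continuousOn
  have hface : MeasurableSet (S.faceOpposite j).closedInterior := (isClosed_face S j).measurableSet
  have h := tendsto_face_integral S j (g := fun x => tr (f x) * φ x) (m := c * b)
    ((htrc.comp_aestronglyMeasurable hf.1).mul hφ.aestronglyMeasurable)
    (fun x hx => by
      rw [abs_mul]
      exact mul_le_mul (htrb _) (hb x (S.interior_subset_closedInterior hx)) (abs_nonneg _) hc0)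
    (by
      filter_upwards [hc] with x hx
      exact ((htrc.tendsto _).comp hx).mul (hφ.continuousAt.continuousWithinAt))
  have h1 : ∫ x in (S.faceOpposite j).closedInterior, tr (f x) * φ x ∂(surf d)
      = ∫ x in (S.faceOpposite j).closedInterior, f x * φ x ∂(surf d) := by
    refine integral_congr_ae ?_
    filter_upwards [hc, ae_restrict_mem hface] with x hx hxf
    have hcl : IsClosed {t : ℝ | |t| ≤ c} := isClosed_le continuous_abs continuous_const
    have := mem_of_tendsto_of_ae (isOpen_interior S) (face_subset_closure S j hxf) hcl hx hcb
    rw [htr_id _ this]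
  rw [h1] at h
  refine h.congr fun ε => integral_congr_ae ?_
  filter_upwards [hcb] with x hx
  rw [htr_id _ hx]

/-- The Gauss-Green formula on a simplex for a bounded vector field with bounded distributional
divergence whose normal component is continuous up to almost every boundary point. -/
theorem gauss_green {a : Fin d → Sp d → ℝ} {D : Sp d → ℝ}
    (ha : ∀ k, MemLp (a k) ⊤ (volume.restrict S.interior))
    (hD : MemLp D ⊤ (volume.restrict S.interior))
    (hdiv : ∀ φ : Sp d → ℝ, ContDiff ℝ ∞ φ → HasCompactSupport φ → tsupport φ ⊆ S.interior →
      ∑ k, ∫ x in S.interior, a k x * fderiv ℝ φ x (EuclideanSpace.single k 1)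
        = - ∫ x in S.interior, D x * φ x)
    (hc : ∀ j, ∀ᵐ x ∂(surf d).restrict (S.faceOpposite j).closedInterior,
      Tendsto (fun y => ∑ k, outNormal S j k * a k y) (𝓝[S.interior] x)
        (𝓝 (∑ k, outNormal S j k * a k x)))
    {φ : Sp d → ℝ} (hφ : ContDiff ℝ ∞ φ) :
    (∑ k, ∫ x in S.interior, a k x * fderiv ℝ φ x (EuclideanSpace.single k 1))
      + (∫ x in S.interior, D x * φ x)
      = ∑ j, ∫ x in (S.faceOpposite j).closedInterior,
          (∑ k, outNormal S j k * a k x) * φ x ∂(surf d) := by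
  have := isFiniteMeasure_interior S
  have hKo := isOpen_interior S
  have hKb := isBounded_interior S
  set K := S.interior
  have hcφ : ∀ k, Continuous fun x => fderiv ℝ φ x (EuclideanSpace.single k 1) := fun k =>
    (hφ.continuous_fderiv (by simp)).clm_apply continuous_const
  have hcb : ∀ {f : Sp d → ℝ}, Continuous f → MemLp f ⊤ (volume.restrict K) := fun hf =>
    memLp_top_of_continuous hf hKb hKo.measurableSet
  have hint : ∀ {f : Sp d → ℝ}, MemLp f ⊤ (volume.restrict K) → IntegrableOn f K := fun hf =>
    hf.integrable le_top
  have hchi : ∀ ε, Continuous (chi S ε) := fun ε => (contDiff_chi S ε).continuous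
  have hlayer : ∀ j ε, Continuous fun x => (ε * S.height j)⁻¹ * deriv cut (lam S j x / ε)
      * chiErase S j ε x := fun j ε => by
    refine (continuous_const.mul (continuous_deriv_cut.comp
      ((continuous_lam S j).div_const ε))).mul ?_
    unfold chiErase
    exact continuous_finsetProd _ fun i _ =>
      contDiff_cut.continuous.comp ((continuous_lam S i).div_const ε)
  have hna : ∀ j, MemLp (fun x => ∑ k, outNormal S j k * a k x) ⊤ (volume.restrict K) := fun j =>
    memLp_finsetSum _ fun k _ => (ha k).const_mul _
  -- the identity for the truncated test function
  have hid : ∀ ε > 0,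
      ∫ x in K, ((∑ k, a k x * fderiv ℝ φ x (EuclideanSpace.single k 1)) + D x * φ x) * chi S ε x
      = ∑ j, ∫ x in K, (∑ k, outNormal S j k * a k x) * φ x * ((ε * S.height j)⁻¹ *
        deriv cut (lam S j x / ε) * chiErase S j ε x) := by
    intro ε hε
    -- The cutoff makes `φ` admissible in the weak divergence identity. The product rule then
    -- separates the interior terms, weighted by the cutoff, from the layer terms, in which only the
    -- normal component of the field appears.
    have hsm : ContDiff ℝ ∞ fun x => φ x * chi S ε x := hφ.mul (contDiff_chi S ε)
    have hts : tsupport (fun x => φ x * chi S ε x) ⊆ tsupport (chi S ε) :=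
      tsupport_mul_subset_right
    have h := hdiv _ hsm ((hasCompactSupport_chi S hε).mono'
      ((subset_tsupport _).trans hts)) (hts.trans (tsupport_chi_subset_interior S hε))
    have hcd : ∀ k, Continuous fun x =>
        fderiv ℝ (fun x => φ x * chi S ε x) x (EuclideanSpace.single k 1) := fun k =>
      (hsm.continuous_fderiv (by simp)).clm_apply continuous_const
    rw [← integral_finsetSum _ fun k _ => hint (memLp_top_mul (ha k) (hcb (hcd k))),
      eq_neg_iff_add_eq_zero, ← integral_add
        (integrable_finsetSum _ fun k _ => hint (memLp_top_mul (ha k) (hcb (hcd k))))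
        (hint (memLp_top_mul hD (hcb hsm.continuous)))] at h
    rw [← integral_finsetSum _ fun j _ => hint (memLp_top_mul (memLp_top_mul (hna j)
      (hcb hφ.continuous)) (hcb (hlayer j ε))), ← sub_eq_zero, ← h, ← integral_sub]
    · refine integral_congr_ae (Eventually.of_forall fun x => ?_)
      have hfd : ∀ k, fderiv ℝ (fun x => φ x * chi S ε x) x (EuclideanSpace.single k 1)
          = φ x * fderiv ℝ (chi S ε) x (EuclideanSpace.single k 1)
            + chi S ε x * fderiv ℝ φ x (EuclideanSpace.single k 1) := fun k => by
        rw [fderiv_fun_mul (hφ.differentiable (by simp) x)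
          ((contDiff_chi S ε).differentiable (by simp) x)]
        simp
      have hin : ∀ j k, inner ℝ (outNormal S j) (EuclideanSpace.single k (1 : ℝ))
          = outNormal S j k := fun j k => by
        rw [EuclideanSpace.inner_single_right]; simp
      simp only [hfd, fderiv_chi, hin]
      have hswap : ∑ k, a k x * (φ x * -∑ j, (ε * S.height j)⁻¹ * deriv cut (lam S j x / ε) *
            chiErase S j ε x * outNormal S j k)
          = - ∑ j, (∑ k, outNormal S j k * a k x) * φ x * ((ε * S.height j)⁻¹ *
            deriv cut (lam S j x / ε) * chiErase S j ε x) := by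
        simp only [mul_neg, Finset.mul_sum, Finset.sum_mul, Finset.sum_neg_distrib]
        rw [Finset.sum_comm]
        congr 1
        refine Finset.sum_congr rfl fun j _ => Finset.sum_congr rfl fun k _ => ?_
        ring
      simp only [mul_add, Finset.sum_add_distrib]
      rw [hswap, add_mul, Finset.sum_mul, sub_eq_add_neg]
      have : ∑ k, a k x * (chi S ε x * fderiv ℝ φ x (EuclideanSpace.single k 1))
          = ∑ k, a k x * fderiv ℝ φ x (EuclideanSpace.single k 1) * chi S ε x :=
        Finset.sum_congr rfl fun k _ => by ring
      rw [this]
      ring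
    · refine hint (memLp_top_mul (MemLp.add (memLp_finsetSum _ fun k _ => ?_)
        (memLp_top_mul hD (hcb hφ.continuous))) (hcb (hchi ε)))
      exact memLp_top_mul (ha k) (hcb (hcφ k))
    · exact integrable_finsetSum _ fun j _ => hint (memLp_top_mul (memLp_top_mul (hna j)
        (hcb hφ.continuous)) (hcb (hlayer j ε)))
  set F : Sp d → ℝ := fun x => (∑ k, a k x * fderiv ℝ φ x (EuclideanSpace.single k 1)) + D x * φ x
    with hF
  have hFm : MemLp F ⊤ (volume.restrict K) :=
    MemLp.add (memLp_finsetSum _ fun k _ => memLp_top_mul (ha k) (hcb (hcφ k)))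
      (memLp_top_mul hD (hcb hφ.continuous))
  have hl : Tendsto (fun ε => ∫ x in K, F x * chi S ε x) (𝓝[>] 0) (𝓝 (∫ x in K, F x)) := by
    refine tendsto_integral_filter_of_dominated_convergence (fun x => ‖F x‖) ?_ ?_
      (hint hFm).norm ?_
    · exact Eventually.of_forall fun ε => hFm.1.mul (hchi ε).aestronglyMeasurable
    · refine Eventually.of_forall fun ε => Eventually.of_forall fun x => ?_
      rw [norm_mul, Real.norm_of_nonneg (chi_nonneg S ε x)]
      exact mul_le_of_le_one_right (norm_nonneg _) (chi_le_one S ε x)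
    · filter_upwards [ae_restrict_mem hKo.measurableSet] with x hx
      refine tendsto_const_nhds.congr' ?_
      filter_upwards [tendsto_chi S hx] with ε hε
      rw [hε, mul_one]
  have hr := tendsto_finsetSum Finset.univ fun j _ =>
    tendsto_face_flux S j (hna j) (hc j) hφ.continuous
  have heq := tendsto_nhds_unique (hl.congr' (by
    filter_upwards [self_mem_nhdsWithin] with ε hε using hid ε hε)) hr
  rw [← heq, hF, integral_add (integrable_finsetSum _ fun k _ =>
      hint (memLp_top_mul (ha k) (hcb (hcφ k)))) (hint (memLp_top_mul hD (hcb hφ.continuous))),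
    integral_finsetSum _ fun k _ => hint (memLp_top_mul (ha k) (hcb (hcφ k)))]

end GaussGreen

/-! ### Geometry of the mesh -/

section MeshGeometry

set_option linter.unusedSectionVars false

variable {d : ℕ} [NeZero d] {Ω : Set (Sp d)} (M : Mesh d Ω)

/-- The relative interior of the face `s`. -/
def Mesh.relFace (s : M.Side) : Set (Sp d) :=
  {x | lam (M.elem s.1) s.2 x = 0 ∧ ∀ i, i ≠ s.2 → 0 < lam (M.elem s.1) i x}

theorem Mesh.mem_face_iff (s : M.Side) (x : Sp d) :
    x ∈ M.face s ↔ lam (M.elem s.1) s.2 x = 0 ∧ ∀ i, 0 ≤ lam (M.elem s.1) i x :=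
  mem_faceOpposite_iff _ _ _

theorem Mesh.normal_eq (s : M.Side) : M.normal s = outNormal (M.elem s.1) s.2 := rfl

theorem Mesh.norm_normal (s : M.Side) : ‖M.normal s‖ = 1 := norm_outNormal _ _

theorem Mesh.measurableSet_face (s : M.Side) : MeasurableSet (M.face s) :=
  (isClosed_face _ _).measurableSet

theorem Mesh.surf_face_lt_top (s : M.Side) : surf d (M.face s) < ⊤ :=
  surf_lt_top_of_bounded (norm_outNormal (M.elem s.1) s.2) _ (face_subset_hyperplane _ _)
    ((M.elem s.1).faceOpposite s.2).isCompact_closedInterior.isBounded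

theorem Mesh.relFace_subset_face (s : M.Side) : M.relFace s ⊆ M.face s := by
  intro x hx
  rw [M.mem_face_iff]
  refine ⟨hx.1, fun i => ?_⟩
  by_cases hi : i = s.2
  · rw [hi, hx.1]
  · exact (hx.2 i hi).le

theorem Mesh.face_subset_closedInterior (s : M.Side) :
    M.face s ⊆ (M.elem s.1).closedInterior := fun x hx =>
  (mem_closedInterior_iff _ x).mpr ((M.mem_face_iff s x).mp hx).2

/-- A point of the face outside its relative interior has a second vanishing coordinate, hence lies
on another face of the same simplex. -/
theorem Mesh.surf_face_diff_relFace (s : M.Side) : surf d (M.face s \ M.relFace s) = 0 := by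
  refine surf_null_of_flat_null (norm_outNormal (M.elem s.1) s.2) ((M.elem s.1).altitudeFoot s.2)
    (Set.sdiff_subset.trans (face_subset_hyperplane _ _)) ?_
  refine measure_mono_null (t := ⋃ i : {i // i ≠ s.2}, {y : Hp (outNormal (M.elem s.1) s.2) |
    lam (M.elem s.1) i ((M.elem s.1).altitudeFoot s.2 + (y : Sp d)) = 0}) ?_ ?_
  · rintro y ⟨h1, h2⟩
    rw [M.mem_face_iff] at h1
    by_contra hcon
    simp only [Set.mem_iUnion, Set.mem_ofPred_eq, not_exists] at hcon
    exact h2 ⟨h1.1, fun i hi => lt_of_le_of_ne (h1.2 i) (Ne.symm (hcon ⟨i, hi⟩))⟩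
  · exact measure_iUnion_null fun i => volume_lam_zero _ i.2

theorem Mesh.ae_mem_relFace (s : M.Side) : ∀ᵐ x ∂surf d, x ∈ M.face s → x ∈ M.relFace s := by
  rw [ae_iff]
  convert M.surf_face_diff_relFace s using 2
  ext x
  simp

/-- At a relative interior point of a face only one coordinate vanishes, and it increases along any
direction with negative normal component; the others stay positive by continuity. -/
theorem Mesh.eventually_mem_K {s : M.Side} {x v : Sp d} (hx : x ∈ M.relFace s)
    (hv : inner ℝ (M.normal s) v < 0) : ∀ᶠ t in 𝓝[>] (0 : ℝ), x + t • v ∈ M.K s.1 := by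
  have hall : ∀ i, ∀ᶠ t in 𝓝[>] (0 : ℝ), 0 < lam (M.elem s.1) i (x + t • v) := by
    intro i
    by_cases hi : i = s.2
    · filter_upwards [self_mem_nhdsWithin] with t ht
      have h1 := lam_sub (M.elem s.1) s.2 (x + t • v) x
      rw [hx.1, sub_zero, add_sub_cancel_left, inner_smul_right, ← M.normal_eq] at h1
      rw [hi, h1]
      have := inv_pos.mpr ((M.elem s.1).height_pos s.2)
      have h2 : t * inner ℝ (M.normal s) v < 0 := mul_neg_of_pos_of_neg ht hv
      nlinarith
    · have hc : Continuous fun t : ℝ => lam (M.elem s.1) i (x + t • v) :=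
        (continuous_lam _ i).comp (by fun_prop)
      have h0 := hc.tendsto 0
      rw [zero_smul, add_zero] at h0
      exact (h0.mono_left nhdsWithin_le_nhds).eventually (lt_mem_nhds (hx.2 i hi))
  filter_upwards [eventually_all.mpr hall] with t ht
  exact (mem_interior_iff _ _).mpr ht

/-- Near a relative interior point of a face the other constraints are inactive, so the closed
simplex contains the whole inner half of a neighbourhood. -/
theorem Mesh.eventually_mem_closedInterior {s : M.Side} {x : Sp d} (hx : x ∈ M.relFace s) :
    ∀ᶠ y in 𝓝 x, inner ℝ (M.normal s) (y - x) ≤ 0 → y ∈ (M.elem s.1).closedInterior := by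
  have hall : ∀ i, ∀ᶠ y in 𝓝 x, i ≠ s.2 → 0 < lam (M.elem s.1) i y := by
    intro i
    by_cases hi : i = s.2
    · exact Eventually.of_forall fun y h => absurd hi h
    · filter_upwards [((continuous_lam _ i).tendsto x).eventually (lt_mem_nhds (hx.2 i hi))]
        with y hy _ using hy
  filter_upwards [eventually_all.mpr hall] with y hy hn
  rw [mem_closedInterior_iff]
  intro i
  by_cases hi : i = s.2
  · have h1 := lam_sub (M.elem s.1) s.2 y x
    rw [hx.1, sub_zero, ← M.normal_eq] at h1
    rw [hi, h1]
    have := inv_pos.mpr ((M.elem s.1).height_pos s.2)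
    nlinarith
  · exact (hy i hi).le

/-- If the unit normals `n`, `n'` were not opposite, `-(n + n')` would have negative inner product
with both, since `‖n + n'‖² = 2 + 2 n·n' > 0`. A small step in that direction would then enter both
open elements, which are disjoint. -/
theorem Mesh.normal_eq_neg {s s' : M.Side} {x : Sp d} (hx : x ∈ M.relFace s)
    (hx' : x ∈ M.relFace s') (hs : s.1 ≠ s'.1) : M.normal s' = - M.normal s := by
  by_contra hne
  have h1 : 0 < ‖M.normal s + M.normal s'‖ ^ 2 := by
    have : M.normal s + M.normal s' ≠ 0 := fun h => hne (eq_neg_of_add_eq_zero_right h)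
    positivity
  rw [norm_add_sq_real, M.norm_normal, M.norm_normal] at h1
  have h2 : inner ℝ (M.normal s) (-(M.normal s + M.normal s')) < 0 := by
    rw [inner_neg_right, inner_add_right, real_inner_self_eq_norm_sq, M.norm_normal]
    linarith
  have h3 : inner ℝ (M.normal s') (-(M.normal s + M.normal s')) < 0 := by
    rw [inner_neg_right, inner_add_right, real_inner_self_eq_norm_sq, M.norm_normal,
      real_inner_comm]
    linarith
  obtain ⟨t, ht, ht'⟩ := ((M.eventually_mem_K hx h2).and (M.eventually_mem_K hx' h3)).exists
  exact Set.disjoint_left.mp (M.disjoint hs) ht ht'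

theorem Mesh.isOpen_K (i : Fin M.N) : IsOpen (M.K i) := isOpen_interior _

theorem Mesh.closedInterior_subset (i : Fin M.N) : (M.elem i).closedInterior ⊆ closure Ω := by
  rw [← M.cover]
  exact Set.subset_iUnion (fun i => (M.elem i).closedInterior) i

theorem Mesh.face_subset_closure (s : M.Side) : M.face s ⊆ closure Ω :=
  (M.face_subset_closedInterior s).trans (M.closedInterior_subset s.1)

/-- The elements are only known to lie in the closure of the domain; being open they lie in its
interior, which is the domain by regularity. A slit could otherwise run through an element. -/
theorem Mesh.K_subset (hΩr : interior (closure Ω) = Ω) (i : Fin M.N) : M.K i ⊆ Ω := by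
  have h := interior_maximal ((M.elem i).interior_subset_closedInterior.trans
    (M.closedInterior_subset i)) (M.isOpen_K i)
  rwa [hΩr] at h

theorem Mesh.exists_face_of_not_mem_K {i : Fin M.N} {x : Sp d}
    (hx : x ∈ (M.elem i).closedInterior) (hK : x ∉ M.K i) : ∃ j, x ∈ M.face (i, j) := by
  have h1 : ¬ ∀ j, 0 < lam (M.elem i) j x := fun h => hK ((mem_interior_iff _ x).mpr h)
  rw [mem_closedInterior_iff] at hx
  push Not at h1
  obtain ⟨j, hj⟩ := h1
  exact ⟨j, (M.mem_face_iff _ x).mpr ⟨le_antisymm hj (hx j), hx⟩⟩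

/-- If the common point were in the open element `i'`, density of the open element `i` in its
closure would make the two open elements overlap. -/
theorem Mesh.exists_face_of_mem_two {i i' : Fin M.N} (hii : i ≠ i') {x : Sp d}
    (hx : x ∈ (M.elem i).closedInterior) (hx' : x ∈ (M.elem i').closedInterior) :
    ∃ j, x ∈ M.face (i', j) := by
  refine M.exists_face_of_not_mem_K hx' fun hK => ?_
  obtain ⟨y, hy, hy'⟩ := mem_closure_iff.mp (closedInterior_subset_closure _ hx) _
    (M.isOpen_K i') hK
  exact Set.disjoint_left.mp (M.disjoint hii) hy' hy

/-- The normals are opposite, so the two closed elements contain complementary halves of a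
neighbourhood of `x`. Hence `x` is interior to the closure of the domain, which is the domain
itself. -/
theorem Mesh.not_mem_frontier (hΩo : IsOpen Ω) (hΩr : interior (closure Ω) = Ω) {s s' : M.Side}
    {x : Sp d} (hx : x ∈ M.relFace s) (hx' : x ∈ M.relFace s') (hs : s.1 ≠ s'.1) :
    x ∉ frontier Ω := by
  have hn := M.normal_eq_neg hx hx' hs
  have : x ∈ interior (closure Ω) := by
    rw [mem_interior_iff_mem_nhds]
    filter_upwards [M.eventually_mem_closedInterior hx, M.eventually_mem_closedInterior hx']
      with y h1 h2
    rcases le_total (inner ℝ (M.normal s) (y - x)) 0 with h | h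
    · exact M.closedInterior_subset _ (h1 h)
    · refine M.closedInterior_subset _ (h2 ?_)
      rw [hn, inner_neg_left]
      linarith
  rw [hΩr] at this
  rw [frontier, hΩo.interior_eq]
  exact fun h => h.2 this

/-- Points slightly beyond the face are still in the domain, hence in closed elements other than
`s.1`. There are finitely many elements, so one of them contains such points arbitrarily close to
`x`, and being closed it contains `x`. -/
theorem Mesh.exists_neighbour (hΩo : IsOpen Ω) {s : M.Side} {x : Sp d} (hx : x ∈ M.relFace s)
    (hxΩ : x ∈ Ω) : ∃ s' : M.Side, s.1 ≠ s'.1 ∧ x ∈ M.face s' := by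
  have hlim : Tendsto (fun t : ℝ => x + t • M.normal s) (𝓝[>] 0) (𝓝 x) := by
    have : Continuous fun t : ℝ => x + t • M.normal s := by fun_prop
    have h := this.tendsto 0
    rw [zero_smul, add_zero] at h
    exact h.mono_left nhdsWithin_le_nhds
  have hev : ∀ᶠ t in 𝓝[>] (0 : ℝ), ∃ i, s.1 ≠ i ∧
      x + t • M.normal s ∈ (M.elem i).closedInterior := by
    filter_upwards [hlim (hΩo.mem_nhds hxΩ), self_mem_nhdsWithin] with t ht ht0
    have h1 := subset_closure (s := Ω) ht
    rw [← M.cover, Set.mem_iUnion] at h1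
    obtain ⟨i, hi⟩ := h1
    refine ⟨i, ?_, hi⟩
    rintro rfl
    rw [mem_closedInterior_iff] at hi
    have h2 := lam_sub (M.elem s.1) s.2 (x + t • M.normal s) x
    rw [hx.1, sub_zero, add_sub_cancel_left, inner_smul_right, ← M.normal_eq,
      real_inner_self_eq_norm_sq, M.norm_normal] at h2
    have h3 := hi s.2
    have := inv_pos.mpr ((M.elem s.1).height_pos s.2)
    rw [h2] at h3
    have : 0 < ((M.elem s.1).height s.2)⁻¹ * t := mul_pos this ht0
    linarith
  have hfr : ∃ i, ∃ᶠ t in 𝓝[>] (0 : ℝ), s.1 ≠ i ∧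
      x + t • M.normal s ∈ (M.elem i).closedInterior := by
    by_contra hcon
    push Not at hcon
    have h2 := eventually_all.mpr hcon
    obtain ⟨t, ⟨i, h3, h4⟩, h5⟩ := (hev.and h2).exists
    exact h5 i h3 h4
  obtain ⟨i, hi⟩ := hfr
  obtain ⟨_, hne, _⟩ := hi.exists
  have hxi : x ∈ (M.elem i).closedInterior :=
    (M.elem i).isClosed_closedInterior.mem_of_frequently_of_tendsto (hi.mono fun t h => h.2) hlim
  obtain ⟨j, hj⟩ := M.exists_face_of_mem_two hne
    (M.face_subset_closedInterior s (M.relFace_subset_face s hx)) hxi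
  exact ⟨(i, j), hne, hj⟩

/-! ### Mortars as a partition of the faces up to null sets -/

variable (Γ : BdDecomp Ω)

theorem Mesh.measurableSet_carrier (e : M.Mortar Γ) : MeasurableSet (M.carrier Γ e) := by
  rcases e with q | q
  · exact (M.measurableSet_face _).inter (M.measurableSet_face _)
  · exact (M.measurableSet_face _).inter (Γ.measurable _)

theorem Mesh.carrier_subset_face {e : M.Mortar Γ} {s : M.Side} (hs : s ∈ M.sides Γ e) :
    M.carrier Γ e ⊆ M.face s := by
  rcases e with q | q
  · simp only [Mesh.sides, Finset.mem_insert, Finset.mem_singleton] at hs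
    rcases hs with rfl | rfl
    · exact Set.inter_subset_left
    · exact Set.inter_subset_right
  · simp only [Mesh.sides, Finset.mem_singleton] at hs
    rw [hs]
    exact Set.inter_subset_left

theorem Mesh.surf_carrier_pos (e : M.Mortar Γ) : 0 < surf d (M.carrier Γ e) := by
  rcases e with q | q
  · exact q.2.2
  · exact q.2

theorem Mesh.exists_side (e : M.Mortar Γ) : ∃ s, s ∈ M.sides Γ e := by
  rcases e with q | q
  · exact ⟨q.1.1, by simp [Mesh.sides]⟩
  · exact ⟨q.1.1, by simp [Mesh.sides]⟩

theorem Mesh.isFiniteMeasure_carrier (e : M.Mortar Γ) :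
    IsFiniteMeasure ((surf d).restrict (M.carrier Γ e)) := by
  obtain ⟨s, hs⟩ := M.exists_side Γ e
  exact ⟨by
    rw [Measure.restrict_apply_univ]
    exact (measure_mono (M.carrier_subset_face Γ hs)).trans_lt (M.surf_face_lt_top s)⟩

theorem Mesh.other_side {q : M.IntMortar} {s : M.Side}
    (hs : s ∈ M.sides Γ (.inl q)) : ∃ s' : M.Side, s.1 ≠ s'.1 ∧
      M.carrier Γ (.inl q) = M.face s ∩ M.face s' ∧ (q.1 = (s, s') ∨ q.1 = (s', s)) := by
  simp only [Mesh.sides, Finset.mem_insert, Finset.mem_singleton] at hs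
  rcases hs with rfl | rfl
  · exact ⟨q.1.2, q.2.1.ne, rfl, Or.inl rfl⟩
  · exact ⟨q.1.1, q.2.1.ne', Set.inter_comm _ _, Or.inr rfl⟩

theorem Mesh.exists_intMortar {s s' : M.Side} (hs : s.1 ≠ s'.1)
    (hpos : 0 < surf d (M.face s ∩ M.face s')) :
    ∃ q : M.IntMortar, q.1 = (s, s') ∨ q.1 = (s', s) := by
  rcases lt_or_gt_of_ne hs with h | h
  · exact ⟨⟨(s, s'), h, hpos⟩, Or.inl rfl⟩
  · exact ⟨⟨(s', s), h, by rwa [Set.inter_comm]⟩, Or.inr rfl⟩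

/-- Almost every point of a face lies on a mortar. -/
theorem Mesh.ae_exists_mortar (hΩo : IsOpen Ω) (s : M.Side) :
    ∀ᵐ x ∂surf d, x ∈ M.face s → ∃ e : M.Mortar Γ, s ∈ M.sides Γ e ∧ x ∈ M.carrier Γ e := by
  -- Intersections of zero measure are not mortars. There are finitely many of them, so their points
  -- can be discarded; the same applies to the boundary parts.
  have h1 : ∀ᵐ x ∂surf d, ∀ s' : M.Side, surf d (M.face s ∩ M.face s') = 0 →
      x ∉ M.face s ∩ M.face s' := by
    refine eventually_all.mpr fun s' => ?_
    by_cases h : surf d (M.face s ∩ M.face s') = 0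
    · filter_upwards [measure_eq_zero_iff_ae_notMem.mp h] with x hx _ using hx
    · exact Eventually.of_forall fun x h' => absurd h' h
  have h2 : ∀ᵐ x ∂surf d, ∀ t : BdType, surf d (M.face s ∩ Γ.part t) = 0 →
      x ∉ M.face s ∩ Γ.part t := by
    refine eventually_all.mpr fun t => ?_
    by_cases h : surf d (M.face s ∩ Γ.part t) = 0
    · filter_upwards [measure_eq_zero_iff_ae_notMem.mp h] with x hx _ using hx
    · exact Eventually.of_forall fun x h' => absurd h' h
  filter_upwards [M.ae_mem_relFace s, h1, h2] with x hx h1 h2 hxs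
  by_cases hxΩ : x ∈ Ω
  · obtain ⟨s', hne, hs'⟩ := M.exists_neighbour hΩo (hx hxs) hxΩ
    have hpos : 0 < surf d (M.face s ∩ M.face s') :=
      pos_iff_ne_zero.mpr fun h => h1 s' h ⟨hxs, hs'⟩
    obtain ⟨q, hq⟩ := M.exists_intMortar hne hpos
    refine ⟨.inl q, ?_, ?_⟩
    · rcases hq with hq | hq <;> simp [Mesh.sides, hq]
    · rcases hq with hq | hq <;> simp [Mesh.carrier, hq, hxs, hs']
  · have hfr : x ∈ frontier Ω := by
      rw [frontier, hΩo.interior_eq]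
      exact ⟨M.face_subset_closure s hxs, hxΩ⟩
    rw [← Γ.union, Set.mem_iUnion] at hfr
    obtain ⟨t, ht⟩ := hfr
    have hpos : 0 < surf d (M.face s ∩ Γ.part t) :=
      pos_iff_ne_zero.mpr fun h => h2 t h ⟨hxs, ht⟩
    exact ⟨.inr ⟨(s, t), hpos⟩, by simp [Mesh.sides], ⟨hxs, ht⟩⟩

theorem Mesh.part_subset_frontier (t : BdType) : Γ.part t ⊆ frontier Ω := by
  rw [← Γ.union]
  exact Set.subset_iUnion Γ.part t

/-- Distinct mortars on the same side overlap only in a null set. -/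
theorem Mesh.aeDisjoint_carrier (hΩo : IsOpen Ω) (hΩr : interior (closure Ω) = Ω) {s : M.Side}
    {e e' : M.Mortar Γ} (hs : s ∈ M.sides Γ e) (hs' : s ∈ M.sides Γ e') (hne : e ≠ e') :
    AEDisjoint (surf d) (M.carrier Γ e) (M.carrier Γ e') := by
  rw [AEDisjoint, measure_eq_zero_iff_ae_notMem]
  filter_upwards [eventually_all.mpr M.ae_mem_relFace] with x hrel hx
  obtain ⟨hxe, hxe'⟩ := hx
  have hxs := hrel s (M.carrier_subset_face Γ hs hxe)
  -- A point in the relative interior of faces of two elements is inside the domain, whereas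
  -- boundary mortars lie on its frontier.
  have hmixed : ∀ (q : M.IntMortar) (r : M.BdMortar Γ), s ∈ M.sides Γ (.inl q) →
      x ∈ M.carrier Γ (.inl q) → x ∈ M.carrier Γ (.inr r) → False := by
    intro q r hq hxq hxr
    obtain ⟨s1, h1, h2, -⟩ := M.other_side Γ hq
    rw [h2] at hxq
    exact M.not_mem_frontier hΩo hΩr hxs (hrel s1 hxq.2) h1
      (Mesh.part_subset_frontier Γ _ hxr.2)
  rcases e with q | q <;> rcases e' with q' | q'
  · obtain ⟨s1, h1, h2, h3⟩ := M.other_side Γ hs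
    obtain ⟨s2, h4, h5, h6⟩ := M.other_side Γ hs'
    rw [h2] at hxe
    rw [h5] at hxe'
    have hr1 := hrel s1 hxe.2
    have hr2 := hrel s2 hxe'.2
    by_cases h12 : s1 = s2
    · apply hne
      subst h12
      congr 1
      apply Subtype.ext
      have hlt := q.2.1
      have hlt' := q'.2.1
      rcases h3 with h3 | h3 <;> rcases h6 with h6 | h6 <;> rw [h3] at hlt <;>
        rw [h6] at hlt' <;> rw [h3, h6]
      · exact absurd hlt (lt_asymm hlt')
      · exact absurd hlt (lt_asymm hlt')
    -- Two faces of one simplex have disjoint relative interiors. Three faces of distinct elements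
    -- meeting at such a point would have pairwise opposite normals, which is impossible for unit
    -- vectors.
    · by_cases h12' : s1.1 = s2.1
      · obtain ⟨i, j1⟩ := s1
        obtain ⟨i', j2⟩ := s2
        simp only at h12'
        subst h12'
        have hj : j1 ≠ j2 := fun h => h12 (by rw [h])
        have := hr1.2 j2 hj.symm
        rw [hr2.1] at this
        exact lt_irrefl _ this
      · have e1 := M.normal_eq_neg hxs hr1 h1
        have e2 := M.normal_eq_neg hxs hr2 h4
        have e3 := M.normal_eq_neg hr1 hr2 h12'
        rw [e1, e2, neg_neg] at e3
        have h0 : M.normal s = 0 := by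
          have h00 : (2 : ℝ) • M.normal s = 0 := by
            rw [two_smul]
            nth_rewrite 1 [← e3]
            simp
          simpa using h00
        have := M.norm_normal s
        rw [h0, norm_zero] at this
        exact zero_ne_one this
  · exact hmixed q q' hs hxe hxe'
  · exact hmixed q' q hs' hxe' hxe
  · simp only [Mesh.sides, Finset.mem_singleton] at hs hs'
    obtain ⟨⟨s1, t1⟩, hq⟩ := q
    obtain ⟨⟨s2, t2⟩, hq'⟩ := q'
    simp only at hs hs'
    subst hs
    subst hs'
    have ht : t1 ≠ t2 := by
      rintro rfl
      exact hne rfl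
    exact Set.disjoint_left.mp (Γ.disjoint ht) hxe.2 hxe'.2

/-- The integral over a face is the sum of the integrals over its mortars. -/
theorem Mesh.integral_face (hΩo : IsOpen Ω) (hΩr : interior (closure Ω) = Ω) (s : M.Side)
    {g : Sp d → ℝ}
    (hg : ∀ e : M.Mortar Γ, s ∈ M.sides Γ e → IntegrableOn g (M.carrier Γ e) (surf d)) :
    ∫ x in M.face s, g x ∂(surf d)
      = open Classical in ∑ e : M.Mortar Γ with s ∈ M.sides Γ e,
        ∫ x in M.carrier Γ e, g x ∂(surf d) := by
  classical
  set E : Finset (M.Mortar Γ) := {e | s ∈ M.sides Γ e} with hE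
  have hmem : ∀ e : E, s ∈ M.sides Γ e := fun e => (Finset.mem_filter.mp e.2).2
  have hU : (M.face s : Set (Sp d)) =ᵐ[surf d] ⋃ e : E, M.carrier Γ e := by
    filter_upwards [M.ae_exists_mortar Γ hΩo s] with x hx
    apply propext
    refine ⟨fun h => ?_, fun h => ?_⟩
    · obtain ⟨e, he, hxe⟩ := hx h
      exact Set.mem_iUnion.mpr ⟨⟨e, by simpa [hE] using he⟩, hxe⟩
    · obtain ⟨e, hxe⟩ := Set.mem_iUnion.mp h
      exact M.carrier_subset_face Γ (hmem e) hxe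
  rw [setIntegral_congr_set hU, integral_iUnion_ae, tsum_fintype]
  · exact Finset.sum_coe_sort E fun e => ∫ x in M.carrier Γ e, g x ∂(surf d)
  · exact fun e => (M.measurableSet_carrier Γ e).nullMeasurableSet
  · exact fun e e' h => M.aeDisjoint_carrier Γ hΩo hΩr (hmem e) (hmem e')
      fun h' => h (Subtype.ext h')
  · rw [integrableOn_finite_iUnion]
    exact fun e => hg e (hmem e)

theorem Mesh.ae_face_of_ae_mortar (hΩo : IsOpen Ω) (s : M.Side) {P : Sp d → Prop}
    (h : ∀ e : M.Mortar Γ, s ∈ M.sides Γ e → ∀ᵐ x ∂(surf d).restrict (M.carrier Γ e), P x) :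
    ∀ᵐ x ∂(surf d).restrict (M.face s), P x := by
  rw [ae_restrict_iff' (M.measurableSet_face s)]
  have h' : ∀ᵐ x ∂surf d, ∀ e : M.Mortar Γ, s ∈ M.sides Γ e → x ∈ M.carrier Γ e → P x := by
    refine eventually_all.mpr fun e => ?_
    by_cases he : s ∈ M.sides Γ e
    · have := h e he
      rw [ae_restrict_iff' (M.measurableSet_carrier Γ e)] at this
      filter_upwards [this] with x hx _ using hx
    · exact Eventually.of_forall fun x hx => absurd hx he
  filter_upwards [M.ae_exists_mortar Γ hΩo s, h'] with x h1 h2 hx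
  obtain ⟨e, he, hxe⟩ := h1 hx
  exact h2 e he hxe

/-- Positive measure guarantees a point of the mortar in the relative interior of both faces, and
one such point determines the relation between the normals. -/
theorem Mesh.normal_intMortar (q : M.IntMortar) : M.normal q.1.2 = - M.normal q.1.1 := by
  have hpos := q.2.2
  by_contra hne
  apply hpos.ne'
  rw [measure_eq_zero_iff_ae_notMem]
  filter_upwards [eventually_all.mpr M.ae_mem_relFace] with x hrel hx
  exact hne (M.normal_eq_neg (hrel _ hx.1) (hrel _ hx.2) q.2.1.ne)

/-- The frontier is covered by finitely many faces, so a part of positive measure meets at least one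
of them in positive measure. -/
theorem Mesh.exists_bdMortar (hΩo : IsOpen Ω) (hΩr : interior (closure Ω) = Ω) {t : BdType}
    (ht : 0 < surf d (Γ.part t)) : ∃ q : M.BdMortar Γ, q.1.2 = t := by
  by_contra hcon
  push Not at hcon
  have hnull : ∀ s : M.Side, surf d (M.face s ∩ Γ.part t) = 0 := fun s => by
    by_contra hne
    exact hcon ⟨(s, t), pos_iff_ne_zero.mpr hne⟩ rfl
  apply ht.ne'
  refine measure_mono_null (t := ⋃ s : M.Side, M.face s ∩ Γ.part t) ?_ (measure_iUnion_null hnull)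
  intro x hx
  have hfr := Mesh.part_subset_frontier Γ t hx
  rw [frontier, hΩo.interior_eq] at hfr
  obtain ⟨hcl, hnΩ⟩ := hfr
  rw [← M.cover, Set.mem_iUnion] at hcl
  obtain ⟨i, hi⟩ := hcl
  obtain ⟨j, hj⟩ := M.exists_face_of_not_mem_K hi fun h => hnΩ (M.K_subset hΩr i h)
  exact Set.mem_iUnion.mpr ⟨(i, j), hj, hx⟩

/-- Almost every point of the domain lies in an open element. -/
theorem Mesh.ae_exists_K (hΩo : IsOpen Ω) : ∀ᵐ x ∂volume.restrict Ω, ∃ i, x ∈ M.K i := by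
  have h0 : ∀ (i : Fin M.N) (j : Fin (d + 1)), volume {x | lam (M.elem i) j x = 0} = 0 := by
    intro i j
    refine PolyOnLines.measure_zeros volume ?_ (continuous_lam (M.elem i) j)
      (x₀ := (M.elem i).points j) ?_
    · intro x v
      refine ⟨Polynomial.C (lam (M.elem i) j x)
        + Polynomial.C ((lam (M.elem i) j).linear v) * Polynomial.X, fun t => ?_⟩
      rw [add_comm x, ← vadd_eq_add, AffineMap.map_vadd, map_smul]
      simp only [Polynomial.eval_add, Polynomial.eval_mul, Polynomial.eval_C, Polynomial.eval_X,
        vadd_eq_add, smul_eq_mul]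
      ring
    · rw [lam_points, if_pos rfl]
      exact one_ne_zero
  have h1 : ∀ᵐ x : Sp d, ∀ (i : Fin M.N) (j : Fin (d + 1)), lam (M.elem i) j x ≠ 0 :=
    eventually_all.mpr fun i => eventually_all.mpr fun j => measure_eq_zero_iff_ae_notMem.mp (h0 i j)
  have h2 : ∀ᵐ x : Sp d, x ∈ Ω → ∃ i, x ∈ M.K i := by
    filter_upwards [h1] with x hx hxΩ
    have h3 := subset_closure hxΩ
    rw [← M.cover, Set.mem_iUnion] at h3
    obtain ⟨i, hi⟩ := h3
    refine ⟨i, (mem_interior_iff _ x).mpr fun j => ?_⟩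
    exact lt_of_le_of_ne ((mem_closedInterior_iff _ x).mp hi j) (hx i j).symm
  exact (ae_restrict_iff' hΩo.measurableSet).mpr h2

end MeshGeometry

/-! ### Connectivity of the mesh through interior mortars -/

section Connectivity

variable {d : ℕ}

/-- A set that meets every line parallel to `n` near a given one is not a null set for the surface
measure. -/
theorem surf_pos_of_crossing [NeZero d] {n : Sp d} (hn : ‖n‖ = 1) (p : Sp d) {δ : ℝ} (hδ : 0 < δ)
    {A : Set (Sp d)}
    (hA : ∀ y : Hp n, ‖y‖ < δ → ∃ t : ℝ, p + (y : Sp d) + t • n ∈ A) : 0 < surf d A := by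
  rw [pos_iff_ne_zero]
  intro h0
  -- Projection along `n` is 1-Lipschitz and cannot increase Hausdorff measure, so the image of a
  -- null set is null; but the image of `A` contains a ball of the hyperplane.
  set f : Sp d → Hp n := fun x => (Hp n).orthogonalProjectionOnto (x - p) with hf
  have hlip : LipschitzWith 1 f := by
    have h1 : LipschitzWith 1 fun x : Sp d => x - p := (IsometryEquiv.subRight p).isometry.lipschitz
    have h2 : LipschitzWith 1 ((Hp n).orthogonalProjectionOnto : Sp d →L[ℝ] Hp n) :=
      (Hp n).orthogonalProjectionOnto.lipschitz.weaken
        (by exact_mod_cast (Hp n).orthogonalProjectionOnto_norm_le)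
    have h3 := h2.comp h1
    rw [mul_one] at h3
    exact h3
  have h1 : Measure.hausdorffMeasure ((d - 1 : ℕ) : ℝ) A = 0 := by
    rw [surf, Measure.euclideanHausdorffMeasure_def, Measure.smul_apply] at h0
    simpa [Measure.addHaarScalarFactor_volume_hausdorffMeasure_ne_zero] using h0
  have h2 : Measure.hausdorffMeasure ((d - 1 : ℕ) : ℝ) (f '' A) = 0 := by
    have := hlip.hausdorffMeasure_image_le (d := ((d - 1 : ℕ) : ℝ)) (by positivity) A
    rw [h1] at this
    simpa using this
  have h3 : volume (f '' A) = 0 := by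
    rw [← InnerProductSpace.euclideanHausdorffMeasure_eq_volume, finrank_Hp hn,
      Measure.euclideanHausdorffMeasure_def, Measure.smul_apply, h2, smul_zero]
  have h4 : Metric.ball (0 : Hp n) δ ⊆ f '' A := by
    intro y hy
    rw [mem_ball_zero_iff] at hy
    obtain ⟨t, ht⟩ := hA y hy
    refine ⟨_, ht, ?_⟩
    have h5 : p + (y : Sp d) + t • n - p = (y : Sp d) + t • n := by abel
    have h6 : (Hp n).orthogonalProjectionOnto n = 0 := by
      rw [Submodule.orthogonalProjectionOnto_eq_zero_iff, Submodule.orthogonal_orthogonal]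
      exact Submodule.mem_span_singleton_self n
    simp only [hf]
    rw [h5, map_add, map_smul, h6, smul_zero, add_zero]
    exact Submodule.orthogonalProjectionOnto_mem_subspace_eq_self y
  exact (Metric.measure_ball_pos volume (0 : Hp n) hδ).ne' (measure_mono_null h4 h3)

variable [NeZero d] {Ω : Set (Sp d)} (M : Mesh d Ω)

/-- A quantity attached to the elements that does not change across interior mortars is constant. -/
theorem Mesh.eq_of_eq_across_mortars (hΩo : IsOpen Ω) (hΩc : IsConnected Ω)
    (hΩr : interior (closure Ω) = Ω) {X : Type*} (c : Fin M.N → X)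
    (hc : ∀ q : M.IntMortar, c q.1.1.1 = c q.1.2.1) (i i' : Fin M.N) : c i = c i' := by
  by_contra hne
  set U : Set (Sp d) := ⋃ k : {k // c k = c i}, (M.elem k).closedInterior with hU
  set V : Set (Sp d) := ⋃ k : {k // c k ≠ c i}, (M.elem k).closedInterior with hV
  have hUc : IsClosed U := isClosed_iUnion_of_finite fun k => (M.elem k).isClosed_closedInterior
  have hVc : IsClosed V := isClosed_iUnion_of_finite fun k => (M.elem k).isClosed_closedInterior
  have hcov : Ω ⊆ U ∪ V := by
    intro x hx
    have h := subset_closure hx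
    rw [← M.cover, Set.mem_iUnion] at h
    obtain ⟨k, hk⟩ := h
    by_cases hck : c k = c i
    · exact Or.inl (Set.mem_iUnion.mpr ⟨⟨k, hck⟩, hk⟩)
    · exact Or.inr (Set.mem_iUnion.mpr ⟨⟨k, hck⟩, hk⟩)
  have hKU : ∀ k, c k = c i → M.K k ⊆ U := fun k hk x hx =>
    Set.mem_iUnion.mpr ⟨⟨k, hk⟩, (M.elem k).interior_subset_closedInterior hx⟩
  have hKV : ∀ k, c k ≠ c i → M.K k ⊆ V := fun k hk x hx =>
    Set.mem_iUnion.mpr ⟨⟨k, hk⟩, (M.elem k).interior_subset_closedInterior hx⟩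
  -- A common point of elements from the two groups lies on a face of each. Such an intersection of
  -- positive measure would be a mortar across which the quantity changes.
  have hnull : surf d (U ∩ V) = 0 := by
    refine measure_mono_null (t := ⋃ r : {r : M.Side × M.Side // c r.1.1 = c i ∧ c r.2.1 ≠ c i},
      M.face r.1.1 ∩ M.face r.1.2) ?_ (measure_iUnion_null fun r => ?_)
    · rintro x ⟨hxU, hxV⟩
      obtain ⟨⟨k, hk⟩, hxk⟩ := Set.mem_iUnion.mp hxU
      obtain ⟨⟨l, hl⟩, hxl⟩ := Set.mem_iUnion.mp hxV
      have hkl : k ≠ l := by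
        rintro rfl
        exact hl hk
      obtain ⟨j, hj⟩ := M.exists_face_of_mem_two hkl hxk hxl
      obtain ⟨j', hj'⟩ := M.exists_face_of_mem_two hkl.symm hxl hxk
      exact Set.mem_iUnion.mpr ⟨⟨((k, j'), (l, j)), hk, hl⟩, hj', hj⟩
    · obtain ⟨⟨s, s'⟩, h1, h2⟩ := r
      simp only at h1 h2
      by_contra hpos
      have hss : s.1 ≠ s'.1 := by
        intro h
        rw [h] at h1
        exact h2 h1
      obtain ⟨q, hq⟩ := M.exists_intMortar hss (pos_iff_ne_zero.mpr hpos)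
      have := hc q
      rcases hq with hq | hq <;> rw [hq] at this
      · exact h2 (this ▸ h1)
      · exact h2 (this.trans h1)
  obtain ⟨a, ha⟩ := nonempty_interior (M.elem i)
  obtain ⟨b, hb⟩ := nonempty_interior (M.elem i')
  -- Connectedness forces the two closed groups to meet at a point `x` of the domain. Arbitrarily
  -- close to `x` there are interior points `p`, `p'` of elements from either group.
  obtain ⟨x, hxΩ, hxU, hxV⟩ := isPreconnected_closed_iff.mp hΩc.isPreconnected U V hUc hVc hcov
    ⟨a, M.K_subset hΩr i ha, hKU i rfl ha⟩ ⟨b, M.K_subset hΩr i' hb, hKV i' (Ne.symm hne) hb⟩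
  obtain ⟨r, hr, hball⟩ := Metric.isOpen_iff.mp hΩo x hxΩ
  obtain ⟨⟨k, hk⟩, hxk⟩ := Set.mem_iUnion.mp hxU
  obtain ⟨⟨l, hl⟩, hxl⟩ := Set.mem_iUnion.mp hxV
  obtain ⟨p, hpB, hpk⟩ := mem_closure_iff.mp (closedInterior_subset_closure _ hxk) _
    Metric.isOpen_ball (Metric.mem_ball_self hr)
  obtain ⟨p', hpB', hpl⟩ := mem_closure_iff.mp (closedInterior_subset_closure _ hxl) _
    Metric.isOpen_ball (Metric.mem_ball_self hr)
  obtain ⟨δ, hδ, hδs⟩ := Metric.isOpen_iff.mp (Metric.isOpen_ball.inter (M.isOpen_K k)) p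
    ⟨hpB, hpk⟩
  obtain ⟨δ', hδ', hδs'⟩ := Metric.isOpen_iff.mp (Metric.isOpen_ball.inter (M.isOpen_K l)) p'
    ⟨hpB', hpl⟩
  have hpp : p' - p ≠ 0 := by
    intro h
    have hkl : k ≠ l := by
      rintro rfl
      exact hl hk
    have h' : p' = p := sub_eq_zero.mp h
    rw [h'] at hpl
    exact Set.disjoint_left.mp (M.disjoint hkl) hpk hpl
  have hnorm : ‖p' - p‖ ≠ 0 := norm_ne_zero_iff.mpr hpp
  set n : Sp d := ‖p' - p‖⁻¹ • (p' - p) with hn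
  have hn1 : ‖n‖ = 1 := by
    rw [hn, norm_smul, norm_inv, norm_norm, inv_mul_cancel₀ hnorm]
  -- Each small translate of the segment from `p` to `p'` starts in `U`, ends in `V` and stays in a
  -- ball inside the domain, so it crosses `U ∩ V`. Crossings on all these parallel lines cannot
  -- form a null set.
  refine (surf_pos_of_crossing hn1 p (lt_min hδ hδ') fun y hy => ?_).ne' hnull
  have hq : p + (y : Sp d) ∈ Metric.ball x r ∩ M.K k := hδs (by
    rw [mem_ball_iff_norm, add_sub_cancel_left]
    exact hy.trans_le (min_le_left _ _))
  have hq' : p' + (y : Sp d) ∈ Metric.ball x r ∩ M.K l := hδs' (by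
    rw [mem_ball_iff_norm, add_sub_cancel_left]
    exact hy.trans_le (min_le_right _ _))
  have hseg : segment ℝ (p + (y : Sp d)) (p' + (y : Sp d)) ⊆ U ∪ V :=
    ((convex_ball x r).segment_subset hq.1 hq'.1).trans (hball.trans hcov)
  obtain ⟨z, hz, hzUV⟩ := isPreconnected_closed_iff.mp
    (convex_segment (𝕜 := ℝ) (p + (y : Sp d)) (p' + (y : Sp d))).isPreconnected U V hUc hVc hseg
    ⟨_, left_mem_segment ℝ _ _, hKU k hk hq.2⟩ ⟨_, right_mem_segment ℝ _ _, hKV l hl hq'.2⟩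
  rw [segment_eq_image'] at hz
  obtain ⟨t, -, rfl⟩ := hz
  refine ⟨t * ‖p' - p‖, ?_⟩
  have h7 : (t * ‖p' - p‖) • n = t • (p' - p) := by
    rw [hn, smul_smul, mul_assoc, mul_inv_cancel₀ hnorm, mul_one]
  rw [h7]
  simpa using hzUV

end Connectivity

/-! ### Polynomial functions -/

section Polynomials

variable {d : ℕ}

theorem pval_add (q r : MvPolynomial (Fin d) ℝ) (x : Sp d) :
    pval (q + r) x = pval q x + pval r x := map_add _ _ _

theorem pval_mul (q r : MvPolynomial (Fin d) ℝ) (x : Sp d) :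
    pval (q * r) x = pval q x * pval r x := map_mul _ _ _

theorem pval_smul (c : ℝ) (q : MvPolynomial (Fin d) ℝ) (x : Sp d) :
    pval (c • q) x = c * pval q x := by simp [pval]

theorem pval_zero (x : Sp d) : pval (0 : MvPolynomial (Fin d) ℝ) x = 0 := map_zero _

theorem pval_sum {ι : Type*} (s : Finset ι) (q : ι → MvPolynomial (Fin d) ℝ) (x : Sp d) :
    pval (∑ i ∈ s, q i) x = ∑ i ∈ s, pval (q i) x := map_sum _ _ _

theorem contDiff_pval (q : MvPolynomial (Fin d) ℝ) : ContDiff ℝ ∞ (pval q) := by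
  induction q using MvPolynomial.induction_on with
  | C c =>
    have : pval (MvPolynomial.C c : MvPolynomial (Fin d) ℝ) = fun _ => c := by
      ext x; simp [pval]
    rw [this]; exact contDiff_const
  | add q r hq hr =>
    have : pval (q + r) = fun x => pval q x + pval r x := by ext x; exact pval_add q r x
    rw [this]; exact hq.add hr
  | mul_X q i hq =>
    have : pval (q * MvPolynomial.X i) = fun x => pval q x * x i := by ext x; simp [pval]
    rw [this]; exact hq.mul (by fun_prop)

theorem continuous_pval (q : MvPolynomial (Fin d) ℝ) : Continuous (pval q) :=
  (contDiff_pval q).continuous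

theorem fderiv_pval (q : MvPolynomial (Fin d) ℝ) (x : Sp d) (k : Fin d) :
    fderiv ℝ (pval q) x (EuclideanSpace.single k 1) = pval (MvPolynomial.pderiv k q) x := by
  have hd : ∀ q : MvPolynomial (Fin d) ℝ, DifferentiableAt ℝ (pval q) x := fun q =>
    (contDiff_pval q).differentiable (by simp) x
  induction q using MvPolynomial.induction_on with
  | C c =>
    have : pval (MvPolynomial.C c : MvPolynomial (Fin d) ℝ) = fun _ => c := by
      ext x; simp [pval]
    rw [this]; simp [pval]
  | add q r hq hr =>
    have : pval (q + r) = fun x => pval q x + pval r x := by ext x; exact pval_add q r x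
    rw [this, fderiv_fun_add (hd q) (hd r), add_apply, hq, hr, map_add, pval_add]
  | mul_X q i hq =>
    have h1 : pval (q * MvPolynomial.X i) = fun x => pval q x * x i := by ext x; simp [pval]
    have h2 : HasFDerivAt (fun x : Sp d => x i) (EuclideanSpace.proj i : Sp d →L[ℝ] ℝ) x :=
      (EuclideanSpace.proj i : Sp d →L[ℝ] ℝ).hasFDerivAt
    rw [h1, fderiv_fun_mul (hd q) h2.differentiableAt, h2.fderiv, Derivation.leibniz, pval_add]
    simp only [add_apply, smul_apply, hq, smul_eq_mul, pval_mul, MvPolynomial.pderiv_X]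
    by_cases hik : i = k
    · subst hik; simp [pval]
    · simp [pval, hik]

theorem pval_polyOnLines (q : MvPolynomial (Fin d) ℝ) : PolyOnLines (pval q) := by
  intro x v
  refine ⟨MvPolynomial.aeval (fun k => Polynomial.C (x k) + Polynomial.C (v k) * Polynomial.X) q,
    fun t => ?_⟩
  induction q using MvPolynomial.induction_on with
  | C c => simp [pval]
  | add q r hq hr => rw [pval_add, hq, hr, map_add, Polynomial.eval_add]
  | mul_X q i hq =>
    rw [pval_mul, hq, map_mul, Polynomial.eval_mul]
    congr 1
    rw [MvPolynomial.aeval_X]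
    simp only [pval, MvPolynomial.eval_X, Polynomial.eval_add, Polynomial.eval_mul,
      Polynomial.eval_C, Polynomial.eval_X, PiLp.add_apply, PiLp.smul_apply, smul_eq_mul]
    ring

theorem PolyOnLines.flat {f : Sp d → ℝ} (hf : PolyOnLines f) (n x₀ : Sp d) :
    PolyOnLines fun y : Hp n => f (x₀ + (y : Sp d)) := by
  intro x v
  obtain ⟨P, hP⟩ := hf (x₀ + (x : Sp d)) (v : Sp d)
  refine ⟨P, fun t => ?_⟩
  beta_reduce
  rw [← hP t, Submodule.coe_add, Submodule.coe_smul, add_assoc]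

/-- A polynomial that vanishes almost everywhere on a nonempty open set is zero. -/
theorem eq_zero_of_pval_ae {q : MvPolynomial (Fin d) ℝ} {U : Set (Sp d)} (hU : IsOpen U)
    (hne : U.Nonempty) (h : ∀ᵐ x ∂volume.restrict U, pval q x = 0) : q = 0 := by
  have hz : ∀ x, pval q x = 0 := by
    by_contra hcon
    push Not at hcon
    obtain ⟨x₀, h0⟩ := hcon
    have h1 := (pval_polyOnLines q).measure_zeros volume (continuous_pval q) h0
    rw [ae_restrict_iff' hU.measurableSet] at h
    have h2 := measure_eq_zero_iff_ae_notMem.mp h1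
    have h3 : ∀ᵐ x : Sp d, x ∉ U := by
      filter_upwards [h, h2] with x hx hx' hxU using hx' (hx hxU)
    exact (hU.measure_pos volume hne).ne' (measure_eq_zero_iff_ae_notMem.mpr h3)
  apply MvPolynomial.funext
  intro y
  have := hz (WithLp.toLp 2 y)
  simpa [pval] using this

/-- The restriction of a polynomial to a subset of positive measure of a hyperplane vanishes if it
vanishes almost everywhere. -/
theorem polyOn_eq_zero {n : Sp d} (hn : ‖n‖ = 1) (x₀ : Sp d) {s : Set (Sp d)}
    (hs : s ⊆ {x | inner ℝ n (x - x₀) = 0}) (hm : MeasurableSet s) (hpos : 0 < surf d s) {k : ℕ}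
    (w : polyOn s k) (h : ∀ᵐ x ∂(surf d).restrict s, (w : Sp d → ℝ) x = 0) : w = 0 := by
  obtain ⟨w, hw⟩ := w
  obtain ⟨q, hq, rfl⟩ := hw
  have hz : ∀ y : Hp n, pval q (x₀ + (y : Sp d)) = 0 := by
    by_contra hcon
    push Not at hcon
    obtain ⟨y₀, h0⟩ := hcon
    have h1 := ((pval_polyOnLines q).flat n x₀).measure_zeros volume
      ((continuous_pval q).comp (by fun_prop)) h0
    have h2 : surf d (s ∩ {x | pval q x = 0}) = 0 := by
      refine surf_null_of_flat_null hn x₀ (Set.inter_subset_left.trans hs) ?_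
      exact measure_mono_null (fun y (hy : _ ∧ _) => hy.2) h1
    rw [ae_restrict_iff' hm] at h
    have h3 : ∀ᵐ x ∂surf d, x ∉ s := by
      filter_upwards [h, measure_eq_zero_iff_ae_notMem.mp h2] with x hx hx' hxs
      refine hx' ⟨hxs, ?_⟩
      have := hx hxs
      simpa [restrictPoly, hxs] using this
    exact hpos.ne' (measure_eq_zero_iff_ae_notMem.mpr h3)
  apply Subtype.ext
  funext x
  by_cases hx : x ∈ s
  · have h1 := hs hx
    rw [← range_flat] at h1
    obtain ⟨y, rfl⟩ := h1
    simpa [restrictPoly, hx] using hz y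
  · simp [restrictPoly, hx]

theorem polyOn_exists {s : Set (Sp d)} {k : ℕ} (w : polyOn s k) :
    ∃ q : MvPolynomial (Fin d) ℝ, (w : Sp d → ℝ) = s.indicator (pval q) := by
  obtain ⟨w, hw⟩ := w
  obtain ⟨q, -, rfl⟩ := hw
  exact ⟨q, rfl⟩

/-- Used to see that `∑_k B_k ∂_k u` belongs to the same broken polynomial space and may serve as a
test function. -/
theorem pderiv_mem_restrictTotalDegree {m : ℕ} {q : MvPolynomial (Fin d) ℝ}
    (hq : q ∈ MvPolynomial.restrictTotalDegree (Fin d) ℝ m) (k : Fin d) :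
    MvPolynomial.pderiv k q ∈ MvPolynomial.restrictTotalDegree (Fin d) ℝ m := by
  rw [MvPolynomial.mem_restrictTotalDegree] at hq ⊢
  refine le_trans (Finset.sup_le fun s hs => ?_) hq
  rw [MvPolynomial.mem_support_iff, MvPolynomial.coeff_pderiv] at hs
  have h1 : s + Finsupp.single k 1 ∈ q.support := by
    rw [MvPolynomial.mem_support_iff]
    exact fun h => hs (by rw [h]; simp)
  have h2 := MvPolynomial.le_totalDegree h1
  have h3 : ((s + Finsupp.single k 1).sum fun _ e => e) = (s.sum fun _ e => e) + 1 := by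
    rw [Finsupp.sum_add_index' (by simp) (by simp)]
    simp
  omega

/-- A polynomial function with vanishing partial derivatives is constant. -/
theorem pval_const {q : MvPolynomial (Fin d) ℝ}
    (h : ∀ k x, pval (MvPolynomial.pderiv k q) x = 0) (x y : Sp d) : pval q x = pval q y := by
  refine is_const_of_fderiv_eq_zero ((contDiff_pval q).differentiable (by simp)) (fun z => ?_) x y
  apply ContinuousLinearMap.coe_injective
  refine (EuclideanSpace.basisFun (Fin d) ℝ).toBasis.ext fun k => ?_
  simp [fderiv_pval, h]

end Polynomials

/-- Members of independent families of ranges that sum to zero vanish. -/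
theorem RangesIndependent.eq_zero {d a b : ℕ} {B : Fin d → Matrix (Fin a) (Fin b) ℝ}
    (hB : RangesIndependent B) (w : Fin d → Fin b → ℝ) (h : ∑ k, B k *ᵥ w k = 0) (k : Fin d) :
    B k *ᵥ w k = 0 := by
  unfold RangesIndependent at hB
  rw [iSupIndep_iff_finsetSum_eq_zero_imp_eq_zero] at hB
  exact hB Finset.univ (fun k => B k *ᵥ w k) (fun k _ => ⟨w k, by simp⟩) h k (Finset.mem_univ k)

/-! ### Essentially bounded vector and matrix functions -/

section VectorBounded

variable {α : Type*} [MeasurableSpace α] {ν : Measure α} {ι κ : Type*}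

/-- All components are essentially bounded. -/
def VBdd (ν : Measure α) (f : α → ι → ℝ) : Prop := ∀ j, MemLp (fun x => f x j) ⊤ ν

/-- All entries are essentially bounded. -/
def MBdd (ν : Measure α) (f : α → Matrix ι κ ℝ) : Prop := ∀ i j, MemLp (fun x => f x i j) ⊤ ν

theorem VBdd.add {f g : α → ι → ℝ} (hf : VBdd ν f) (hg : VBdd ν g) :
    VBdd ν fun x => f x + g x := fun j => (hf j).add (hg j)

theorem VBdd.sub {f g : α → ι → ℝ} (hf : VBdd ν f) (hg : VBdd ν g) :
    VBdd ν fun x => f x - g x := fun j => (hf j).sub (hg j)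

theorem VBdd.sum {τ : Type*} (s : Finset τ) {f : τ → α → ι → ℝ} (hf : ∀ t ∈ s, VBdd ν (f t)) :
    VBdd ν fun x => ∑ t ∈ s, f t x := fun j => by
  simp only [Finset.sum_apply]
  exact memLp_finsetSum s fun t ht => hf t ht j

theorem VBdd.dot [Fintype ι] {f g : α → ι → ℝ} (hf : VBdd ν f) (hg : VBdd ν g) :
    MemLp (fun x => f x ⬝ᵥ g x) ⊤ ν :=
  memLp_finsetSum _ fun j _ => memLp_top_mul (hf j) (hg j)

theorem VBdd.integrable_dot [Fintype ι] [IsFiniteMeasure ν] {f g : α → ι → ℝ} (hf : VBdd ν f)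
    (hg : VBdd ν g) : Integrable (fun x => f x ⬝ᵥ g x) ν :=
  (hf.dot hg).integrable le_top

theorem MBdd.mulVec [Fintype κ] {A : α → Matrix ι κ ℝ} {f : α → κ → ℝ} (hA : MBdd ν A)
    (hf : VBdd ν f) : VBdd ν fun x => A x *ᵥ f x := fun i =>
  memLp_finsetSum _ fun j _ => memLp_top_mul (hA i j) (hf j)

theorem MBdd.add {A B : α → Matrix ι κ ℝ} (hA : MBdd ν A) (hB : MBdd ν B) :
    MBdd ν fun x => A x + B x := fun i j => (hA i j).add (hB i j)

theorem MBdd.const_smul {A : α → Matrix ι κ ℝ} (hA : MBdd ν A) (c : ℝ) :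
    MBdd ν fun x => c • A x := fun i j => (hA i j).const_mul c

theorem MBdd.smul {A : α → Matrix ι κ ℝ} (hA : MBdd ν A) {f : α → ℝ} (hf : MemLp f ⊤ ν) :
    MBdd ν fun x => f x • A x := fun i j => memLp_top_mul hf (hA i j)

theorem MBdd.transpose {A : α → Matrix ι κ ℝ} (hA : MBdd ν A) : MBdd ν fun x => (A x)ᵀ :=
  fun i j => hA j i

theorem MBdd.mono_measure {ν' : Measure α} {A : α → Matrix ι κ ℝ} (hA : MBdd ν A) (h : ν' ≤ ν) :
    MBdd ν' A := fun i j => (hA i j).mono_measure h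

theorem MBdd.const [IsFiniteMeasure ν] (A : Matrix ι κ ℝ) : MBdd ν fun _ => A :=
  fun i j => memLp_const (A i j)

theorem MBdd.blocks {a b : ℕ} {A : α → BlockMat a b} (hA : MBdd ν A) :
    MBdd ν (fun x => (A x).toBlocks₁₁) ∧ MBdd ν (fun x => (A x).toBlocks₁₂) ∧
    MBdd ν (fun x => (A x).toBlocks₂₁) ∧ MBdd ν (fun x => (A x).toBlocks₂₂) :=
  ⟨fun i j => hA (.inl i) (.inl j), fun i j => hA (.inl i) (.inr j),
    fun i j => hA (.inr i) (.inl j), fun i j => hA (.inr i) (.inr j)⟩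

end VectorBounded

/-! ### Gauss-Green formula for matrix fields and polynomials -/

section GaussGreenMatrix

variable {d : ℕ} [NeZero d] (S : Affine.Simplex ℝ (Sp d) d)

theorem dot_mulVec_eq_sum {ι κ : Type*} [Fintype ι] [Fintype κ] (A : Matrix ι κ ℝ) (v : κ → ℝ)
    (w : ι → ℝ) : (A *ᵥ v) ⬝ᵥ w = ∑ i, ∑ j, A i j * (w i * v j) := by
  simp only [dotProduct, Matrix.mulVec, Finset.sum_mul]
  exact Finset.sum_congr rfl fun i _ => Finset.sum_congr rfl fun j _ => by ring

/-- The scalar formula is applied entry by entry with the product `w i * z j` as test function; the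
product rule yields the two derivative terms. -/
theorem gauss_green_matrix {ι κ : Type*} [Fintype ι] [Fintype κ]
    {A : Fin d → Sp d → Matrix ι κ ℝ} {D : Sp d → Matrix ι κ ℝ}
    (hA : ∀ k, MBdd (volume.restrict S.interior) (A k))
    (hD : MBdd (volume.restrict S.interior) D)
    (hdiv : ∀ φ : Sp d → ℝ, ContDiff ℝ ∞ φ → HasCompactSupport φ → tsupport φ ⊆ S.interior →
      ∀ i j, ∑ k, ∫ x in S.interior, A k x i j * fderiv ℝ φ x (EuclideanSpace.single k 1)
        = - ∫ x in S.interior, D x i j * φ x)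
    (hc : ∀ f, ∀ᵐ x ∂(surf d).restrict (S.faceOpposite f).closedInterior,
      Tendsto (fun y => ∑ k, outNormal S f k • A k y) (𝓝[S.interior] x)
        (𝓝 (∑ k, outNormal S f k • A k x)))
    (hF : ∀ f, MBdd ((surf d).restrict (S.faceOpposite f).closedInterior)
      fun x => ∑ k, outNormal S f k • A k x)
    (w : ι → MvPolynomial (Fin d) ℝ) (z : κ → MvPolynomial (Fin d) ℝ) :
    (∑ k, ∫ x in S.interior,
        ((A k x *ᵥ fun j => pval (z j) x) ⬝ᵥ (fun i => pval (MvPolynomial.pderiv k (w i)) x)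
        + (A k x *ᵥ fun j => pval (MvPolynomial.pderiv k (z j)) x) ⬝ᵥ fun i => pval (w i) x))
      + (∫ x in S.interior, (D x *ᵥ fun j => pval (z j) x) ⬝ᵥ fun i => pval (w i) x)
    = ∑ f, ∫ x in (S.faceOpposite f).closedInterior,
        ((∑ k, outNormal S f k • A k x) *ᵥ fun j => pval (z j) x) ⬝ᵥ (fun i => pval (w i) x)
          ∂(surf d) := by
  have := isFiniteMeasure_interior S
  have hKo := isOpen_interior S
  have hKb := isBounded_interior S
  have hface : ∀ f, IsFiniteMeasure ((surf d).restrict (S.faceOpposite f).closedInterior) :=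
    fun f => ⟨by
      rw [Measure.restrict_apply_univ]
      exact surf_lt_top_of_bounded (norm_outNormal S f) _ (face_subset_hyperplane S f)
        (S.faceOpposite f).isCompact_closedInterior.isBounded⟩
  have hcb : ∀ {g : Sp d → ℝ}, Continuous g → MemLp g ⊤ (volume.restrict S.interior) := fun hg =>
    memLp_top_of_continuous hg hKb hKo.measurableSet
  have hcf : ∀ f, ∀ {g : Sp d → ℝ}, Continuous g →
      MemLp g ⊤ ((surf d).restrict (S.faceOpposite f).closedInterior) := fun f g hg =>
    memLp_top_of_continuous hg (S.faceOpposite f).isCompact_closedInterior.isBounded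
      (isClosed_face S f).measurableSet
  have happ : ∀ f x i j, (∑ k, outNormal S f k • A k x) i j = ∑ k, outNormal S f k * A k x i j := by
    intro f x i j
    simp [Matrix.sum_apply]
  have hcwz : ∀ i j, Continuous fun x => pval (w i) x * pval (z j) x := fun i j =>
    (continuous_pval _).mul (continuous_pval _)
  have hs : ∀ i j,
      (∑ k, ∫ x in S.interior, A k x i j * (pval (MvPolynomial.pderiv k (w i)) x * pval (z j) x
        + pval (w i) x * pval (MvPolynomial.pderiv k (z j)) x))
      + (∫ x in S.interior, D x i j * (pval (w i) x * pval (z j) x))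
      = ∑ f, ∫ x in (S.faceOpposite f).closedInterior,
        (∑ k, outNormal S f k • A k x) i j * (pval (w i) x * pval (z j) x) ∂(surf d) := by
    intro i j
    have h := gauss_green S (fun k => hA k i j) (hD i j)
      (fun φ h1 h2 h3 => hdiv φ h1 h2 h3 i j) (fun f => by
        filter_upwards [hc f] with x hx
        have h1 := (tendsto_pi_nhds.mp (tendsto_pi_nhds.mp hx i)) j
        simpa only [happ] using h1) (contDiff_pval (w i * z j))
    simp only [fderiv_pval, Derivation.leibniz, pval_add, smul_eq_mul, pval_mul] at h
    simp only [happ]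
    rw [← h]
    congr 1
    refine Finset.sum_congr rfl fun k _ => integral_congr_ae (Eventually.of_forall fun x => ?_)
    simp only
    ring
  have hL1 : ∀ k, (∫ x in S.interior,
        ((A k x *ᵥ fun j => pval (z j) x) ⬝ᵥ (fun i => pval (MvPolynomial.pderiv k (w i)) x)
        + (A k x *ᵥ fun j => pval (MvPolynomial.pderiv k (z j)) x) ⬝ᵥ fun i => pval (w i) x))
      = ∑ i, ∑ j, ∫ x in S.interior, A k x i j * (pval (MvPolynomial.pderiv k (w i)) x * pval (z j) x
        + pval (w i) x * pval (MvPolynomial.pderiv k (z j)) x) := by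
    intro k
    have hi : ∀ i j, Integrable (fun x => A k x i j * (pval (MvPolynomial.pderiv k (w i)) x *
        pval (z j) x + pval (w i) x * pval (MvPolynomial.pderiv k (z j)) x))
        (volume.restrict S.interior) := fun i j =>
      (memLp_top_mul (hA k i j) (hcb (((continuous_pval _).mul (continuous_pval _)).add
        ((continuous_pval _).mul (continuous_pval _))))).integrable le_top
    simp_rw [← integral_finsetSum Finset.univ fun j _ => hi _ j]
    rw [← integral_finsetSum Finset.univ fun i _ => integrable_finsetSum _ fun j _ => hi i j]
    refine integral_congr_ae (Eventually.of_forall fun x => ?_)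
    simp only [dot_mulVec_eq_sum, ← Finset.sum_add_distrib, mul_add]
  have hL2 : (∫ x in S.interior, (D x *ᵥ fun j => pval (z j) x) ⬝ᵥ fun i => pval (w i) x)
      = ∑ i, ∑ j, ∫ x in S.interior, D x i j * (pval (w i) x * pval (z j) x) := by
    have hi : ∀ i j, Integrable (fun x => D x i j * (pval (w i) x * pval (z j) x))
        (volume.restrict S.interior) := fun i j =>
      (memLp_top_mul (hD i j) (hcb (hcwz i j))).integrable le_top
    simp_rw [← integral_finsetSum Finset.univ fun j _ => hi _ j]
    rw [← integral_finsetSum Finset.univ fun i _ => integrable_finsetSum _ fun j _ => hi i j]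
    refine integral_congr_ae (Eventually.of_forall fun x => ?_)
    simp only [dot_mulVec_eq_sum]
  have hR : ∀ f, (∫ x in (S.faceOpposite f).closedInterior,
        ((∑ k, outNormal S f k • A k x) *ᵥ fun j => pval (z j) x) ⬝ᵥ (fun i => pval (w i) x)
          ∂(surf d))
      = ∑ i, ∑ j, ∫ x in (S.faceOpposite f).closedInterior,
        (∑ k, outNormal S f k • A k x) i j * (pval (w i) x * pval (z j) x) ∂(surf d) := by
    intro f
    have := hface f
    have hi : ∀ i j, Integrable (fun x => (∑ k, outNormal S f k • A k x) i j *
        (pval (w i) x * pval (z j) x)) ((surf d).restrict (S.faceOpposite f).closedInterior) :=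
      fun i j => (memLp_top_mul (hF f i j) (hcf f (hcwz i j))).integrable le_top
    simp_rw [← integral_finsetSum Finset.univ fun j _ => hi _ j]
    rw [← integral_finsetSum Finset.univ fun i _ => integrable_finsetSum _ fun j _ => hi i j]
    refine integral_congr_ae (Eventually.of_forall fun x => ?_)
    simp only [dot_mulVec_eq_sum]
  simp only [hL1, hL2, hR]
  rw [Finset.sum_comm, ← Finset.sum_add_distrib]
  conv_rhs => rw [Finset.sum_comm]
  refine Finset.sum_congr rfl fun i _ => ?_
  rw [Finset.sum_comm, ← Finset.sum_add_distrib]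
  conv_rhs => rw [Finset.sum_comm]
  exact Finset.sum_congr rfl fun j _ => hs i j

end GaussGreenMatrix

/-! ### Discrete functions and coefficients on elements and mortars -/

section Coefficients

set_option linter.unusedSectionVars false

variable {d : ℕ} [NeZero d] {Ω : Set (Sp d)} {M : Mesh d Ω} {Γ : BdDecomp Ω} {a b : ℕ}
  {p : Fin M.N → ℕ} {n : ℕ}

theorem Mesh.isBounded_K (i : Fin M.N) : Bornology.IsBounded (M.K i) := isBounded_interior _

theorem Mesh.isFiniteMeasure_K (i : Fin M.N) : IsFiniteMeasure (volume.restrict (M.K i)) :=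
  isFiniteMeasure_interior _

theorem Mesh.isBounded_face (s : M.Side) : Bornology.IsBounded (M.face s) :=
  ((M.elem s.1).faceOpposite s.2).isCompact_closedInterior.isBounded

theorem Mesh.isBounded_carrier (e : M.Mortar Γ) : Bornology.IsBounded (M.carrier Γ e) := by
  obtain ⟨s, hs⟩ := M.exists_side Γ e
  exact (Mesh.isBounded_face s).subset (M.carrier_subset_face Γ hs)

theorem vbdd_vval_K (w : VolSpace M p n) (i : Fin M.N) :
    VBdd (volume.restrict (M.K i)) (vval w i) := fun _ =>
  memLp_top_of_continuous (continuous_pval _) (Mesh.isBounded_K i) (M.isOpen_K i).measurableSet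

theorem vbdd_dval_K (k : Fin d) (w : VolSpace M p n) (i : Fin M.N) :
    VBdd (volume.restrict (M.K i)) (dval k w i) := fun _ =>
  memLp_top_of_continuous (continuous_pval _) (Mesh.isBounded_K i) (M.isOpen_K i).measurableSet

theorem vbdd_vval_carrier (w : VolSpace M p n) (i : Fin M.N) (e : M.Mortar Γ) :
    VBdd ((surf d).restrict (M.carrier Γ e)) (vval w i) := fun _ =>
  memLp_top_of_continuous (continuous_pval _) (Mesh.isBounded_carrier e)
    (M.measurableSet_carrier Γ e)

theorem vbdd_tval_carrier (w : TraceSpace M Γ p n) (e : M.Mortar Γ) :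
    VBdd ((surf d).restrict (M.carrier Γ e)) (tval w e) := fun j => by
  obtain ⟨q, hq⟩ := polyOn_exists (w e j)
  have h : MemLp (pval q) ⊤ ((surf d).restrict (M.carrier Γ e)) :=
    memLp_top_of_continuous (continuous_pval _) (Mesh.isBounded_carrier e)
      (M.measurableSet_carrier Γ e)
  refine (memLp_congr_ae ?_).mp h
  filter_upwards [ae_restrict_mem (M.measurableSet_carrier Γ e)] with x hx
  simp [tval, hq, hx]

theorem ae_K_of_ae {P : Sp d → Prop} (hΩr : interior (closure Ω) = Ω) (i : Fin M.N)
    (h : ∀ᵐ x ∂volume.restrict Ω, P x) : ∀ᵐ x ∂volume.restrict (M.K i), P x :=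
  ae_restrict_of_ae_restrict_of_subset (M.K_subset hΩr i) h

theorem mbdd_K {ι κ : Type*} {F : Sp d → Matrix ι κ ℝ} (hΩr : interior (closure Ω) = Ω)
    (i : Fin M.N) (h : MBdd (volume.restrict Ω) F) : MBdd (volume.restrict (M.K i)) F :=
  h.mono_measure (Measure.restrict_mono (M.K_subset hΩr i) le_rfl)

/-! ### The normal coefficient and its values on the faces -/

theorem normalMat_apply (A : Fin d → Sp d → BlockMat a b) (s : M.Side) (x : Sp d)
    (i j : Fin a ⊕ Fin b) : normalMat M A s x i j = ∑ k, M.normal s k * A k x i j := by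
  simp [normalMat, Matrix.sum_apply]

theorem matB_eq (A : Fin d → Sp d → BlockMat a b) (s : M.Side) (x : Sp d) :
    matB M A s x = ∑ k, M.normal s k • (A k x).toBlocks₁₂ := by
  ext i j
  simp [matB, Matrix.toBlocks₁₂, normalMat_apply, Matrix.sum_apply]

theorem matC_eq (A : Fin d → Sp d → BlockMat a b) (s : M.Side) (x : Sp d) :
    matC M A s x = ∑ k, M.normal s k • (A k x).toBlocks₂₂ := by
  ext i j
  simp [matC, Matrix.toBlocks₂₂, normalMat_apply, Matrix.sum_apply]

/-- After removal of a measurable null set containing the points of discontinuity, `f` is continuous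
on the rest. Volume measurability says nothing about the values on a face, so measurability there
has to come from continuity. -/
theorem aestronglyMeasurable_of_ae_continuousWithinAt {μ : Measure (Sp d)} {f : Sp d → ℝ}
    {t u : Set (Sp d)} (ht : MeasurableSet t) (htu : t ⊆ u)
    (h : ∀ᵐ x ∂μ.restrict t, ContinuousWithinAt f u x) :
    AEStronglyMeasurable f (μ.restrict t) := by
  set N := toMeasurable (μ.restrict t) {x | ¬ ContinuousWithinAt f u x} with hN
  have hNm : MeasurableSet N := measurableSet_toMeasurable _ _
  have hN0 : (μ.restrict t) N = 0 := by
    rw [hN, measure_toMeasurable]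
    exact h
  have h1 : ContinuousOn f (t \ N) := fun x hx => by
    have : ContinuousWithinAt f u x := by
      by_contra hcon
      exact hx.2 (subset_toMeasurable _ _ hcon)
    exact this.mono (Set.sdiff_subset.trans htu)
  have h2 := h1.aestronglyMeasurable (μ := μ) (ht.diff hNm)
  have h3 : μ.restrict t = μ.restrict (t \ N) := by
    refine Measure.restrict_congr_set ?_
    have : ∀ᵐ x ∂μ.restrict t, x ∉ N := measure_eq_zero_iff_ae_notMem.mp hN0
    rw [ae_restrict_iff' ht] at this
    filter_upwards [this] with x hx
    exact propext ⟨fun h => ⟨h, hx h⟩, fun h => h.1⟩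
  rw [h3]
  exact h2

variable {A : Fin d → Sp d → BlockMat a b}

theorem ae_continuousWithinAt_normalMat (hΩo : IsOpen Ω) (hcont : ContinuousAcrossSkeleton M Γ A)
    (s : M.Side) : ∀ᵐ x ∂(surf d).restrict (M.face s),
      ContinuousWithinAt (normalMat M A s) (closure Ω) x :=
  M.ae_face_of_ae_mortar Γ hΩo s fun e he => hcont e s he

theorem ae_tendsto_normalMat (hΩo : IsOpen Ω) (hΩr : interior (closure Ω) = Ω)
    (hcont : ContinuousAcrossSkeleton M Γ A) (s : M.Side) :
    ∀ᵐ x ∂(surf d).restrict (M.face s),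
      Tendsto (normalMat M A s) (𝓝[M.K s.1] x) (𝓝 (normalMat M A s x)) := by
  filter_upwards [ae_continuousWithinAt_normalMat hΩo hcont s] with x hx
  exact hx.mono ((M.K_subset hΩr s.1).trans subset_closure)

/-- A closed condition satisfied almost everywhere in the domain by the normal coefficient holds
almost everywhere on the faces. -/
theorem ae_face_of_closed (hΩo : IsOpen Ω) (hΩr : interior (closure Ω) = Ω)
    (hcont : ContinuousAcrossSkeleton M Γ A) (s : M.Side) {C : Set (BlockMat a b)}
    (hC : IsClosed C) (h : ∀ᵐ x ∂volume.restrict (M.K s.1), normalMat M A s x ∈ C) :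
    ∀ᵐ x ∂(surf d).restrict (M.face s), normalMat M A s x ∈ C := by
  filter_upwards [ae_tendsto_normalMat hΩo hΩr hcont s, ae_restrict_mem (M.measurableSet_face s)]
    with x hx hxs
  exact mem_of_tendsto_of_ae (M.isOpen_K s.1) (face_subset_closure _ _ hxs) hC hx h

/-- A bound on an entry is a closed condition: it holds almost everywhere in the element and passes
to the face values, which are limits from inside. -/
theorem mbdd_normalMat_face (hΩo : IsOpen Ω) (hΩr : interior (closure Ω) = Ω)
    (hcont : ContinuousAcrossSkeleton M Γ A) (hA : ∀ k, EssBounded (A k) (volume.restrict Ω))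
    (s : M.Side) : MBdd ((surf d).restrict (M.face s)) (normalMat M A s) := by
  intro i j
  have h1 : MemLp (fun x => normalMat M A s x i j) ⊤ (volume.restrict (M.K s.1)) := by
    simp only [normalMat_apply]
    exact memLp_finsetSum _ fun k _ =>
      ((hA k i j).mono_measure (Measure.restrict_mono (M.K_subset hΩr s.1) le_rfl)).const_mul _
  obtain ⟨c, hc0, hc⟩ := exists_ae_bound h1
  have hcl : IsClosed {X : BlockMat a b | |X i j| ≤ c} :=
    isClosed_le (continuous_abs.comp (continuous_id.matrix_elem i j)) continuous_const
  refine memLp_top_of_bound ?_ c (ae_face_of_closed hΩo hΩr hcont s hcl hc)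
  refine aestronglyMeasurable_of_ae_continuousWithinAt (M.measurableSet_face s)
    (M.face_subset_closure s) ?_
  filter_upwards [ae_continuousWithinAt_normalMat hΩo hcont s] with x hx
  exact ((continuous_id.matrix_elem i j).tendsto _).comp hx

theorem ae_carrier_of_ae_face {P : Sp d → Prop} {e : M.Mortar Γ} {s : M.Side}
    (hs : s ∈ M.sides Γ e) (h : ∀ᵐ x ∂(surf d).restrict (M.face s), P x) :
    ∀ᵐ x ∂(surf d).restrict (M.carrier Γ e), P x :=
  ae_restrict_of_ae_restrict_of_subset (M.carrier_subset_face Γ hs) h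

theorem mbdd_normalMat_carrier (hΩo : IsOpen Ω) (hΩr : interior (closure Ω) = Ω)
    (hcont : ContinuousAcrossSkeleton M Γ A) (hA : ∀ k, EssBounded (A k) (volume.restrict Ω))
    {e : M.Mortar Γ} {s : M.Side} (hs : s ∈ M.sides Γ e) :
    MBdd ((surf d).restrict (M.carrier Γ e)) (normalMat M A s) :=
  (mbdd_normalMat_face hΩo hΩr hcont hA s).mono_measure
    (Measure.restrict_mono (M.carrier_subset_face Γ hs) le_rfl)

/-- Symmetry of the full normal coefficient is a closed condition and survives the passage from the
element to the face; the diagonal block inherits it. -/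
theorem ae_matC_isSymm (hΩo : IsOpen Ω) (hΩr : interior (closure Ω) = Ω)
    (hcont : ContinuousAcrossSkeleton M Γ A)
    (hsymm : ∀ k, ∀ᵐ x ∂volume.restrict Ω, (A k x).IsSymm) (s : M.Side) :
    ∀ᵐ x ∂(surf d).restrict (M.face s), (matC M A s x).IsSymm := by
  have hcl : IsClosed {X : BlockMat a b | Xᵀ = X} :=
    isClosed_eq (continuous_id.matrix_transpose) continuous_id
  have h := ae_face_of_closed hΩo hΩr hcont s hcl (by
    filter_upwards [eventually_all.mpr fun k => ae_K_of_ae hΩr s.1 (hsymm k)] with x hx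
    simp only [normalMat, Matrix.transpose_sum, Matrix.transpose_smul]
    exact Finset.sum_congr rfl fun k _ => by rw [(hx k).eq])
  filter_upwards [h] with x hx
  have hx' : (normalMat M A s x)ᵀ = normalMat M A s x := hx
  ext i j
  exact congrFun (congrFun hx' (.inr i)) (.inr j)

/-! ### Sums over the skeleton -/

theorem bdSum_eq (g : M.Mortar Γ → M.Side → Sp d → ℝ) :
    bdSum M Γ g = ∑ e : M.Mortar Γ, ∑ s ∈ M.sides Γ e, ∫ x in M.carrier Γ e, g e s x ∂(surf d) := by
  classical
  unfold bdSum
  refine Finset.sum_comm' fun s e => ?_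
  simp

theorem bdSum_eq_faces (hΩo : IsOpen Ω) (hΩr : interior (closure Ω) = Ω)
    {g : M.Side → Sp d → ℝ}
    (hg : ∀ (e : M.Mortar Γ), ∀ s ∈ M.sides Γ e,
      Integrable (g s) ((surf d).restrict (M.carrier Γ e))) :
    bdSum M Γ (fun _ s x => g s x) = ∑ s, ∫ x in M.face s, g s x ∂(surf d) := by
  unfold bdSum
  refine Finset.sum_congr rfl fun s _ => ?_
  rw [M.integral_face Γ hΩo hΩr s fun e he => hg e s he]

/-! ### Gauss-Green formulas on the mesh -/

/-- A test function supported in an element is a test function on the domain, and all integrands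
vanish outside the element. -/
theorem weakDiv_K (hΩo : IsOpen Ω) (hΩr : interior (closure Ω) = Ω) {D : Sp d → BlockMat a b}
    (hdiv : HasWeakDivergence Ω A D) (i : Fin M.N) {φ : Sp d → ℝ} (h1 : ContDiff ℝ ∞ φ)
    (h2 : HasCompactSupport φ) (h3 : tsupport φ ⊆ M.K i) (r c : Fin a ⊕ Fin b) :
    ∑ k, ∫ x in M.K i, A k x r c * fderiv ℝ φ x (EuclideanSpace.single k 1)
      = - ∫ x in M.K i, D x r c * φ x := by
  have hK := M.K_subset hΩr i
  have h := hdiv φ h1 h2 (h3.trans hK) r c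
  have h0 : ∀ x, x ∉ M.K i → φ x = 0 := fun x hx => image_eq_zero_of_notMem_tsupport
    fun h => hx (h3 h)
  have h0' : ∀ x, x ∉ M.K i → fderiv ℝ φ x = 0 := fun x hx =>
    image_eq_zero_of_notMem_tsupport fun h => hx (h3 (tsupport_fderiv_subset ℝ h))
  have hres : ∀ g : Sp d → ℝ, (∀ x, x ∉ M.K i → g x = 0) →
      ∫ x in Ω, g x = ∫ x in M.K i, g x := fun g hg =>
    setIntegral_eq_of_subset_of_forall_sdiff_eq_zero hΩo.measurableSet hK fun x hx => hg x hx.2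
  rw [hres _ (fun x hx => by rw [h0 x hx, mul_zero])] at h
  rw [← h]
  exact Finset.sum_congr rfl fun k _ => (hres _ fun x hx => by rw [h0' x hx]; simp).symm

theorem integral_fderiv_eq_zero (i : Fin M.N) {φ : Sp d → ℝ} (h1 : ContDiff ℝ ∞ φ)
    (h2 : HasCompactSupport φ) (h3 : tsupport φ ⊆ M.K i) (v : Sp d) :
    ∫ x in M.K i, fderiv ℝ φ x v = 0 := by
  have h0' : ∀ x, x ∉ M.K i → fderiv ℝ φ x v = 0 := fun x hx => by
    rw [image_eq_zero_of_notMem_tsupport fun h => hx (h3 (tsupport_fderiv_subset ℝ h))]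
    simp
  rw [setIntegral_eq_integral_of_forall_compl_eq_zero h0']
  have hi : Integrable φ := h1.continuous.integrable_of_hasCompactSupport h2
  have hi' : Integrable fun x => fderiv ℝ φ x v :=
    ((h1.continuous_fderiv (by simp)).clm_apply continuous_const).integrable_of_hasCompactSupport
      (h2.fderiv_apply (𝕜 := ℝ) v)
  have := integral_mul_fderiv_eq_neg_fderiv_mul_of_integrable (μ := volume) (𝕜 := ℝ)
    (f := fun _ : Sp d => (1 : ℝ)) (g := φ) (v := v) (by simp) (by simpa using hi')
    (by simpa using hi) (by simp) (fun x _ => h1.differentiable (by simp) x)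
  simpa using this

/-- The matrices `B k` are constant, so the off-diagonal coefficients are divergence free in the
weak sense and no zeroth-order term appears. -/
theorem gauss_green_B (hΩo : IsOpen Ω) (hΩr : interior (closure Ω) = Ω)
    (hcont : ContinuousAcrossSkeleton M Γ A) (hA : ∀ k, EssBounded (A k) (volume.restrict Ω))
    {B : Fin d → Matrix (Fin a) (Fin b) ℝ}
    (hB : ∀ k, ∀ᵐ x ∂volume.restrict Ω, (A k x).toBlocks₁₂ = B k)
    (w : VolSpace M p a) (u : VolSpace M p b) :
    (∑ k, ∑ i, ∫ x in M.K i, (((A k x).toBlocks₁₂ *ᵥ vval u i x) ⬝ᵥ dval k w i x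
      + ((A k x).toBlocks₁₂ *ᵥ dval k u i x) ⬝ᵥ vval w i x))
    = bdSum M Γ (fun _ s x => (matB M A s x *ᵥ vval u s.1 x) ⬝ᵥ vval w s.1 x) := by
  have hint : ∀ (e : M.Mortar Γ), ∀ s ∈ M.sides Γ e,
      Integrable (fun x => (matB M A s x *ᵥ vval u s.1 x) ⬝ᵥ vval w s.1 x)
        ((surf d).restrict (M.carrier Γ e)) := fun e s hs => by
    have := M.isFiniteMeasure_carrier Γ e
    exact (((mbdd_normalMat_carrier hΩo hΩr hcont hA hs).blocks.2.1).mulVec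
      (vbdd_vval_carrier u _ e)).integrable_dot (vbdd_vval_carrier w _ e)
  rw [bdSum_eq_faces hΩo hΩr (g := fun s x => (matB M A s x *ᵥ vval u s.1 x) ⬝ᵥ vval w s.1 x) hint,
    Fintype.sum_prod_type, Finset.sum_comm]
  refine Finset.sum_congr rfl fun i _ => ?_
  have h := gauss_green_matrix (M.elem i) (A := fun k x => (A k x).toBlocks₁₂) (D := fun _ => 0)
    (fun k => mbdd_K hΩr i (MBdd.blocks (hA k)).2.1) (fun _ _ => by simp)
    (fun φ h1 h2 h3 r c => by
      have hk : ∀ k, ∫ x in M.K i, (A k x).toBlocks₁₂ r c *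
          fderiv ℝ φ x (EuclideanSpace.single k 1) = 0 := fun k => by
        have h4 : ∫ x in M.K i, (A k x).toBlocks₁₂ r c * fderiv ℝ φ x (EuclideanSpace.single k 1)
            = ∫ x in M.K i, B k r c * fderiv ℝ φ x (EuclideanSpace.single k 1) := by
          refine integral_congr_ae ?_
          filter_upwards [ae_K_of_ae hΩr i (hB k)] with x hx
          rw [hx]
        rw [h4, integral_const_mul, integral_fderiv_eq_zero i h1 h2 h3, mul_zero]
      exact (Finset.sum_eq_zero fun k _ => hk k).trans (by simp))
    (fun f => by
      filter_upwards [ae_tendsto_normalMat hΩo hΩr hcont (i, f)] with x hx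
      have hb : Continuous fun X : BlockMat a b => X.toBlocks₁₂ :=
        continuous_matrix fun _ _ => continuous_id.matrix_elem _ _
      have ht : Tendsto (matB M A (i, f)) (𝓝[M.K i] x) (𝓝 (matB M A (i, f) x)) :=
        (hb.tendsto _).comp hx
      rw [show matB M A (i, f) = _ from funext (matB_eq A (i, f))] at ht
      exact ht)
    (fun f => by
      have hm : MBdd ((surf d).restrict (M.face (i, f))) (matB M A (i, f)) :=
        (mbdd_normalMat_face hΩo hΩr hcont hA (i, f)).blocks.2.1
      rw [show matB M A (i, f) = _ from funext (matB_eq A (i, f))] at hm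
      exact hm)
    (fun j => (w i j : MvPolynomial (Fin d) ℝ)) (fun j => (u i j : MvPolynomial (Fin d) ℝ))
  simp only [Matrix.zero_mulVec, zero_dotProduct, integral_zero, add_zero] at h
  simp only [matB_eq]
  exact h

theorem gauss_green_C (hΩo : IsOpen Ω) (hΩr : interior (closure Ω) = Ω)
    (hcont : ContinuousAcrossSkeleton M Γ A) (hA : ∀ k, EssBounded (A k) (volume.restrict Ω))
    {D : Sp d → BlockMat a b} (hD : EssBounded D (volume.restrict Ω))
    (hdiv : HasWeakDivergence Ω A D) (w u : VolSpace M p b) :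
    (∑ k, ∑ i, ∫ x in M.K i, (((A k x).toBlocks₂₂ *ᵥ vval u i x) ⬝ᵥ dval k w i x
      + ((A k x).toBlocks₂₂ *ᵥ dval k u i x) ⬝ᵥ vval w i x))
      + (∑ i, ∫ x in M.K i, ((D x).toBlocks₂₂ *ᵥ vval u i x) ⬝ᵥ vval w i x)
    = bdSum M Γ (fun _ s x => (matC M A s x *ᵥ vval u s.1 x) ⬝ᵥ vval w s.1 x) := by
  have hint : ∀ (e : M.Mortar Γ), ∀ s ∈ M.sides Γ e,
      Integrable (fun x => (matC M A s x *ᵥ vval u s.1 x) ⬝ᵥ vval w s.1 x)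
        ((surf d).restrict (M.carrier Γ e)) := fun e s hs => by
    have := M.isFiniteMeasure_carrier Γ e
    exact (((mbdd_normalMat_carrier hΩo hΩr hcont hA hs).blocks.2.2.2).mulVec
      (vbdd_vval_carrier u _ e)).integrable_dot (vbdd_vval_carrier w _ e)
  rw [bdSum_eq_faces hΩo hΩr (g := fun s x => (matC M A s x *ᵥ vval u s.1 x) ⬝ᵥ vval w s.1 x) hint,
    Fintype.sum_prod_type, Finset.sum_comm, ← Finset.sum_add_distrib]
  refine Finset.sum_congr rfl fun i _ => ?_
  have h := gauss_green_matrix (M.elem i) (A := fun k x => (A k x).toBlocks₂₂)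
    (D := fun x => (D x).toBlocks₂₂)
    (fun k => mbdd_K hΩr i (MBdd.blocks (hA k)).2.2.2) (mbdd_K hΩr i (MBdd.blocks hD).2.2.2)
    (fun φ h1 h2 h3 r c => weakDiv_K hΩo hΩr hdiv i h1 h2 h3 (.inr r) (.inr c))
    (fun f => by
      filter_upwards [ae_tendsto_normalMat hΩo hΩr hcont (i, f)] with x hx
      have hb : Continuous fun X : BlockMat a b => X.toBlocks₂₂ :=
        continuous_matrix fun _ _ => continuous_id.matrix_elem _ _
      have ht : Tendsto (matC M A (i, f)) (𝓝[M.K i] x) (𝓝 (matC M A (i, f) x)) :=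
        (hb.tendsto _).comp hx
      rw [show matC M A (i, f) = _ from funext (matC_eq A (i, f))] at ht
      exact ht)
    (fun f => by
      have hm : MBdd ((surf d).restrict (M.face (i, f))) (matC M A (i, f)) :=
        (mbdd_normalMat_face hΩo hΩr hcont hA (i, f)).blocks.2.2.2
      rw [show matC M A (i, f) = _ from funext (matC_eq A (i, f))] at hm
      exact hm)
    (fun j => (w i j : MvPolynomial (Fin d) ℝ)) (fun j => (u i j : MvPolynomial (Fin d) ℝ))
  simp only [matC_eq]
  exact h

end Coefficients

/-! ### Bilinear forms given by integrals -/

section Bilinear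

set_option linter.unusedSectionVars false

variable {Z Y X : Type*} [AddCommGroup Z] [Module ℝ Z] [AddCommGroup Y] [Module ℝ Y]
  [AddCommGroup X] [Module ℝ X]

/-- The function of two variables is bilinear. -/
def IsBilin (f : Z → Y → ℝ) : Prop := ∃ β : Z →ₗ[ℝ] Y →ₗ[ℝ] ℝ, ∀ z t, f z t = β z t

theorem IsBilin.add {f g : Z → Y → ℝ} (hf : IsBilin f) (hg : IsBilin g) :
    IsBilin fun z t => f z t + g z t := by
  obtain ⟨β, hβ⟩ := hf
  obtain ⟨γ, hγ⟩ := hg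
  exact ⟨β + γ, fun z t => by simp [hβ, hγ]⟩

theorem IsBilin.neg {f : Z → Y → ℝ} (hf : IsBilin f) : IsBilin fun z t => - f z t := by
  obtain ⟨β, hβ⟩ := hf
  exact ⟨-β, fun z t => by simp [hβ]⟩

theorem IsBilin.sub {f g : Z → Y → ℝ} (hf : IsBilin f) (hg : IsBilin g) :
    IsBilin fun z t => f z t - g z t := by
  simpa only [sub_eq_add_neg] using hf.add hg.neg

theorem IsBilin.sum {τ : Type*} (s : Finset τ) {f : τ → Z → Y → ℝ}
    (hf : ∀ i ∈ s, IsBilin (f i)) : IsBilin fun z t => ∑ i ∈ s, f i z t := by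
  classical
  induction s using Finset.induction_on with
  | empty => exact ⟨0, fun z t => by simp⟩
  | insert i s hi ih =>
    have := (hf i (Finset.mem_insert_self i s)).add
      (ih fun j hj => hf j (Finset.mem_insert_of_mem hj))
    simpa only [Finset.sum_insert hi] using this

theorem IsBilin.comp_right {f : Z → Y → ℝ} (hf : IsBilin f) (L : X →ₗ[ℝ] Y) :
    IsBilin fun z t => f z (L t) := by
  obtain ⟨β, hβ⟩ := hf
  exact ⟨(LinearMap.lcomp ℝ ℝ L).comp β, fun z t => by simp [hβ]⟩

theorem IsBilin.zero_right {f : Z → Y → ℝ} (hf : IsBilin f) (z : Z) : f z 0 = 0 := by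
  obtain ⟨β, hβ⟩ := hf
  rw [hβ, map_zero]

variable {α : Type*} [MeasurableSpace α] {ν : Measure α} {ι κ : Type*} [Fintype ι] [Fintype κ]

theorem IsBilin.integral_dot [IsFiniteMeasure ν] {F : Z → α → ι → ℝ} {Q : Y → α → ι → ℝ}
    (hF : IsLinearMap ℝ F) (hQ : IsLinearMap ℝ Q) (bF : ∀ z, VBdd ν (F z))
    (bQ : ∀ t, VBdd ν (Q t)) : IsBilin fun z t => ∫ x, F z x ⬝ᵥ Q t x ∂ν := by
  refine ⟨LinearMap.mk₂ ℝ (fun z t => ∫ x, F z x ⬝ᵥ Q t x ∂ν) ?_ ?_ ?_ ?_, fun z t => rfl⟩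
  · intro z z' t
    rw [← integral_add ((bF z).integrable_dot (bQ t)) ((bF z').integrable_dot (bQ t))]
    simp only [hF.map_add, Pi.add_apply, add_dotProduct]
  · intro c z t
    simp only [hF.map_smul, Pi.smul_apply, smul_dotProduct]
    rw [integral_smul]
  · intro z t t'
    rw [← integral_add ((bF z).integrable_dot (bQ t)) ((bF z).integrable_dot (bQ t'))]
    simp only [hQ.map_add, Pi.add_apply, dotProduct_add]
  · intro c z t
    simp only [hQ.map_smul, Pi.smul_apply, dotProduct_smul]
    rw [integral_smul]

theorem isLinearMap_sum {τ : Type*} (s : Finset τ) {F : τ → Z → α → ι → ℝ}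
    (hF : ∀ i, IsLinearMap ℝ (F i)) : IsLinearMap ℝ fun z x => ∑ i ∈ s, F i z x :=
  ⟨fun z z' => by
    funext x
    simp only [(hF _).map_add, Pi.add_apply, Finset.sum_add_distrib], fun c z => by
    funext x
    simp only [(hF _).map_smul, Pi.smul_apply, Finset.smul_sum]⟩

theorem isLinearMap_mulVec {F : Z → α → κ → ℝ} (hF : IsLinearMap ℝ F) (A : α → Matrix ι κ ℝ) :
    IsLinearMap ℝ fun z x => A x *ᵥ F z x :=
  ⟨fun z z' => by
    funext x
    simp only [hF.map_add, Pi.add_apply, Matrix.mulVec_add], fun c z => by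
    funext x
    simp only [hF.map_smul, Pi.smul_apply, Matrix.mulVec_smul]⟩

end Bilinear

/-! ### The scheme as a linear system -/

section Scheme

set_option linter.unusedSectionVars false

variable {d : ℕ} [NeZero d] {Ω : Set (Sp d)} {M : Mesh d Ω} {Γ : BdDecomp Ω} {a b : ℕ}
  {p : Fin M.N → ℕ} {n : ℕ}

theorem vval_add (w w' : VolSpace M p n) (i : Fin M.N) : vval (w + w') i = vval w i + vval w' i := by
  funext x j
  exact pval_add _ _ x

theorem vval_smul (c : ℝ) (w : VolSpace M p n) (i : Fin M.N) : vval (c • w) i = c • vval w i := by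
  funext x j
  exact pval_smul _ _ x

theorem dval_add (k : Fin d) (w w' : VolSpace M p n) (i : Fin M.N) :
    dval k (w + w') i = dval k w i + dval k w' i := by
  funext x j
  exact (congrArg (fun q => pval q x) (map_add (MvPolynomial.pderiv k) _ _)).trans (pval_add _ _ x)

theorem dval_smul (k : Fin d) (c : ℝ) (w : VolSpace M p n) (i : Fin M.N) :
    dval k (c • w) i = c • dval k w i := by
  funext x j
  exact (congrArg (fun q => pval q x) ((MvPolynomial.pderiv k).map_smul c _)).trans
    (pval_smul _ _ x)

theorem tval_add (w w' : TraceSpace M Γ p n) (e : M.Mortar Γ) :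
    tval (w + w') e = tval w e + tval w' e := rfl

theorem tval_smul (c : ℝ) (w : TraceSpace M Γ p n) (e : M.Mortar Γ) :
    tval (c • w) e = c • tval w e := rfl

theorem isLinearMap_vval (i : Fin M.N) : IsLinearMap ℝ fun w : VolSpace M p n => vval w i :=
  ⟨fun w w' => vval_add w w' i, fun c w => vval_smul c w i⟩

theorem isLinearMap_dval (k : Fin d) (i : Fin M.N) :
    IsLinearMap ℝ fun w : VolSpace M p n => dval k w i :=
  ⟨fun w w' => dval_add k w w' i, fun c w => dval_smul k c w i⟩

theorem isLinearMap_tval (e : M.Mortar Γ) : IsLinearMap ℝ fun w : TraceSpace M Γ p n => tval w e :=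
  ⟨fun w w' => tval_add w w' e, fun c w => tval_smul c w e⟩

/-- The triples `(σ, u, û)` of discrete functions. -/
abbrev Triple (M : Mesh d Ω) (Γ : BdDecomp Ω) (p : Fin M.N → ℕ) (a b : ℕ) : Type :=
  VolSpace M p a × VolSpace M p b × TraceSpace M Γ p b

variable (A : Fin d → Sp d → BlockMat a b) (G : Sp d → BlockMat a b)
  (T : M.Side → Sp d → Matrix (Fin b) (Fin b) ℝ) (ϱ : Sp d → ℝ)

/-- Left-hand side of the first local equation. -/
def resσ (z : Triple M Γ p a b) (s : VolSpace M p a) : ℝ :=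
  - (∑ k, ∑ i, ∫ x in M.K i, ((A k x).toBlocks₁₂ *ᵥ vval z.2.1 i x) ⬝ᵥ dval k s i x)
    + (∑ i, ∫ x in M.K i,
        ((G x).toBlocks₁₁ *ᵥ vval z.1 i x + (G x).toBlocks₁₂ *ᵥ vval z.2.1 i x) ⬝ᵥ vval s i x)
    + bdSum M Γ (fun e t x => (matB M A t x *ᵥ tval z.2.2 e x) ⬝ᵥ vval s t.1 x)

/-- Left-hand side of the second local equation. -/
def resu (z : Triple M Γ p a b) (v : VolSpace M p b) : ℝ :=
  - (∑ k, ∑ i, ∫ x in M.K i,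
        ((A k x).toBlocks₁₂ᵀ *ᵥ vval z.1 i x + (A k x).toBlocks₂₂ *ᵥ vval z.2.1 i x)
          ⬝ᵥ dval k v i x)
    + (∑ i, ∫ x in M.K i,
        ((G x).toBlocks₂₁ *ᵥ vval z.1 i x + (G x).toBlocks₂₂ *ᵥ vval z.2.1 i x) ⬝ᵥ vval v i x)
    + bdSum M Γ (fun e t x => fluxU A T z.1 z.2.1 z.2.2 e t x ⬝ᵥ vval v t.1 x)

/-- Difference of the two sides of the conservation condition. -/
def resGlobal (z : Triple M Γ p a b) (w : TraceSpace M Γ p b) : ℝ :=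
  (open Classical in ∑ e : M.Mortar Γ with ¬ M.IsDir Γ e, ∫ x in M.carrier Γ e,
        (∑ t ∈ M.sides Γ e, fluxU A T z.1 z.2.1 z.2.2 e t x) ⬝ᵥ tval w e x ∂(surf d))
    - (open Classical in ∑ e : M.Mortar Γ with M.IsNeuRob Γ e, ∫ x in M.carrier Γ e,
        (∑ t ∈ M.sides Γ e,
          ((ϱ x • (1 : Matrix (Fin b) (Fin b) ℝ) + matC M A t x) *ᵥ tval z.2.2 e x))
            ⬝ᵥ tval w e x ∂(surf d))

/-- Left-hand side of the Dirichlet condition. -/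
def resDir (z : Triple M Γ p a b) (w : TraceSpace M Γ p b) : ℝ :=
  open Classical in ∑ e : M.Mortar Γ with M.IsDir Γ e, ∫ x in M.carrier Γ e,
        tval z.2.2 e x ⬝ᵥ tval w e x ∂(surf d)

/-- The load functional of a volume density. -/
def load (f : Sp d → Fin n → ℝ) (s : VolSpace M p n) : ℝ :=
  ∑ i, ∫ x in M.K i, f x ⬝ᵥ vval s i x

variable {A G T ϱ}

theorem isSolution_iff {fσ : Sp d → Fin a → ℝ} {fu : Sp d → Fin b → ℝ}
    (z : Triple M Γ p a b) :
    IsSolution M Γ p A G T ϱ fσ fu z.1 z.2.1 z.2.2 ↔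
      (∀ s, resσ A G z s = load fσ s) ∧ (∀ v, resu A G T z v = load fu v) ∧
      (∀ w, resGlobal A T ϱ z w = 0) ∧ ∀ w, resDir z w = 0 :=
  ⟨fun h => ⟨h.local_σ, h.local_u, fun w => sub_eq_zero.mpr (h.global w), h.dirichlet⟩,
    fun h => ⟨h.1, h.2.1, fun w => sub_eq_zero.mp (h.2.2.1 w), h.2.2.2⟩⟩

theorem isLinear_load (hΩr : interior (closure Ω) = Ω) {f : Sp d → Fin n → ℝ}
    (hf : ∀ j, MemLp (fun x => f x j) 2 (volume.restrict Ω)) :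
    ∃ ℓ : VolSpace M p n →ₗ[ℝ] ℝ, ∀ s, load f s = ℓ s := by
  have hint : ∀ (s : VolSpace M p n) i,
      Integrable (fun x => f x ⬝ᵥ vval s i x) (volume.restrict (M.K i)) := fun s i => by
    have := Mesh.isFiniteMeasure_K i
    refine integrable_finsetSum _ fun j _ => ?_
    have h1 : Integrable (fun x => f x j) (volume.restrict (M.K i)) :=
      ((hf j).mono_measure (Measure.restrict_mono (M.K_subset hΩr i) le_rfl)).integrable
        (by norm_num)
    obtain ⟨c, -, hc⟩ := exists_ae_bound (vbdd_vval_K s i j)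
    exact h1.mul_bdd (c := c) (vbdd_vval_K s i j).1 hc
  refine ⟨⟨⟨load f, fun s s' => ?_⟩, fun c s => ?_⟩, fun s => rfl⟩
  · unfold load
    rw [← Finset.sum_add_distrib]
    refine Finset.sum_congr rfl fun i _ => ?_
    rw [← integral_add (hint s i) (hint s' i)]
    simp only [vval_add, Pi.add_apply, dotProduct_add]
  · unfold load
    simp only [vval_smul, Pi.smul_apply, dotProduct_smul]
    simp_rw [integral_smul]
    rw [← Finset.smul_sum]
    rfl

/-- The projections of a triple. -/
def prσ : Triple M Γ p a b →ₗ[ℝ] VolSpace M p a := LinearMap.fst ℝ _ _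

/-- The projections of a triple. -/
def pru : Triple M Γ p a b →ₗ[ℝ] VolSpace M p b := LinearMap.fst ℝ _ _ ∘ₗ LinearMap.snd ℝ _ _

/-- The projections of a triple. -/
def prt : Triple M Γ p a b →ₗ[ℝ] TraceSpace M Γ p b := LinearMap.snd ℝ _ _ ∘ₗ LinearMap.snd ℝ _ _

theorem lin_u (i : Fin M.N) : IsLinearMap ℝ fun z : Triple M Γ p a b => vval z.2.1 i :=
  ⟨fun z z' => vval_add z.2.1 z'.2.1 i, fun c z => vval_smul c z.2.1 i⟩

theorem lin_t (e : M.Mortar Γ) : IsLinearMap ℝ fun z : Triple M Γ p a b => tval z.2.2 e :=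
  ⟨fun z z' => tval_add z.2.2 z'.2.2 e, fun c z => tval_smul c z.2.2 e⟩

theorem lin_cell {m : ℕ} (X : Sp d → Matrix (Fin m) (Fin a) ℝ) (Y : Sp d → Matrix (Fin m) (Fin b) ℝ)
    (i : Fin M.N) : IsLinearMap ℝ fun (z : Triple M Γ p a b) x =>
      X x *ᵥ vval z.1 i x + Y x *ᵥ vval z.2.1 i x := by
  refine ⟨fun z z' => ?_, fun c z => ?_⟩
  · funext x
    simp only [Prod.fst_add, Prod.snd_add, vval_add, Pi.add_apply, Matrix.mulVec_add]
    abel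
  · funext x
    simp only [Prod.smul_fst, Prod.smul_snd, vval_smul, Pi.smul_apply, Matrix.mulVec_smul,
      smul_add]

theorem isBilin_cell {m : ℕ} {X : Sp d → Matrix (Fin m) (Fin a) ℝ}
    {Y : Sp d → Matrix (Fin m) (Fin b) ℝ} {i : Fin M.N}
    (hX : MBdd (volume.restrict (M.K i)) X) (hY : MBdd (volume.restrict (M.K i)) Y)
    {V : Type*} [AddCommGroup V] [Module ℝ V] {Q : V → Sp d → Fin m → ℝ} (hQ : IsLinearMap ℝ Q)
    (bQ : ∀ t, VBdd (volume.restrict (M.K i)) (Q t)) :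
    IsBilin fun (z : Triple M Γ p a b) t => ∫ x in M.K i,
      (X x *ᵥ vval z.1 i x + Y x *ᵥ vval z.2.1 i x) ⬝ᵥ Q t x := by
  have := Mesh.isFiniteMeasure_K i
  exact IsBilin.integral_dot (lin_cell X Y i) hQ
    (fun z => (hX.mulVec (vbdd_vval_K z.1 i)).add (hY.mulVec (vbdd_vval_K z.2.1 i))) bQ

theorem lin_flux (e : M.Mortar Γ) (s : M.Side) :
    IsLinearMap ℝ fun z : Triple M Γ p a b => fluxU A T z.1 z.2.1 z.2.2 e s := by
  refine ⟨fun z z' => ?_, fun c z => ?_⟩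
  · funext x
    simp only [fluxU, Prod.fst_add, Prod.snd_add, vval_add, tval_add, Pi.add_apply,
      Matrix.mulVec_add, Matrix.mulVec_sub]
    abel
  · funext x
    simp only [fluxU, Prod.smul_fst, Prod.smul_snd, vval_smul, tval_smul, Pi.smul_apply,
      Matrix.mulVec_smul, Matrix.mulVec_sub, smul_add, smul_sub]

/-- Boundedness of the data on the elements and mortars. -/
structure BoundedData (M : Mesh d Ω) (Γ : BdDecomp Ω) (A : Fin d → Sp d → BlockMat a b)
    (G : Sp d → BlockMat a b) (T : M.Side → Sp d → Matrix (Fin b) (Fin b) ℝ) (ϱ : Sp d → ℝ) :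
    Prop where
  bA : ∀ i k, MBdd (volume.restrict (M.K i)) (A k)
  bG : ∀ i, MBdd (volume.restrict (M.K i)) G
  bN : ∀ (e : M.Mortar Γ), ∀ s ∈ M.sides Γ e,
    MBdd ((surf d).restrict (M.carrier Γ e)) (normalMat M A s)
  bT : ∀ (e : M.Mortar Γ), ∀ s ∈ M.sides Γ e, MBdd ((surf d).restrict (M.carrier Γ e)) (T s)
  bϱ : ∀ (e : M.Mortar Γ), M.IsNeuRob Γ e → MemLp ϱ ⊤ ((surf d).restrict (M.carrier Γ e))

theorem BoundedData.mbdd_matB (h : BoundedData M Γ A G T ϱ) (e : M.Mortar Γ) {s : M.Side}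
    (hs : s ∈ M.sides Γ e) : MBdd ((surf d).restrict (M.carrier Γ e)) (matB M A s) :=
  (h.bN e s hs).blocks.2.1

theorem BoundedData.mbdd_matC (h : BoundedData M Γ A G T ϱ) (e : M.Mortar Γ) {s : M.Side}
    (hs : s ∈ M.sides Γ e) : MBdd ((surf d).restrict (M.carrier Γ e)) (matC M A s) :=
  (h.bN e s hs).blocks.2.2.2

theorem BoundedData.flux (h : BoundedData M Γ A G T ϱ) (e : M.Mortar Γ) {s : M.Side}
    (hs : s ∈ M.sides Γ e) (z : Triple M Γ p a b) :
    VBdd ((surf d).restrict (M.carrier Γ e)) (fluxU A T z.1 z.2.1 z.2.2 e s) :=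
  (((h.mbdd_matB e hs).transpose.mulVec (vbdd_vval_carrier _ _ e)).add
    ((h.mbdd_matC e hs).mulVec (vbdd_vval_carrier _ _ e))).add
    ((h.bT e s hs).mulVec ((vbdd_vval_carrier _ _ e).sub (vbdd_tval_carrier _ e)))

theorem BoundedData.robin (h : BoundedData M Γ A G T ϱ) {e : M.Mortar Γ} (he : M.IsNeuRob Γ e)
    {s : M.Side} (hs : s ∈ M.sides Γ e) : MBdd ((surf d).restrict (M.carrier Γ e))
      fun x => ϱ x • (1 : Matrix (Fin b) (Fin b) ℝ) + matC M A s x := by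
  have := M.isFiniteMeasure_carrier Γ e
  exact ((MBdd.const 1).smul (h.bϱ e he)).add (h.mbdd_matC e hs)

theorem isBilin_bdSum {Z Y : Type*} [AddCommGroup Z] [Module ℝ Z] [AddCommGroup Y] [Module ℝ Y]
    {F : M.Mortar Γ → M.Side → Z → Sp d → Fin n → ℝ} {Q : M.Side → Y → Sp d → Fin n → ℝ}
    (hF : ∀ e s, IsLinearMap ℝ (F e s)) (hQ : ∀ s, IsLinearMap ℝ (Q s))
    (bF : ∀ (e : M.Mortar Γ), ∀ s ∈ M.sides Γ e, ∀ z,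
      VBdd ((surf d).restrict (M.carrier Γ e)) (F e s z))
    (bQ : ∀ (e : M.Mortar Γ) s t, VBdd ((surf d).restrict (M.carrier Γ e)) (Q s t)) :
    IsBilin fun z t => bdSum M Γ fun e s x => F e s z x ⬝ᵥ Q s t x := by
  simp only [bdSum_eq]
  refine IsBilin.sum _ fun e _ => IsBilin.sum _ fun s hs => ?_
  have := M.isFiniteMeasure_carrier Γ e
  exact IsBilin.integral_dot (hF e s) (hQ s) (bF e s hs) (bQ e s)

theorem BoundedData.isBilin_resσ (h : BoundedData M Γ A G T ϱ) :
    IsBilin (resσ A G : Triple M Γ p a b → _ → ℝ) := by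
  unfold resσ
  refine ((IsBilin.sum _ fun k _ => IsBilin.sum _ fun i _ => ?_).neg.add
    (IsBilin.sum _ fun i _ => ?_)).add ?_
  · have := Mesh.isFiniteMeasure_K i
    exact IsBilin.integral_dot (isLinearMap_mulVec (lin_u i) _) (isLinearMap_dval k i)
      (fun z => (h.bA i k).blocks.2.1.mulVec (vbdd_vval_K _ i)) fun t => vbdd_dval_K k t i
  · exact isBilin_cell (V := VolSpace M p a) (Q := fun t => vval t i) (h.bG i).blocks.1
      (h.bG i).blocks.2.1 (isLinearMap_vval (p := p) (n := a) i) fun t => vbdd_vval_K t i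
  · exact isBilin_bdSum (Z := Triple M Γ p a b) (Y := VolSpace M p a)
      (F := fun e s z x => matB M A s x *ᵥ tval z.2.2 e x) (Q := fun s t x => vval t s.1 x) (fun e s => isLinearMap_mulVec (lin_t e) _)
      (fun s => isLinearMap_vval s.1)
      (fun e s hs z => (h.mbdd_matB e hs).mulVec (vbdd_tval_carrier _ e))
      fun e s t => vbdd_vval_carrier t s.1 e

theorem BoundedData.isBilin_resu (h : BoundedData M Γ A G T ϱ) :
    IsBilin (resu A G T : Triple M Γ p a b → _ → ℝ) := by
  unfold resu
  refine ((IsBilin.sum _ fun k _ => IsBilin.sum _ fun i _ => ?_).neg.add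
    (IsBilin.sum _ fun i _ => ?_)).add ?_
  · exact isBilin_cell (V := VolSpace M p b) (Q := fun t => dval k t i)
      (h.bA i k).blocks.2.1.transpose (h.bA i k).blocks.2.2.2
      (isLinearMap_dval (p := p) (n := b) k i) fun t => vbdd_dval_K k t i
  · exact isBilin_cell (V := VolSpace M p b) (Q := fun t => vval t i) (h.bG i).blocks.2.2.1
      (h.bG i).blocks.2.2.2 (isLinearMap_vval (p := p) (n := b) i) fun t => vbdd_vval_K t i
  · exact isBilin_bdSum (Z := Triple M Γ p a b) (Y := VolSpace M p b)
      (F := fun e s z x => fluxU A T z.1 z.2.1 z.2.2 e s x) (Q := fun s t x => vval t s.1 x) (fun e s => lin_flux e s)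
      (fun s => isLinearMap_vval s.1) (fun e s hs z => h.flux e hs z)
      fun e s t => vbdd_vval_carrier t s.1 e

theorem BoundedData.isBilin_resGlobal (h : BoundedData M Γ A G T ϱ) :
    IsBilin (resGlobal A T ϱ : Triple M Γ p a b → _ → ℝ) := by
  classical
  unfold resGlobal
  refine (IsBilin.sum _ fun e _ => ?_).sub (IsBilin.sum _ fun e he => ?_)
  · have := M.isFiniteMeasure_carrier Γ e
    exact IsBilin.integral_dot (isLinearMap_sum _ fun s => lin_flux e s) (isLinearMap_tval e)
      (fun z => VBdd.sum _ fun s hs => h.flux e hs z) fun t => vbdd_tval_carrier t e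
  · have := M.isFiniteMeasure_carrier Γ e
    have hNR : M.IsNeuRob Γ e := (Finset.mem_filter.mp he).2
    exact IsBilin.integral_dot
      (isLinearMap_sum _ fun s => isLinearMap_mulVec (lin_t e) _) (isLinearMap_tval e)
      (fun z => VBdd.sum _ fun s hs => (h.robin hNR hs).mulVec (vbdd_tval_carrier _ e))
      fun t => vbdd_tval_carrier t e

theorem isBilin_resDir : IsBilin (resDir : Triple M Γ p a b → _ → ℝ) := by
  classical
  unfold resDir
  refine IsBilin.sum _ fun e _ => ?_
  have := M.isFiniteMeasure_carrier Γ e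
  exact IsBilin.integral_dot (lin_t e) (isLinearMap_tval e)
    (fun z => vbdd_tval_carrier _ e) fun t => vbdd_tval_carrier t e

/-! ### Unique solvability of the square linear system -/

instance : FiniteDimensional ℝ (Triple M Γ p a b) := by
  have h : ∀ e : M.Mortar Γ,
      FiniteDimensional ℝ (polyOn (M.carrier Γ e) (M.degree Γ p e)) := fun e => by
    unfold polyOn
    infer_instance
  infer_instance

/-- A trace function cut down to the Dirichlet mortars. -/
def dirPart (w : TraceSpace M Γ p n) : TraceSpace M Γ p n :=
  open Classical in fun e => if M.IsDir Γ e then w e else 0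

theorem tval_dirPart_of_isDir (w : TraceSpace M Γ p n) {e : M.Mortar Γ} (he : M.IsDir Γ e) :
    tval (dirPart w) e = tval w e := by
  funext x j
  simp [tval, dirPart, he]

theorem tval_dirPart_of_not_isDir (w : TraceSpace M Γ p n) {e : M.Mortar Γ}
    (he : ¬ M.IsDir Γ e) : tval (dirPart w) e = 0 := by
  funext x j
  simp [tval, dirPart, he]

theorem not_isDir_of_isNeuRob {e : M.Mortar Γ} (he : M.IsNeuRob Γ e) : ¬ M.IsDir Γ e := by
  intro h
  unfold Mesh.IsDir at h
  unfold Mesh.IsNeuRob at he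
  rw [h] at he
  simp at he

/-- The conservation condition does not see Dirichlet mortars, and the Dirichlet condition sees
nothing else. Testing with the Dirichlet part therefore isolates the Dirichlet residual in the sum
of the two. -/
theorem resGlobal_dirPart (z : Triple M Γ p a b) (w : TraceSpace M Γ p b) :
    resGlobal A T ϱ z (dirPart w) = 0 := by
  classical
  unfold resGlobal
  rw [Finset.sum_eq_zero, Finset.sum_eq_zero, sub_zero]
  · intro e he
    rw [tval_dirPart_of_not_isDir w (not_isDir_of_isNeuRob (Finset.mem_filter.mp he).2)]
    simp
  · intro e he
    rw [tval_dirPart_of_not_isDir w (Finset.mem_filter.mp he).2]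
    simp

theorem resDir_dirPart (z : Triple M Γ p a b) (w : TraceSpace M Γ p b) :
    resDir z (dirPart w) = resDir z w := by
  classical
  unfold resDir
  refine Finset.sum_congr rfl fun e he => ?_
  rw [tval_dirPart_of_isDir w (Finset.mem_filter.mp he).2]

/-- The square linear system is uniquely solvable if the homogeneous problem is. -/
theorem BoundedData.existsUnique (h : BoundedData M Γ A G T ϱ) (hΩr : interior (closure Ω) = Ω)
    {fσ : Sp d → Fin a → ℝ} {fu : Sp d → Fin b → ℝ}
    (hfσ : ∀ j, MemLp (fun x => fσ x j) 2 (volume.restrict Ω))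
    (hfu : ∀ j, MemLp (fun x => fu x j) 2 (volume.restrict Ω))
    (huniq : ∀ z : Triple M Γ p a b, (∀ s, resσ A G z s = 0) → (∀ v, resu A G T z v = 0) →
      (∀ w, resGlobal A T ϱ z w = 0) → (∀ w, resDir z w = 0) → z = 0) :
    ∃! z : Triple M Γ p a b, IsSolution M Γ p A G T ϱ fσ fu z.1 z.2.1 z.2.2 := by
  -- The sum of all four residuals, the conservation and Dirichlet ones taken against the same trace
  -- test function, so that the system is square.
  obtain ⟨β, hβ⟩ := ((h.isBilin_resσ (p := p)).comp_right (prσ (Γ := Γ) (b := b))).add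
    (((h.isBilin_resu (p := p)).comp_right (pru (Γ := Γ) (a := a))).add
      (((h.isBilin_resGlobal (p := p)).add isBilin_resDir).comp_right (prt (a := a))))
  obtain ⟨lσ, hlσ⟩ := isLinear_load (M := M) (p := p) hΩr hfσ
  obtain ⟨lu, hlu⟩ := isLinear_load (M := M) (p := p) hΩr hfu
  set ℓ : Module.Dual ℝ (Triple M Γ p a b) := lσ ∘ₗ prσ + lu ∘ₗ pru with hℓ
  -- The separate equations are recovered from the sum by switching on one component of the test
  -- triple at a time. For the trace component the Dirichlet condition is extracted first, and then
  -- subtracted.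
  have hsplit : ∀ z : Triple M Γ p a b, ∀ fs fu' : _ → ℝ, fs 0 = 0 → fu' 0 = 0 →
      (∀ t : Triple M Γ p a b, β z t = fs t.1 + fu' t.2.1) →
      (∀ s, resσ A G z s = fs s) ∧ (∀ v, resu A G T z v = fu' v) ∧
      (∀ w, resGlobal A T ϱ z w = 0) ∧ ∀ w, resDir z w = 0 := by
    intro z fs fu' hs0 hu0 ht
    have hz1 := h.isBilin_resσ.zero_right z
    have hz2 := h.isBilin_resu.zero_right z
    have hz3 := h.isBilin_resGlobal.zero_right z
    have hz4 := isBilin_resDir.zero_right z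
    have hall : ∀ s v w, resσ A G z s + (resu A G T z v + (resGlobal A T ϱ z w + resDir z w))
        = fs s + fu' v := fun s v w => by
      rw [← ht (s, v, w), ← hβ]
      rfl
    have hdir : ∀ w, resDir z w = 0 := fun w => by
      have := hall 0 0 (dirPart w)
      rw [hz1, hz2, hs0, hu0, resGlobal_dirPart, resDir_dirPart] at this
      linarith
    refine ⟨fun s => ?_, fun v => ?_, fun w => ?_, hdir⟩
    · have := hall s 0 0
      rw [hz2, hz3, hz4, hu0] at this
      linarith
    · have := hall 0 v 0
      rw [hz1, hz3, hz4, hs0] at this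
      linarith
    · have := hall 0 0 w
      rw [hz1, hz2, hs0, hu0, hdir] at this
      linarith
  have hinj : Function.Injective β := by
    rw [← LinearMap.ker_eq_bot, LinearMap.ker_eq_bot']
    intro z hz
    obtain ⟨h1, h2, h3, h4⟩ := hsplit z (fun _ => 0) (fun _ => 0) rfl rfl fun t => by
      rw [hz]; simp
    exact huniq z h1 h2 h3 h4
  have hsurj : Function.Surjective β :=
    (LinearMap.injective_iff_surjective_of_finrank_eq_finrank
      Subspace.dual_finrank_eq.symm).mp hinj
  have hiff : ∀ z : Triple M Γ p a b,
      IsSolution M Γ p A G T ϱ fσ fu z.1 z.2.1 z.2.2 ↔ β z = ℓ := by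
    intro z
    rw [isSolution_iff]
    constructor
    · rintro ⟨h1, h2, h3, h4⟩
      refine LinearMap.ext fun t => ?_
      rw [← hβ]
      beta_reduce
      rw [h1, h2, h3, h4, hlσ, hlu, add_zero, add_zero]
      rfl
    · intro hz
      simp only [hlσ, hlu]
      exact hsplit z lσ lu (map_zero _) (map_zero _) fun t => by
        rw [hz, hℓ]; rfl
  obtain ⟨z, hz⟩ := hsurj ℓ
  exact ⟨z, (hiff z).mpr hz, fun z' hz' => hinj (((hiff z').mp hz').trans hz.symm)⟩

end Scheme

/-! ### The energy identity -/

section Energy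

set_option linter.unusedSectionVars false

variable {d : ℕ} [NeZero d] {Ω : Set (Sp d)} {M : Mesh d Ω} {Γ : BdDecomp Ω} {a b : ℕ}
  {p : Fin M.N → ℕ} {n : ℕ}
  {A : Fin d → Sp d → BlockMat a b} {D G : Sp d → BlockMat a b}
  {T : M.Side → Sp d → Matrix (Fin b) (Fin b) ℝ} {ϱ : Sp d → ℝ}

theorem transpose_mulVec_dot {ι κ : Type*} [Fintype ι] [Fintype κ] (X : Matrix ι κ ℝ) (v : ι → ℝ)
    (w : κ → ℝ) : (Xᵀ *ᵥ v) ⬝ᵥ w = (X *ᵥ w) ⬝ᵥ v := by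
  rw [Matrix.mulVec_transpose, ← Matrix.dotProduct_mulVec, dotProduct_comm]

theorem symm_mulVec_dot {ι : Type*} [Fintype ι] {X : Matrix ι ι ℝ} (hX : X.IsSymm) (v w : ι → ℝ) :
    (X *ᵥ v) ⬝ᵥ w = (X *ᵥ w) ⬝ᵥ v := by
  rw [← transpose_mulVec_dot, hX.eq]

/-- Testing with `û` itself turns the Dirichlet condition into a vanishing sum of integrals of
squares. -/
theorem tval_eq_zero_of_resDir {z : Triple M Γ p a b} (h : ∀ w, resDir z w = 0) {e : M.Mortar Γ}
    (he : M.IsDir Γ e) : ∀ᵐ x ∂(surf d).restrict (M.carrier Γ e), tval z.2.2 e x = 0 := by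
  classical
  have hnn : ∀ (e : M.Mortar Γ) x, 0 ≤ tval z.2.2 e x ⬝ᵥ tval z.2.2 e x := fun e x =>
    Finset.sum_nonneg fun j _ => mul_self_nonneg _
  have h0 := h z.2.2
  unfold resDir at h0
  rw [Finset.sum_eq_zero_iff_of_nonneg fun e _ => integral_nonneg fun x => hnn e x] at h0
  have h1 := h0 e (Finset.mem_filter.mpr ⟨Finset.mem_univ e, he⟩)
  have := M.isFiniteMeasure_carrier Γ e
  rw [integral_eq_zero_iff_of_nonneg (fun x => hnn e x)
    ((vbdd_tval_carrier z.2.2 e).integrable_dot (vbdd_tval_carrier z.2.2 e))] at h1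
  filter_upwards [h1] with x hx
  exact dotProduct_self_eq_zero.mp hx

/-- The boundary term of the Neumann and Robin mortars. -/
def robinTerm (A : Fin d → Sp d → BlockMat a b) (ϱ : Sp d → ℝ) (c : ℝ) (w : TraceSpace M Γ p b)
    (e : M.Mortar Γ) (s : M.Side) (x : Sp d) : ℝ :=
  open Classical in if M.IsNeuRob Γ e then
    ((ϱ x • (1 : Matrix (Fin b) (Fin b) ℝ) + c • matC M A s x) *ᵥ tval w e x) ⬝ᵥ tval w e x
  else 0

theorem BoundedData.integrable_robinTerm (h : BoundedData M Γ A G T ϱ) (c : ℝ)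
    (w : TraceSpace M Γ p b) (e : M.Mortar Γ) {s : M.Side} (hs : s ∈ M.sides Γ e) :
    Integrable (robinTerm A ϱ c w e s) ((surf d).restrict (M.carrier Γ e)) := by
  have := M.isFiniteMeasure_carrier Γ e
  unfold robinTerm
  by_cases he : M.IsNeuRob Γ e
  · simp only [he, if_true]
    exact ((((MBdd.const 1).smul (h.bϱ e he)).add ((h.mbdd_matC e hs).const_smul c)).mulVec
      (vbdd_tval_carrier w e)).integrable_dot (vbdd_tval_carrier w e)
  · simp only [he, if_false]
    exact integrable_zero _ _ _

/-- Since `û` vanishes almost everywhere on Dirichlet mortars, the sum over the other mortars may be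
extended to all of them, which matches the boundary sums in the local equations. -/
theorem BoundedData.resGlobal_self (h : BoundedData M Γ A G T ϱ) {z : Triple M Γ p a b}
    (hdir : ∀ e : M.Mortar Γ, M.IsDir Γ e →
      ∀ᵐ x ∂(surf d).restrict (M.carrier Γ e), tval z.2.2 e x = 0) :
    resGlobal A T ϱ z z.2.2
      = bdSum M Γ (fun e s x => fluxU A T z.1 z.2.1 z.2.2 e s x ⬝ᵥ tval z.2.2 e x)
        - bdSum M Γ (robinTerm A ϱ 1 z.2.2) := by
  classical
  unfold resGlobal
  rw [bdSum_eq, bdSum_eq]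
  congr 1
  · rw [Finset.sum_filter]
    refine Finset.sum_congr rfl fun e _ => ?_
    have := M.isFiniteMeasure_carrier Γ e
    by_cases he : M.IsDir Γ e
    · rw [if_neg (not_not.mpr he)]
      refine (Finset.sum_eq_zero fun s _ => ?_).symm
      refine integral_eq_zero_of_ae ?_
      filter_upwards [hdir e he] with x hx
      simp [hx]
    · rw [if_pos he, ← integral_finsetSum _ fun s hs =>
        (h.flux e hs z).integrable_dot (vbdd_tval_carrier z.2.2 e)]
      simp only [sum_dotProduct]
  · rw [Finset.sum_filter]
    refine Finset.sum_congr rfl fun e _ => ?_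
    have := M.isFiniteMeasure_carrier Γ e
    by_cases he : M.IsNeuRob Γ e
    · rw [if_pos he, ← integral_finsetSum _ fun s hs => h.integrable_robinTerm 1 z.2.2 e hs]
      simp only [robinTerm, he, if_true, one_smul, sum_dotProduct]
    · rw [if_neg he]
      refine (Finset.sum_eq_zero fun s _ => ?_).symm
      simp [robinTerm, he]

/-- The density of the energy on the elements. -/
def cellEnergy (G D : Sp d → BlockMat a b) (z : Triple M Γ p a b) (i : Fin M.N) (x : Sp d) : ℝ :=
  ((G x).toBlocks₁₁ *ᵥ vval z.1 i x + (G x).toBlocks₁₂ *ᵥ vval z.2.1 i x) ⬝ᵥ vval z.1 i x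
    + ((G x).toBlocks₂₁ *ᵥ vval z.1 i x + (G x).toBlocks₂₂ *ᵥ vval z.2.1 i x) ⬝ᵥ vval z.2.1 i x
    + (1 / 2) * (((D x).toBlocks₂₂ *ᵥ vval z.2.1 i x) ⬝ᵥ vval z.2.1 i x)

/-- The density of the energy on the element boundaries. -/
def faceEnergy (A : Fin d → Sp d → BlockMat a b) (T : M.Side → Sp d → Matrix (Fin b) (Fin b) ℝ)
    (ϱ : Sp d → ℝ) (z : Triple M Γ p a b) (e : M.Mortar Γ) (s : M.Side) (x : Sp d) : ℝ :=
  (((1 / 2 : ℝ) • matC M A s x + T s x) *ᵥ (vval z.2.1 s.1 x - tval z.2.2 e x))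
      ⬝ᵥ (vval z.2.1 s.1 x - tval z.2.2 e x)
    + robinTerm A ϱ (1 / 2) z.2.2 e s x

theorem BoundedData.integrable_faceEnergy (h : BoundedData M Γ A G T ϱ) (z : Triple M Γ p a b)
    (e : M.Mortar Γ) {s : M.Side} (hs : s ∈ M.sides Γ e) :
    Integrable (faceEnergy A T ϱ z e s) ((surf d).restrict (M.carrier Γ e)) := by
  have := M.isFiniteMeasure_carrier Γ e
  have hd := (vbdd_vval_carrier z.2.1 s.1 e).sub (vbdd_tval_carrier z.2.2 e)
  exact ((((h.mbdd_matC e hs).const_smul (1 / 2)).add (h.bT e s hs)).mulVec hd).integrable_dot hd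
    |>.add (h.integrable_robinTerm (1 / 2) z.2.2 e hs)

theorem BoundedData.integrable_cellEnergy (h : BoundedData M Γ A G T ϱ)
    (hD : ∀ i, MBdd (volume.restrict (M.K i)) D) (z : Triple M Γ p a b) (i : Fin M.N) :
    Integrable (cellEnergy G D z i) (volume.restrict (M.K i)) := by
  have := M.isFiniteMeasure_K i
  have hσ := vbdd_vval_K z.1 i
  have hu := vbdd_vval_K z.2.1 i
  have hG := (h.bG i).blocks
  exact ((((hG.1.mulVec hσ).add (hG.2.1.mulVec hu)).integrable_dot hσ).add
    (((hG.2.2.1.mulVec hσ).add (hG.2.2.2.mulVec hu)).integrable_dot hu)).add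
    ((((hD i).blocks.2.2.2.mulVec hu).integrable_dot hu).const_mul _)

/-- The contributions of the two sides of an interior mortar cancel. -/
theorem sum_sides_matC (w : TraceSpace M Γ p b) {e : M.Mortar Γ} (he : M.kind Γ e = none)
    (x : Sp d) : ∑ s ∈ M.sides Γ e, (matC M A s x *ᵥ tval w e x) ⬝ᵥ tval w e x = 0 := by
  match e, he with
  | .inl q, _ =>
    have hne : q.1.1 ≠ q.1.2 := fun hq => by
      have := q.2.1
      rw [hq] at this
      exact lt_irrefl _ this
    have hC : matC M A q.1.2 x = - matC M A q.1.1 x := by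
      rw [matC_eq, matC_eq, ← Finset.sum_neg_distrib]
      refine Finset.sum_congr rfl fun k _ => ?_
      rw [M.normal_intMortar q, PiLp.neg_apply, neg_smul]
    change ∑ s ∈ ({q.1.1, q.1.2} : Finset M.Side), _ = _
    rw [Finset.sum_pair hne, hC, Matrix.neg_mulVec, neg_dotProduct, add_neg_cancel]

theorem Mesh.kind_eq_none {e : M.Mortar Γ} (hd : ¬ M.IsDir Γ e) (hn : ¬ M.IsNeuRob Γ e) :
    M.kind Γ e = none := by
  unfold Mesh.IsNeuRob at hn
  unfold Mesh.IsDir at hd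
  generalize M.kind Γ e = k at *
  rcases k with _ | (_ | _ | _)
  · rfl
  · exact absurd rfl hd
  · exact absurd (Or.inl rfl) hn
  · exact absurd (Or.inr rfl) hn

theorem BoundedData.sum_sides_integral_matC (h : BoundedData M Γ A G T ϱ)
    {w : TraceSpace M Γ p b} {e : M.Mortar Γ} (hn : ¬ M.IsNeuRob Γ e)
    (hdir : M.IsDir Γ e → ∀ᵐ x ∂(surf d).restrict (M.carrier Γ e), tval w e x = 0) :
    ∑ s ∈ M.sides Γ e, ∫ x in M.carrier Γ e,
      (matC M A s x *ᵥ tval w e x) ⬝ᵥ tval w e x ∂(surf d) = 0 := by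
  have := M.isFiniteMeasure_carrier Γ e
  by_cases hd : M.IsDir Γ e
  · refine Finset.sum_eq_zero fun s _ => integral_eq_zero_of_ae ?_
    filter_upwards [hdir hd] with x hx
    simp [hx]
  rw [← integral_finsetSum _ fun s hs => ((h.mbdd_matC e hs).mulVec
    (vbdd_tval_carrier w e)).integrable_dot (vbdd_tval_carrier w e)]
  simp only [sum_sides_matC w (Mesh.kind_eq_none hd hn), integral_zero]

/-- Pointwise the four `B` terms cancel. For symmetric `C`, `Cu·(u - û) - ½ Cu·u = ½ C(u - û)·(u -
û) - ½ Cû·û`. The last term turns `ϱI + C` into `ϱI + ½C` on Neumann and Robin mortars, and its sum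
over the other mortars is zero. -/
theorem BoundedData.faceEnergy_identity (h : BoundedData M Γ A G T ϱ) {z : Triple M Γ p a b}
    (hC : ∀ (e : M.Mortar Γ), ∀ s ∈ M.sides Γ e,
      ∀ᵐ x ∂(surf d).restrict (M.carrier Γ e), (matC M A s x).IsSymm)
    (hdir : ∀ e : M.Mortar Γ, M.IsDir Γ e →
      ∀ᵐ x ∂(surf d).restrict (M.carrier Γ e), tval z.2.2 e x = 0) :
    bdSum M Γ (fun e s x => (matB M A s x *ᵥ tval z.2.2 e x) ⬝ᵥ vval z.1 s.1 x)
      + bdSum M Γ (fun e s x => fluxU A T z.1 z.2.1 z.2.2 e s x ⬝ᵥ vval z.2.1 s.1 x)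
      - bdSum M Γ (fun _ s x => (matB M A s x *ᵥ vval z.2.1 s.1 x) ⬝ᵥ vval z.1 s.1 x)
      - (1 / 2) * bdSum M Γ (fun _ s x => (matC M A s x *ᵥ vval z.2.1 s.1 x) ⬝ᵥ vval z.2.1 s.1 x)
      - bdSum M Γ (fun e s x => fluxU A T z.1 z.2.1 z.2.2 e s x ⬝ᵥ tval z.2.2 e x)
      + bdSum M Γ (robinTerm A ϱ 1 z.2.2)
    = bdSum M Γ (faceEnergy A T ϱ z) := by
  classical
  simp only [bdSum_eq]
  simp only [Finset.mul_sum, ← Finset.sum_add_distrib, ← Finset.sum_sub_distrib]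
  refine Finset.sum_congr rfl fun e _ => ?_
  have := M.isFiniteMeasure_carrier Γ e
  -- These terms are not zero side by side, only in the sum over the sides of the mortar; they are
  -- inserted here so that the remaining identity holds on each side separately.
  have hZ : ∑ s ∈ M.sides Γ e, ∫ x in M.carrier Γ e, (if M.IsNeuRob Γ e then 0 else
      (matC M A s x *ᵥ tval z.2.2 e x) ⬝ᵥ tval z.2.2 e x) ∂(surf d) = 0 := by
    by_cases he : M.IsNeuRob Γ e
    · simp [he]
    simp only [he, if_false]
    exact h.sum_sides_integral_matC he (hdir e)
  rw [← sub_zero (∑ s ∈ M.sides Γ e, ∫ x in M.carrier Γ e, faceEnergy A T ϱ z e s x ∂(surf d)),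
    ← mul_zero (1 / 2 : ℝ), ← hZ, Finset.mul_sum, ← Finset.sum_sub_distrib]
  refine Finset.sum_congr rfl fun s hs => ?_
  have hσ := vbdd_vval_carrier z.1 s.1 e
  have hu := vbdd_vval_carrier z.2.1 s.1 e
  have hw := vbdd_tval_carrier z.2.2 e
  have hBm := h.mbdd_matB e hs
  have hCm := h.mbdd_matC e hs
  have hfl := h.flux e hs z
  have i1 := (hBm.mulVec hw).integrable_dot hσ
  have i2 := hfl.integrable_dot hu
  have i3 := (hBm.mulVec hu).integrable_dot hσ
  have i4 := ((hCm.mulVec hu).integrable_dot hu).const_mul (1 / 2)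
  have i5 := hfl.integrable_dot hw
  have i6 := h.integrable_robinTerm 1 z.2.2 e hs
  have i7 := h.integrable_faceEnergy z e hs
  have i8 : Integrable (fun x => (1 / 2) * (if M.IsNeuRob Γ e then 0 else
      (matC M A s x *ᵥ tval z.2.2 e x) ⬝ᵥ tval z.2.2 e x)) ((surf d).restrict (M.carrier Γ e)) := by
    by_cases he : M.IsNeuRob Γ e
    · simp [he]
    · simp only [he, if_false]
      exact ((hCm.mulVec hw).integrable_dot hw).const_mul _
  rw [← integral_const_mul, ← integral_const_mul, ← integral_add' i1 i2,
    ← integral_sub' (i1.add i2) i3, ← integral_sub' ((i1.add i2).sub i3) i4,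
    ← integral_sub' (((i1.add i2).sub i3).sub i4) i5,
    ← integral_add' ((((i1.add i2).sub i3).sub i4).sub i5) i6, ← integral_sub' i7 i8]
  refine integral_congr_ae ?_
  filter_upwards [hC e s hs] with x hx
  simp only [Pi.add_apply, Pi.sub_apply, fluxU, faceEnergy, robinTerm, add_dotProduct,
    transpose_mulVec_dot, Matrix.add_mulVec, Matrix.smul_mulVec, Matrix.mulVec_sub,
    sub_dotProduct, dotProduct_sub, smul_dotProduct, Matrix.one_mulVec, smul_eq_mul]
  rw [symm_mulVec_dot hx (tval z.2.2 e x) (vval z.2.1 s.1 x)]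
  split_ifs <;> ring

end Energy

/-! ### Energy identity for the homogeneous problem and consequences of zero energy -/

section Coercivity

set_option linter.unusedSectionVars false

variable {d : ℕ} [NeZero d] {Ω : Set (Sp d)} {M : Mesh d Ω} {Γ : BdDecomp Ω} {a b : ℕ}
  {p : Fin M.N → ℕ} {n : ℕ}
  {A : Fin d → Sp d → BlockMat a b} {D G : Sp d → BlockMat a b}
  {T : M.Side → Sp d → Matrix (Fin b) (Fin b) ℝ} {ϱ : Sp d → ℝ}

theorem isSymm_toBlocks₂₂ {X : BlockMat a b} (hX : X.IsSymm) : X.toBlocks₂₂.IsSymm := by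
  ext i j
  exact congrFun (congrFun hX (.inr i)) (.inr j)

/-- Transposing `B_k` and splitting the symmetric `C_k` term into two halves gives complete
product-rule expressions, the form to which the Gauss-Green formula applies. -/
theorem BoundedData.sum_integral_derivatives (h : BoundedData M Γ A G T ϱ)
    (hΩr : interior (closure Ω) = Ω)
    (hsymm : ∀ k, ∀ᵐ x ∂volume.restrict Ω, (A k x).IsSymm) (z : Triple M Γ p a b) :
    (∑ k, ∑ i, ∫ x in M.K i, ((A k x).toBlocks₁₂ *ᵥ vval z.2.1 i x) ⬝ᵥ dval k z.1 i x)
      + (∑ k, ∑ i, ∫ x in M.K i,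
        ((A k x).toBlocks₁₂ᵀ *ᵥ vval z.1 i x + (A k x).toBlocks₂₂ *ᵥ vval z.2.1 i x)
          ⬝ᵥ dval k z.2.1 i x)
    = (∑ k, ∑ i, ∫ x in M.K i, (((A k x).toBlocks₁₂ *ᵥ vval z.2.1 i x) ⬝ᵥ dval k z.1 i x
      + ((A k x).toBlocks₁₂ *ᵥ dval k z.2.1 i x) ⬝ᵥ vval z.1 i x))
      + (1 / 2) * (∑ k, ∑ i, ∫ x in M.K i,
        (((A k x).toBlocks₂₂ *ᵥ vval z.2.1 i x) ⬝ᵥ dval k z.2.1 i x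
      + ((A k x).toBlocks₂₂ *ᵥ dval k z.2.1 i x) ⬝ᵥ vval z.2.1 i x)) := by
  simp only [Finset.mul_sum, ← Finset.sum_add_distrib]
  refine Finset.sum_congr rfl fun k _ => Finset.sum_congr rfl fun i _ => ?_
  have := M.isFiniteMeasure_K i
  have hσ := vbdd_vval_K z.1 i
  have hu := vbdd_vval_K z.2.1 i
  have hσ' := vbdd_dval_K k z.1 i
  have hu' := vbdd_dval_K k z.2.1 i
  obtain ⟨-, h12, -, h22⟩ := (h.bA i k).blocks
  have i1 := (h12.mulVec hu).integrable_dot hσ'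
  have i2 := ((h12.transpose.mulVec hσ).add (h22.mulVec hu)).integrable_dot hu'
  have i3 := (h12.mulVec hu').integrable_dot hσ
  have i4 := ((h22.mulVec hu).integrable_dot hu').add ((h22.mulVec hu').integrable_dot hu)
  have i5 := i4.const_mul (1 / 2)
  rw [← integral_const_mul, ← integral_add' i1 i2]
  refine Eq.trans ?_ (integral_add' (i1.add i3) i5)
  refine integral_congr_ae ?_
  filter_upwards [ae_K_of_ae hΩr i (hsymm k)] with x hx
  simp only [Pi.add_apply, add_dotProduct, transpose_mulVec_dot]
  rw [symm_mulVec_dot (isSymm_toBlocks₂₂ hx) (dval k z.2.1 i x)]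
  ring

/-- The energy identity of a solution of the homogeneous problem. -/
theorem BoundedData.energy_identity (h : BoundedData M Γ A G T ϱ)
    (hΩo : IsOpen Ω) (hΩr : interior (closure Ω) = Ω)
    (hcont : ContinuousAcrossSkeleton M Γ A) (hA : ∀ k, EssBounded (A k) (volume.restrict Ω))
    (hD : EssBounded D (volume.restrict Ω)) (hdiv : HasWeakDivergence Ω A D)
    (hsymm : ∀ k, ∀ᵐ x ∂volume.restrict Ω, (A k x).IsSymm)
    {B : Fin d → Matrix (Fin a) (Fin b) ℝ}
    (hB : ∀ k, ∀ᵐ x ∂volume.restrict Ω, (A k x).toBlocks₁₂ = B k)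
    {z : Triple M Γ p a b} (h1 : ∀ s, resσ A G z s = 0) (h2 : ∀ v, resu A G T z v = 0)
    (h3 : ∀ w, resGlobal A T ϱ z w = 0)
    (hdir : ∀ e : M.Mortar Γ, M.IsDir Γ e →
      ∀ᵐ x ∂(surf d).restrict (M.carrier Γ e), tval z.2.2 e x = 0) :
    (∑ i, ∫ x in M.K i, cellEnergy G D z i x) + bdSum M Γ (faceEnergy A T ϱ z) = 0 := by
  -- The two local equations are tested with `σ` and `u` and added; the conservation condition
  -- tested with `û` is subtracted.
  have e1 := h1 z.1
  have e2 := h2 z.2.1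
  have e3 := (h.resGlobal_self hdir).symm.trans (h3 z.2.2)
  have e4 := h.faceEnergy_identity (fun e s hs => ae_carrier_of_ae_face hs
    (ae_matC_isSymm hΩo hΩr hcont hsymm s)) hdir
  have e5 := gauss_green_B (p := p) hΩo hΩr hcont hA hB z.1 z.2.1
  have e6 := gauss_green_C (p := p) hΩo hΩr hcont hA hD hdiv z.2.1 z.2.1
  have e7 := h.sum_integral_derivatives hΩr hsymm z
  have e8 : (∑ i, ∫ x in M.K i, cellEnergy G D z i x)
      = (∑ i, ∫ x in M.K i,
        ((G x).toBlocks₁₁ *ᵥ vval z.1 i x + (G x).toBlocks₁₂ *ᵥ vval z.2.1 i x) ⬝ᵥ vval z.1 i x)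
      + (∑ i, ∫ x in M.K i,
        ((G x).toBlocks₂₁ *ᵥ vval z.1 i x + (G x).toBlocks₂₂ *ᵥ vval z.2.1 i x) ⬝ᵥ vval z.2.1 i x)
      + (1 / 2) * (∑ i, ∫ x in M.K i, ((D x).toBlocks₂₂ *ᵥ vval z.2.1 i x) ⬝ᵥ vval z.2.1 i x) := by
    simp only [Finset.mul_sum, ← Finset.sum_add_distrib]
    refine Finset.sum_congr rfl fun i _ => ?_
    have := M.isFiniteMeasure_K i
    have hσ := vbdd_vval_K z.1 i
    have hu := vbdd_vval_K z.2.1 i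
    have hG := (h.bG i).blocks
    have hD' := (mbdd_K hΩr i (F := D) hD).blocks.2.2.2
    have i1 := ((hG.1.mulVec hσ).add (hG.2.1.mulVec hu)).integrable_dot hσ
    have i2 := ((hG.2.2.1.mulVec hσ).add (hG.2.2.2.mulVec hu)).integrable_dot hu
    have i3 := ((hD'.mulVec hu).integrable_dot hu).const_mul (1 / 2)
    rw [← integral_const_mul, ← integral_add' i1 i2, ← integral_add' (i1.add i2) i3]
    rfl
  unfold resσ at e1
  unfold resu at e2
  rw [e8]
  linarith

/-- A vanishing sum of nonnegative integrals. -/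
theorem sum_integral_eq_zero {τ α : Type*} [MeasurableSpace α] (s : Finset τ)
    {ν : τ → Measure α} {f : τ → α → ℝ} (hf : ∀ i ∈ s, Integrable (f i) (ν i))
    (hnn : ∀ i ∈ s, ∀ᵐ x ∂ν i, 0 ≤ f i x) (h : ∑ i ∈ s, ∫ x, f i x ∂ν i ≤ 0) :
    ∀ i ∈ s, ∀ᵐ x ∂ν i, f i x = 0 := by
  intro i hi
  have h0 : ∑ i ∈ s, ∫ x, f i x ∂ν i = 0 :=
    le_antisymm h (Finset.sum_nonneg fun i hi => integral_nonneg_of_ae (hnn i hi))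
  rw [Finset.sum_eq_zero_iff_of_nonneg fun i hi => integral_nonneg_of_ae (hnn i hi)] at h0
  exact (integral_eq_zero_iff_of_nonneg_ae (hnn i hi) (hf i hi)).mp (h0 i hi)

/-- The quadratic form of the lower diagonal block. -/
theorem dot_block₂₂ (X : BlockMat a b) (v : Fin b → ℝ) :
    Sum.elim (0 : Fin a → ℝ) v ⬝ᵥ (X *ᵥ Sum.elim 0 v) = v ⬝ᵥ (X.toBlocks₂₂ *ᵥ v) := by
  conv_lhs => rw [← Matrix.fromBlocks_toBlocks X]
  rw [Matrix.fromBlocks_mulVec, sumElim_dotProduct_sumElim]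
  have h0 : (Sum.elim (0 : Fin a → ℝ) v) ∘ Sum.inl = 0 := rfl
  have h1 : (Sum.elim (0 : Fin a → ℝ) v) ∘ Sum.inr = v := rfl
  rw [h0, h1]
  simp

theorem matGE_block₂₂ {X : BlockMat a b} {Y : Matrix (Fin a) (Fin a) ℝ}
    (h : MatGE X (Matrix.fromBlocks Y 0 0 0)) (v : Fin b → ℝ) :
    0 ≤ v ⬝ᵥ (X.toBlocks₂₂ *ᵥ v) := by
  have h1 := h (Sum.elim 0 v)
  rw [dot_block₂₂, dot_block₂₂] at h1
  simpa using h1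

theorem matGE_block₂₂_zero {X : BlockMat a b} (h : MatGE X 0) (v : Fin b → ℝ) :
    0 ≤ v ⬝ᵥ (X.toBlocks₂₂ *ᵥ v) :=
  matGE_block₂₂ (Y := 0) (by rwa [Matrix.fromBlocks_zero]) v

/-- With the off-diagonal blocks of `G` zero, the density splits into a `σ` part, bounded below
through `G^{σσ}`, and a `u` part. The latter is exactly half of the form on the left, since a matrix
and its transpose have the same quadratic form. -/
theorem cellEnergy_ge {z : Triple M Γ p a b} {i : Fin M.N} {x : Sp d} {k₀ : ℝ}
    (h1 : (G x).toBlocks₁₂ = 0 ∧ (G x).toBlocks₂₁ = 0)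
    (h2 : MatGE (G x).toBlocks₁₁ (k₀ • (1 : Matrix (Fin a) (Fin a) ℝ))) :
    k₀ * (vval z.1 i x ⬝ᵥ vval z.1 i x)
      + (1 / 2) * (vval z.2.1 i x ⬝ᵥ ((G x + (G x)ᵀ + D x).toBlocks₂₂ *ᵥ vval z.2.1 i x))
      ≤ cellEnergy G D z i x := by
  have h3 := h2 (vval z.1 i x)
  have h4 : (G x + (G x)ᵀ + D x).toBlocks₂₂
      = (G x).toBlocks₂₂ + (G x).toBlocks₂₂ᵀ + (D x).toBlocks₂₂ := rfl
  rw [Matrix.smul_mulVec, Matrix.one_mulVec, dotProduct_smul, smul_eq_mul] at h3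
  unfold cellEnergy
  rw [h1.1, h1.2, h4, Matrix.add_mulVec, Matrix.add_mulVec, dotProduct_add, dotProduct_add]
  have h5 : vval z.2.1 i x ⬝ᵥ ((G x).toBlocks₂₂ᵀ *ᵥ vval z.2.1 i x)
      = vval z.2.1 i x ⬝ᵥ ((G x).toBlocks₂₂ *ᵥ vval z.2.1 i x) := by
    rw [dotProduct_comm, transpose_mulVec_dot, dotProduct_comm]
  simp only [Matrix.zero_mulVec, add_zero, zero_add, h5]
  rw [dotProduct_comm ((G x).toBlocks₁₁ *ᵥ _), dotProduct_comm ((G x).toBlocks₂₂ *ᵥ _),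
    dotProduct_comm ((D x).toBlocks₂₂ *ᵥ _)]
  linarith

theorem robinTerm_half (w : TraceSpace M Γ p b) {e : M.Mortar Γ} (he : M.IsNeuRob Γ e)
    (s : M.Side) (x : Sp d) : robinTerm A ϱ (1 / 2) w e s x
      = (1 / 2) * (tval w e x ⬝ᵥ (((2 * ϱ x) • (1 : Matrix (Fin b) (Fin b) ℝ) + matC M A s x)
        *ᵥ tval w e x)) := by
  simp only [robinTerm, he, if_true, Matrix.add_mulVec, Matrix.smul_mulVec, Matrix.one_mulVec,
    add_dotProduct, dotProduct_add, smul_dotProduct, dotProduct_smul, smul_eq_mul]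
  rw [dotProduct_comm (tval w e x) (matC M A s x *ᵥ tval w e x)]
  ring

theorem matPos_dot_nonneg {ι : Type*} [Fintype ι] {X : Matrix ι ι ℝ} (hX : MatPos X) (v : ι → ℝ) :
    0 ≤ (X *ᵥ v) ⬝ᵥ v := by
  rw [dotProduct_comm]
  by_cases hv : v = 0
  · simp [hv]
  · exact (hX v hv).le

theorem eq_zero_of_matPos_dot {ι : Type*} [Fintype ι] {X : Matrix ι ι ℝ} (hX : MatPos X)
    {v : ι → ℝ} (h : (X *ᵥ v) ⬝ᵥ v = 0) : v = 0 := by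
  by_contra hv
  have := hX v hv
  rw [dotProduct_comm] at this
  exact this.ne' h

/-- Evaluating the boundary operator at vectors with zero `σ` component removes the `B` blocks and
leaves `2ϱI + C`, whose form is twice that of the boundary term. -/
theorem ae_robinTerm_nonneg (hM : BdOperatorNonneg M Γ A ϱ) (w : TraceSpace M Γ p b)
    (e : M.Mortar Γ) {s : M.Side} (hs : s ∈ M.sides Γ e) :
    ∀ᵐ x ∂(surf d).restrict (M.carrier Γ e), 0 ≤ robinTerm A ϱ (1 / 2) w e s x := by
  by_cases he : M.IsNeuRob Γ e
  · filter_upwards [hM e s hs] with x hx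
    rw [robinTerm_half w he]
    have := matGE_block₂₂_zero (hx.2 he) (tval w e x)
    rw [bdOperator, Matrix.toBlocks_fromBlocks₂₂] at this
    positivity
  · exact Eventually.of_forall fun x => by simp [robinTerm, he]

/-- The consequences of a vanishing energy. -/
theorem BoundedData.of_energy_eq_zero (h : BoundedData M Γ A G T ϱ)
    (hΩr : interior (closure Ω) = Ω) (hD : EssBounded D (volume.restrict Ω))
    (hA4a : ∃ μ₀ : ℝ, 0 < μ₀ ∧ ∀ᵐ x ∂volume.restrict Ω,
      MatGE (G x + (G x)ᵀ + D x) ((2 * μ₀) • Matrix.fromBlocks 1 0 0 0))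
    (hA4b : ∀ᵐ x ∂volume.restrict Ω, (G x).toBlocks₁₂ = 0 ∧ (G x).toBlocks₂₁ = 0)
    (hA6 : ∃ k₀ : ℝ, 0 < k₀ ∧ ∀ᵐ x ∂volume.restrict Ω,
      MatGE (G x).toBlocks₁₁ (k₀ • (1 : Matrix (Fin a) (Fin a) ℝ)))
    (hM : BdOperatorNonneg M Γ A ϱ)
    (hCT : ∀ e : M.Mortar Γ, ∀ s ∈ M.sides Γ e, ∀ᵐ x ∂(surf d).restrict (M.carrier Γ e),
      MatPos ((1 / 2 : ℝ) • matC M A s x + T s x))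
    {z : Triple M Γ p a b}
    (hz : (∑ i, ∫ x in M.K i, cellEnergy G D z i x) + bdSum M Γ (faceEnergy A T ϱ z) = 0) :
    (∀ i, ∀ᵐ x ∂volume.restrict (M.K i), vval z.1 i x = 0 ∧
      vval z.2.1 i x ⬝ᵥ ((G x + (G x)ᵀ + D x).toBlocks₂₂ *ᵥ vval z.2.1 i x) = 0) ∧
    ∀ e : M.Mortar Γ, ∀ s ∈ M.sides Γ e, ∀ᵐ x ∂(surf d).restrict (M.carrier Γ e),
      vval z.2.1 s.1 x = tval z.2.2 e x ∧ (M.IsNeuRob Γ e → tval z.2.2 e x ⬝ᵥ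
        (((2 * ϱ x) • (1 : Matrix (Fin b) (Fin b) ℝ) + matC M A s x) *ᵥ tval z.2.2 e x) = 0) := by
  obtain ⟨μ₀, hμ, h4a⟩ := hA4a
  obtain ⟨k₀, hk, h6⟩ := hA6
  have hge : ∀ i, ∀ᵐ x ∂volume.restrict (M.K i),
      0 ≤ vval z.1 i x ⬝ᵥ vval z.1 i x ∧
      0 ≤ vval z.2.1 i x ⬝ᵥ ((G x + (G x)ᵀ + D x).toBlocks₂₂ *ᵥ vval z.2.1 i x) ∧
      k₀ * (vval z.1 i x ⬝ᵥ vval z.1 i x)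
      + (1 / 2) * (vval z.2.1 i x ⬝ᵥ ((G x + (G x)ᵀ + D x).toBlocks₂₂ *ᵥ vval z.2.1 i x))
      ≤ cellEnergy G D z i x := fun i => by
    filter_upwards [ae_K_of_ae hΩr i h4a, ae_K_of_ae hΩr i hA4b, ae_K_of_ae hΩr i h6]
      with x h1 h2 h3
    refine ⟨Finset.sum_nonneg fun j _ => mul_self_nonneg _, ?_, cellEnergy_ge h2 h3⟩
    rw [Matrix.fromBlocks_smul, smul_zero, smul_zero, smul_zero] at h1
    exact matGE_block₂₂ h1 _
  have hcell : ∀ i, ∀ᵐ x ∂volume.restrict (M.K i), 0 ≤ cellEnergy G D z i x := fun i => by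
    filter_upwards [hge i] with x hx
    refine le_trans ?_ hx.2.2
    have := hx.1
    have := hx.2.1
    positivity
  have hpos : ∀ e : M.Mortar Γ, ∀ s ∈ M.sides Γ e, ∀ᵐ x ∂(surf d).restrict (M.carrier Γ e),
      0 ≤ (((1 / 2 : ℝ) • matC M A s x + T s x) *ᵥ (vval z.2.1 s.1 x - tval z.2.2 e x))
      ⬝ᵥ (vval z.2.1 s.1 x - tval z.2.2 e x) ∧ 0 ≤ robinTerm A ϱ (1 / 2) z.2.2 e s x :=
    fun e s hs => by
      filter_upwards [hCT e s hs, ae_robinTerm_nonneg hM z.2.2 e hs] with x h1 h2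
      exact ⟨matPos_dot_nonneg h1 _, h2⟩
  have hface : ∀ e : M.Mortar Γ, ∀ s ∈ M.sides Γ e, ∀ᵐ x ∂(surf d).restrict (M.carrier Γ e),
      0 ≤ faceEnergy A T ϱ z e s x := fun e s hs => by
    filter_upwards [hpos e s hs] with x hx
    exact add_nonneg hx.1 hx.2
  have hc0 : 0 ≤ ∑ i, ∫ x in M.K i, cellEnergy G D z i x :=
    Finset.sum_nonneg fun i _ => integral_nonneg_of_ae (hcell i)
  have hf0 : ∀ e : M.Mortar Γ, 0 ≤ ∑ s ∈ M.sides Γ e, ∫ x in M.carrier Γ e,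
      faceEnergy A T ϱ z e s x ∂(surf d) := fun e =>
    Finset.sum_nonneg fun s hs => integral_nonneg_of_ae (hface e s hs)
  rw [bdSum_eq] at hz
  have hb0 := Finset.sum_nonneg fun e (_ : e ∈ Finset.univ) => hf0 e
  refine ⟨fun i => ?_, fun e s hs => ?_⟩
  · have h1 := sum_integral_eq_zero Finset.univ
      (fun i _ => h.integrable_cellEnergy (fun i => mbdd_K hΩr i hD) z i)
      (fun i _ => hcell i) (by linarith) i (Finset.mem_univ i)
    filter_upwards [hge i, h1] with x ⟨g1, g2, g3⟩ hx
    have h2 : 0 ≤ k₀ * (vval z.1 i x ⬝ᵥ vval z.1 i x) := by positivity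
    have h3 : k₀ * (vval z.1 i x ⬝ᵥ vval z.1 i x) = 0 := by linarith
    exact ⟨dotProduct_self_eq_zero.mp ((mul_eq_zero.mp h3).resolve_left hk.ne'), by linarith⟩
  · have h0 := (Finset.sum_eq_zero_iff_of_nonneg fun e _ => hf0 e).mp (by linarith) e
      (Finset.mem_univ e)
    have h1 := sum_integral_eq_zero (M.sides Γ e) (fun s hs => h.integrable_faceEnergy z e hs)
      (fun s hs => hface e s hs) h0.le s hs
    filter_upwards [h1, hpos e s hs, hCT e s hs] with x hx ⟨g1, g2⟩ g3
    unfold faceEnergy at hx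
    refine ⟨sub_eq_zero.mp (eq_zero_of_matPos_dot g3 (by linarith)), fun he => ?_⟩
    have h4 : robinTerm A ϱ (1 / 2) z.2.2 e s x = 0 := by linarith
    rw [robinTerm_half z.2.2 he] at h4
    linarith

end Coercivity

/-! ### Uniqueness -/

section Uniqueness

set_option linter.unusedSectionVars false

variable {d : ℕ} [NeZero d] {Ω : Set (Sp d)} {M : Mesh d Ω} {Γ : BdDecomp Ω} {a b : ℕ}
  {p : Fin M.N → ℕ} {n : ℕ}
  {A : Fin d → Sp d → BlockMat a b} {D G : Sp d → BlockMat a b}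
  {T : M.Side → Sp d → Matrix (Fin b) (Fin b) ℝ} {ϱ : Sp d → ℝ}

theorem Mesh.nonempty_K (i : Fin M.N) : (M.K i).Nonempty := nonempty_interior _

theorem VolSpace.eq_zero_of_ae {w : VolSpace M p n} {i : Fin M.N}
    (h : ∀ᵐ x ∂volume.restrict (M.K i), vval w i x = 0) : w i = 0 := by
  funext j
  refine Subtype.ext (eq_zero_of_pval_ae (M.isOpen_K i) (Mesh.nonempty_K i) ?_)
  filter_upwards [h] with x hx
  exact congrFun hx j

theorem TraceSpace.eq_zero_of_ae {w : TraceSpace M Γ p n} {e : M.Mortar Γ}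
    (h : ∀ᵐ x ∂(surf d).restrict (M.carrier Γ e), tval w e x = 0) : w e = 0 := by
  obtain ⟨s, hs⟩ := M.exists_side Γ e
  funext j
  refine polyOn_eq_zero (norm_outNormal (M.elem s.1) s.2) _ ((M.carrier_subset_face Γ hs).trans
    (face_subset_hyperplane (M.elem s.1) s.2)) (M.measurableSet_carrier Γ e)
    (M.surf_carrier_pos Γ e) _ ?_
  filter_upwards [h] with x hx
  exact congrFun hx j

/-- The function `∑_k B_k ∂_k u`. -/
def gradB (B : Fin d → Matrix (Fin a) (Fin b) ℝ) (u : VolSpace M p b) : VolSpace M p a :=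
  fun i r => ∑ k, ∑ c, B k r c • (⟨MvPolynomial.pderiv k (u i c : MvPolynomial (Fin d) ℝ),
    pderiv_mem_restrictTotalDegree (u i c).2 k⟩ : MvPolynomial.restrictTotalDegree (Fin d) ℝ (p i))

theorem vval_gradB (B : Fin d → Matrix (Fin a) (Fin b) ℝ) (u : VolSpace M p b) (i : Fin M.N)
    (x : Sp d) : vval (gradB B u) i x = ∑ k, B k *ᵥ dval k u i x := by
  funext r
  simp only [vval, gradB, Finset.sum_apply, Matrix.mulVec, dotProduct, dval,
    AddSubmonoidClass.coe_finsetSum, Submodule.coe_smul, pval_sum, pval_smul]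

/-- With `σ = 0` and `û = u` on the element boundaries, the boundary term of the first equation is
the one in the Gauss-Green formula, so `∑_k B_k ∂_k u` is orthogonal to every test function. Testing
with this function itself shows that it vanishes. Independence of the ranges kills each `B_k ∂_k u`,
and trivial kernels kill each `∂_k u`. -/
theorem BoundedData.dval_eq_zero (h : BoundedData M Γ A G T ϱ)
    (hΩo : IsOpen Ω) (hΩr : interior (closure Ω) = Ω)
    (hcont : ContinuousAcrossSkeleton M Γ A) (hA : ∀ k, EssBounded (A k) (volume.restrict Ω))
    (hA4b : ∀ᵐ x ∂volume.restrict Ω, (G x).toBlocks₁₂ = 0 ∧ (G x).toBlocks₂₁ = 0)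
    {B : Fin d → Matrix (Fin a) (Fin b) ℝ}
    (hB : ∀ k, ∀ᵐ x ∂volume.restrict Ω, (A k x).toBlocks₁₂ = B k)
    (hrange : RangesIndependent B) (hnull : ∀ k, LinearMap.ker (B k).mulVecLin = ⊥)
    {z : Triple M Γ p a b} (h1 : ∀ s, resσ A G z s = 0)
    (hσ : ∀ i, ∀ᵐ x ∂volume.restrict (M.K i), vval z.1 i x = 0)
    (hu : ∀ e : M.Mortar Γ, ∀ s ∈ M.sides Γ e, ∀ᵐ x ∂(surf d).restrict (M.carrier Γ e),
      vval z.2.1 s.1 x = tval z.2.2 e x) (k : Fin d) (i : Fin M.N) (x : Sp d) :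
    dval k z.2.1 i x = 0 := by
  set w := gradB B z.2.1 with hw
  have hG0 : (∑ i, ∫ x in M.K i,
      ((G x).toBlocks₁₁ *ᵥ vval z.1 i x + (G x).toBlocks₁₂ *ᵥ vval z.2.1 i x) ⬝ᵥ vval w i x)
      = 0 := by
    refine Finset.sum_eq_zero fun i _ => integral_eq_zero_of_ae ?_
    filter_upwards [hσ i, ae_K_of_ae hΩr i hA4b] with x hx hx'
    simp [hx, hx'.1]
  have hbd : bdSum M Γ (fun e t x => (matB M A t x *ᵥ tval z.2.2 e x) ⬝ᵥ vval w t.1 x)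
      = bdSum M Γ (fun _ s x => (matB M A s x *ᵥ vval z.2.1 s.1 x) ⬝ᵥ vval w s.1 x) := by
    simp only [bdSum_eq]
    refine Finset.sum_congr rfl fun e _ => Finset.sum_congr rfl fun s hs => integral_congr_ae ?_
    filter_upwards [hu e s hs] with x hx
    rw [hx]
  have hgg := gauss_green_B (p := p) hΩo hΩr hcont hA hB w z.2.1
  have hsplit : (∑ k, ∑ i, ∫ x in M.K i, (((A k x).toBlocks₁₂ *ᵥ vval z.2.1 i x) ⬝ᵥ dval k w i x
      + ((A k x).toBlocks₁₂ *ᵥ dval k z.2.1 i x) ⬝ᵥ vval w i x))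
      = (∑ k, ∑ i, ∫ x in M.K i, ((A k x).toBlocks₁₂ *ᵥ vval z.2.1 i x) ⬝ᵥ dval k w i x)
        + ∑ i, ∫ x in M.K i, vval w i x ⬝ᵥ vval w i x := by
    have hi1 : ∀ k i, Integrable (fun x => ((A k x).toBlocks₁₂ *ᵥ vval z.2.1 i x) ⬝ᵥ dval k w i x)
        (volume.restrict (M.K i)) := fun k i => by
      have := M.isFiniteMeasure_K i
      exact ((h.bA i k).blocks.2.1.mulVec (vbdd_vval_K z.2.1 i)).integrable_dot (vbdd_dval_K k w i)
    have hi2 : ∀ k i, Integrable (fun x => ((A k x).toBlocks₁₂ *ᵥ dval k z.2.1 i x) ⬝ᵥ vval w i x)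
        (volume.restrict (M.K i)) := fun k i => by
      have := M.isFiniteMeasure_K i
      exact ((h.bA i k).blocks.2.1.mulVec (vbdd_dval_K k z.2.1 i)).integrable_dot (vbdd_vval_K w i)
    have hadd : ∀ k i, (∫ x in M.K i, (((A k x).toBlocks₁₂ *ᵥ vval z.2.1 i x) ⬝ᵥ dval k w i x
      + ((A k x).toBlocks₁₂ *ᵥ dval k z.2.1 i x) ⬝ᵥ vval w i x))
      = (∫ x in M.K i, ((A k x).toBlocks₁₂ *ᵥ vval z.2.1 i x) ⬝ᵥ dval k w i x)
        + ∫ x in M.K i, ((A k x).toBlocks₁₂ *ᵥ dval k z.2.1 i x) ⬝ᵥ vval w i x := fun k i =>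
      integral_add (hi1 k i) (hi2 k i)
    simp only [hadd, Finset.sum_add_distrib]
    congr 1
    rw [Finset.sum_comm]
    refine Finset.sum_congr rfl fun i _ => ?_
    rw [← integral_finsetSum _ fun k _ => hi2 k i]
    refine integral_congr_ae ?_
    filter_upwards [eventually_all.mpr fun k => ae_K_of_ae hΩr i (hB k)] with x hx
    simp only [hx]
    rw [← sum_dotProduct, ← vval_gradB]
  have hzero : ∑ i, ∫ x in M.K i, vval w i x ⬝ᵥ vval w i x = 0 := by
    have := h1 w
    unfold resσ at this
    rw [hG0, hbd, ← hgg, hsplit] at this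
    linarith
  have hae := sum_integral_eq_zero Finset.univ
    (ν := fun i => volume.restrict (M.K i)) (f := fun i x => vval w i x ⬝ᵥ vval w i x)
    (fun i _ => by
      have := M.isFiniteMeasure_K i
      exact (vbdd_vval_K w i).integrable_dot (vbdd_vval_K w i))
    (fun i _ => Eventually.of_forall fun x => Finset.sum_nonneg fun j _ => mul_self_nonneg _)
    hzero.le i (Finset.mem_univ i)
  have hwi : w i = 0 := VolSpace.eq_zero_of_ae (by
    filter_upwards [hae] with x hx using dotProduct_self_eq_zero.mp hx)
  have hsum : ∑ k, B k *ᵥ dval k z.2.1 i x = 0 := by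
    rw [← vval_gradB, ← hw]
    funext j
    simp [vval, hwi, pval_zero]
  have hk := hrange.eq_zero (fun k => dval k z.2.1 i x) hsum k
  have : dval k z.2.1 i x ∈ LinearMap.ker (B k).mulVecLin := by simpa using hk
  rwa [hnull k, Submodule.mem_bot] at this

/-- The homogeneous problem has only the trivial solution. -/
theorem BoundedData.eq_zero (h : BoundedData M Γ A G T ϱ)
    (hΩo : IsOpen Ω) (hΩc : IsConnected Ω) (hΩr : interior (closure Ω) = Ω)
    (hcont : ContinuousAcrossSkeleton M Γ A) (hA : ∀ k, EssBounded (A k) (volume.restrict Ω))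
    (hD : EssBounded D (volume.restrict Ω)) (hdiv : HasWeakDivergence Ω A D)
    (hsymm : ∀ k, ∀ᵐ x ∂volume.restrict Ω, (A k x).IsSymm)
    (hA4a : ∃ μ₀ : ℝ, 0 < μ₀ ∧ ∀ᵐ x ∂volume.restrict Ω,
      MatGE (G x + (G x)ᵀ + D x) ((2 * μ₀) • Matrix.fromBlocks 1 0 0 0))
    (hA4b : ∀ᵐ x ∂volume.restrict Ω, (G x).toBlocks₁₂ = 0 ∧ (G x).toBlocks₂₁ = 0)
    {B : Fin d → Matrix (Fin a) (Fin b) ℝ}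
    (hB : ∀ k, ∀ᵐ x ∂volume.restrict Ω, (A k x).toBlocks₁₂ = B k)
    (hA6 : ∃ k₀ : ℝ, 0 < k₀ ∧ ∀ᵐ x ∂volume.restrict Ω,
      MatGE (G x).toBlocks₁₁ (k₀ • (1 : Matrix (Fin a) (Fin a) ℝ)))
    (hM : BdOperatorNonneg M Γ A ϱ) (hconst : ConstantsControlled M Γ A D G ϱ)
    (hCT : ∀ e : M.Mortar Γ, ∀ s ∈ M.sides Γ e, ∀ᵐ x ∂(surf d).restrict (M.carrier Γ e),
      MatPos ((1 / 2 : ℝ) • matC M A s x + T s x))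
    (hrange : RangesIndependent B) (hnull : ∀ k, LinearMap.ker (B k).mulVecLin = ⊥)
    {z : Triple M Γ p a b} (h1 : ∀ s, resσ A G z s = 0) (h2 : ∀ v, resu A G T z v = 0)
    (h3 : ∀ w, resGlobal A T ϱ z w = 0) (h4 : ∀ w, resDir z w = 0) : z = 0 := by
  have hdir : ∀ e : M.Mortar Γ, M.IsDir Γ e →
      ∀ᵐ x ∂(surf d).restrict (M.carrier Γ e), tval z.2.2 e x = 0 :=
    fun e he => tval_eq_zero_of_resDir h4 he
  obtain ⟨hcell, hface⟩ := h.of_energy_eq_zero hΩr hD hA4a hA4b hA6 hM hCT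
    (h.energy_identity hΩo hΩr hcont hA hD hdiv hsymm hB h1 h2 h3 hdir)
  have hdu := h.dval_eq_zero hΩo hΩr hcont hA hA4b hB hrange hnull h1
    (fun i => (hcell i).mono fun x hx => hx.1) fun e s hs => (hface e s hs).mono fun x hx => hx.1
  have hval : ∀ i x, vval z.2.1 i x = vval z.2.1 i 0 := fun i x => by
    funext j
    exact pval_const (fun k y => congrFun (hdu k i y) j) x 0
  have hne : ∀ e : M.Mortar Γ, (ae ((surf d).restrict (M.carrier Γ e))).NeBot := fun e => by
    rw [ae_neBot, Ne, Measure.restrict_eq_zero]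
    exact (M.surf_carrier_pos Γ e).ne'
  -- A mortar has positive measure, so at some point of it the values of `u` from both sides equal
  -- the single value of `û`.
  have hglob : ∀ i i', vval z.2.1 i 0 = vval z.2.1 i' 0 := by
    refine M.eq_of_eq_across_mortars hΩo hΩc hΩr (fun i => vval z.2.1 i 0) fun q => ?_
    have := hne (.inl q)
    obtain ⟨x, hx1, hx2⟩ := ((hface (.inl q) q.1.1 (by simp [Mesh.sides])).and
      (hface (.inl q) q.1.2 (by simp [Mesh.sides]))).exists
    rw [← hval _ x, hx1.1, ← hx2.1, hval]
  obtain ⟨c, hc⟩ : ∃ c : Fin b → ℝ, ∀ i x, vval z.2.1 i x = c := by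
    rcases isEmpty_or_nonempty (Fin M.N) with hN | ⟨⟨i₀⟩⟩
    · exact ⟨0, fun i => hN.elim i⟩
    · exact ⟨vval z.2.1 i₀ 0, fun i x => (hval i x).trans (hglob i i₀)⟩
  have htr : ∀ e : M.Mortar Γ, ∀ᵐ x ∂(surf d).restrict (M.carrier Γ e), tval z.2.2 e x = c :=
    fun e => by
      obtain ⟨s, hs⟩ := M.exists_side Γ e
      filter_upwards [hface e s hs] with x hx
      rw [← hx.1, hc]
  -- If the Dirichlet part has positive measure, it carries a mortar, where `û` equals both `c` and
  -- 0. Otherwise the two quadratic forms that vanish with the energy are exactly those that control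
  -- constants.
  have hc0 : c = 0 := by
    rcases hconst with hD0 | hcc
    · obtain ⟨q, hq⟩ := M.exists_bdMortar Γ hΩo hΩr hD0
      have := hne (.inr q)
      obtain ⟨x, hx1, hx2⟩ := ((htr (.inr q)).and (hdir (.inr q) (congrArg some hq))).exists
      rw [← hx1, hx2]
    · refine hcc c ?_ fun e he s hs => ?_
      · have hall : ∀ i, ∀ᵐ x ∂volume.restrict Ω, x ∈ M.K i →
            c ⬝ᵥ ((G x + (G x)ᵀ + D x).toBlocks₂₂ *ᵥ c) = 0 := fun i => by
          have h5 := hcell i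
          rw [ae_restrict_iff' (M.isOpen_K i).measurableSet] at h5
          refine ae_restrict_of_ae ?_
          filter_upwards [h5] with x hx hxi
          have h6 := (hx hxi).2
          rwa [hc] at h6
        filter_upwards [eventually_all.mpr hall, M.ae_exists_K hΩo] with x hx ⟨i, hi⟩
        exact hx i hi
      · filter_upwards [hface e s hs, htr e] with x hx hx'
        have h6 := hx.2 he
        rwa [hx'] at h6
  have e1 : z.1 = 0 := funext fun i => VolSpace.eq_zero_of_ae ((hcell i).mono fun x hx => hx.1)
  have e2 : z.2.1 = 0 := funext fun i => VolSpace.eq_zero_of_ae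
    (Eventually.of_forall fun x => (hc i x).trans hc0)
  have e3 : z.2.2 = 0 := funext fun e => TraceSpace.eq_zero_of_ae
    ((htr e).mono fun x hx => hx.trans hc0)
  exact Prod.ext e1 (Prod.ext e2 e3)

theorem boundedData (hΩo : IsOpen Ω) (hΩr : interior (closure Ω) = Ω)
    (hT : ∀ e : M.Mortar Γ, ∀ s ∈ M.sides Γ e,
      EssBounded (T s) ((surf d).restrict (M.carrier Γ e)))
    (hϱ : MemLp ϱ ⊤ ((surf d).restrict (Γ.part .neumann ∪ Γ.part .robin)))
    (hG : EssBounded G (volume.restrict Ω)) (hA : ∀ k, EssBounded (A k) (volume.restrict Ω))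
    (hcont : ContinuousAcrossSkeleton M Γ A) : BoundedData M Γ A G T ϱ where
  bA i k := mbdd_K hΩr i (hA k)
  bG i := mbdd_K hΩr i hG
  bN e s hs := mbdd_normalMat_carrier hΩo hΩr hcont hA hs
  bT := hT
  bϱ e he := by
    refine hϱ.mono_measure (Measure.restrict_mono ?_ le_rfl)
    match e, he with
    | .inr q, he =>
      intro x hx
      have hx2 : x ∈ Γ.part q.1.2 := hx.2
      rcases he with he | he
      · exact Or.inl (by rwa [Option.some.inj he] at hx2)
      · exact Or.inr (by rwa [Option.some.inj he] at hx2)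

end Uniqueness

end HDG

end

/-! ### Well-posedness of the scheme -/

theorem mainTheorem3 {d a b : ℕ} [NeZero d] (hd : 2 ≤ d)
    -- the domain
    (Ω : Set (HDG.Sp d)) (hΩo : IsOpen Ω) (hΩc : IsConnected Ω)
    (hΩr : interior (closure Ω) = Ω)
    -- mesh, boundary decomposition, polynomial degrees
    (M : HDG.Mesh d Ω) (Γ : HDG.BdDecomp Ω) (p : Fin M.N → ℕ)
    -- coefficients, stabilisation matrix, boundary parameter, data
    (A : Fin d → HDG.Sp d → HDG.BlockMat a b) (D G : HDG.Sp d → HDG.BlockMat a b)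
    (T : M.Side → HDG.Sp d → Matrix (Fin b) (Fin b) ℝ) (ϱ : HDG.Sp d → ℝ)
    (fσ : HDG.Sp d → Fin a → ℝ) (fu : HDG.Sp d → Fin b → ℝ)
    (hT : ∀ e : M.Mortar Γ, ∀ s ∈ M.sides Γ e,
      HDG.EssBounded (T s) ((HDG.surf d).restrict (M.carrier Γ e)))
    (hϱ : MemLp ϱ ⊤ ((HDG.surf d).restrict (Γ.part .neumann ∪ Γ.part .robin)))
    (hfσ : ∀ j, MemLp (fun x => fσ x j) 2 (volume.restrict Ω))
    (hfu : ∀ j, MemLp (fun x => fu x j) 2 (volume.restrict Ω))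
    -- (A1) to (A3), and continuity of the normal coefficient across the skeleton
    (hG : HDG.EssBounded G (volume.restrict Ω))
    (hA : ∀ k, HDG.EssBounded (A k) (volume.restrict Ω))
    (hD : HDG.EssBounded D (volume.restrict Ω))
    (hdiv : HDG.HasWeakDivergence Ω A D)
    (hsymm : ∀ k, ∀ᵐ x ∂volume.restrict Ω, (A k x).IsSymm)
    (hcont : HDG.ContinuousAcrossSkeleton M Γ A)
    -- (A4a), (A4b): partial coercivity
    (hA4a : ∃ μ₀ : ℝ, 0 < μ₀ ∧ ∀ᵐ x ∂volume.restrict Ω,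
      HDG.MatGE (G x + (G x)ᵀ + D x) ((2 * μ₀) • Matrix.fromBlocks 1 0 0 0))
    (hA4b : ∀ᵐ x ∂volume.restrict Ω, (G x).toBlocks₁₂ = 0 ∧ (G x).toBlocks₂₁ = 0)
    (B : Fin d → Matrix (Fin a) (Fin b) ℝ)
    (hB : ∀ k, ∀ᵐ x ∂volume.restrict Ω, (A k x).toBlocks₁₂ = B k)
    -- (A5), (A6): two-field structure
    (hA5 : ∀ k, ∀ᵐ x ∂volume.restrict Ω, (A k x).toBlocks₁₁ = 0)
    (hA6 : ∃ k₀ : ℝ, 0 < k₀ ∧ ∀ᵐ x ∂volume.restrict Ω,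
      HDG.MatGE (G x).toBlocks₁₁ (k₀ • (1 : Matrix (Fin a) (Fin a) ℝ)))
    -- nonnegative boundary operator; constants are controlled
    (hM : HDG.BdOperatorNonneg M Γ A ϱ)
    (hconst : HDG.ConstantsControlled M Γ A D G ϱ)
    -- positivity of the stabilisation
    (hCT : ∀ e : M.Mortar Γ, ∀ s ∈ M.sides Γ e,
      ∀ᵐ x ∂(HDG.surf d).restrict (M.carrier Γ e),
        HDG.MatPos ((1 / 2 : ℝ) • HDG.matC M A s x + T s x))
    -- ranges and null spaces
    (hrange : HDG.RangesIndependent B)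
    (hnull : ∀ k, LinearMap.ker (B k).mulVecLin = ⊥) :
    ∃! z : HDG.VolSpace M p a × HDG.VolSpace M p b × HDG.TraceSpace M Γ p b,
      HDG.IsSolution M Γ p A G T ϱ fσ fu z.1 z.2.1 z.2.2 := by
  have h := HDG.boundedData hΩo hΩr hT hϱ hG hA hcont
  exact h.existsUnique hΩr hfσ hfu fun z h1 h2 h3 h4 =>
    h.eq_zero hΩo hΩc hΩr hcont hA hD hdiv hsymm hA4a hA4b hB hA6 hM hconst hCT hrange hnull
      h1 h2 h3 h4
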